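/- Let $d\in\mathbb N$ and let $\mathbb T^d=(\mathbb R/\mathbb Z)^d$. Let $F(\rho,q)=h(\rho)+\tfrac12\kappa(\rho)|q|^2$ for $\rho>0$, $q\in\mathbb R^d$, where $h,\kappa:(0,\infty)\to\mathbb R$ are smooth, $\kappa>0$, and for some constants $\alpha_1,\alpha_2>0$ and all $\rho>0$ $$h''(\rho)\ge\alpha_1,\qquad \kappa''(\rho)>0,\qquad \kappa(\rho)-\frac{2\kappa'(\rho)^2}{\kappa''(\rho)}\ge\alpha_2 .\tag{$H_{4uc}$}$$ Consider the Euler–Korteweg system on $(0,T)\times\mathbb T^d$, $T>0$, $$\partial_t\rho+\operatorname{div}m=0,\qquad \partial_t m+\operatorname{div}\Big(\frac{m\otimes m}{\rho}\Big)=\operatorname{div}S,$$ $$S=\Big[-p(\rho)-\tfrac12(\rho\kappa'(\rho)+\kappa(\rho))|\nabla\rho|^2+\operatorname{div}(\rho\kappa(\rho)\nabla\rho)\Big]\mathbb I-\kappa(\rho)\nabla\rho\otimes\nabla\rho,\qquad p=\rho h'-h .$$ *Weak solutions.* $(\rho,m)$ with $\rho\in C([0,T];L^1(\mathbb T^d))$,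 $m\in C([0,T];L^1(\mathbb T^d)^d)$, $\rho\ge0$, $m=0$ a.e. where $\rho=0$, is a weak solution on $[0,T]$ if $\rho(t)\in W^{1,1}(\mathbb T^d)$ for all $t\in[0,T]$; $m\otimes m/\rho$, the constituents $p(\rho)+\frac12(\rho\kappa'+\kappa)|\nabla\rho|^2$, $\rho\kappa\nabla\rho$, $\kappa\nabla\rho\otimes\nabla\rho$ of $S$ and the weak divergence $\operatorname{div}(\rho\kappa\nabla\rho)$ (hence $S$) are in $L^1((0,T)\times\mathbb T^d)$; and for all $C^1$ functions $\psi,\varphi$ (scalar and vector valued) compactly supported in $[0,T)\times\mathbb T^d$ $$-\iint\rho\,\psi_t+m\cdot\nabla\psi\,dx\,dt=\int\rho(x,0)\psi(x,0)\,dx,$$ $$-\iint m\cdot\varphi_t+\frac{m\otimes m}{\rho}:\nabla\varphi-S:\nabla\varphi\,dx\,dt=\int m(x,0)\cdot\varphi(x,0)\,dx .$$ It is *dissipative* (resp. *conservative*) if moreover $e:=\frac12\frac{|m|^2}{\rho}+F(\rho,\nabla\rho)\in C([0,T];L^1(\mathbb T^d))$ and $-\iint e\,\dot\theta\,dx\,dt\le\theta(0)\int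 e|_{t=0}\,dx$ (resp. $=$) for all nonnegative Lipschitz $\theta$ with compact support in $[0,T)$. (A dissipative or conservative weak solution on $[0,\infty)$ is one on $[0,T]$ for every $T$.) *Strong solutions.* $(\bar\rho,\bar u)$ is a strong conservative solution if $(\bar\rho,\bar m)$, $\bar m=\bar\rho\bar u$, is a conservative weak solution on $[0,T]$ and $\bar\rho$, $\partial_t\bar\rho$, $\partial_t\partial_i\bar\rho$, $\partial_i\partial_j\bar\rho$, $\partial_i\partial_j\partial_k\bar\rho$, $\bar u$, $\partial_t\bar u$, $\partial_j\bar u$, $\partial_j\partial_k\bar u$ are in $L^\infty((0,T)\times\mathbb T^d)$ ($\bar\rho,\bar u$ being the continuous representatives on $[0,T]\times\mathbb T^d$). **Theorem.** Let $0<\rho_{min}$, $\rho_{max}$, $0<\delta$, $\bar R$ and $L$ be real numbers. There is a constant $C>0$, depending only on $d,h,\kappa,T,\rho_{min},\rho_{max},\delta,\bar R,L$, such that the following holds. Let $(\bar\rho,\bar u)$ be a strong conservative solution with $\delta\le\bar\rho\le\bar R$ on $[0,T]\times\mathbb T^d$ and $|\nabla\bar\rho|,\ |\partial_j\bar u_i|,\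 |\partial_j\partial_k\bar u_i|\le L$ a.e. Let $(\rho,m)$ be a dissipative or conservative weak solution with $\sup_{t\in(0,T)}\int\rho\,dx<\infty$, $\sup_{t\in(0,T)}\int e\,dx<\infty$ and $\rho_{min}\le\rho\le\rho_{max}$ for a.e. $(t,x)\in(0,T)\times\mathbb T^d$. Set $$\Phi(t)=\int_{\mathbb T^d}\Big(\tfrac12\rho\Big|\frac m\rho-\frac{\bar m}{\bar\rho}\Big|^2+|\rho-\bar\rho|^2+|\nabla\rho-\nabla\bar\rho|^2\Big)dx\,\Big|_t .$$ Then $\Phi(t)$ is finite and $$\Phi(t)\le C\,\Phi(0),\qquad t\in[0,T].$$ In particular, if $\Phi(0)=0$ then $\sup_{t\in[0,T]}\Phi(t)=0$, and weak–strong uniqueness holds: if $\rho(0)=\bar\rho(0)$ and $m(0)=\bar m(0)$ a.e., then $\rho(t)=\bar\rho(t)$ and $m(t)=\bar m(t)$ a.e. for every $t\in[0,T]$. -/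

import Mathlib

open MeasureTheory Set Filter Topology
open scoped ContDiff

noncomputable section

namespace EulerKorteweg

/-- The `d`-dimensional torus `(ℝ/ℤ)^d`, with its normalized Lebesgue measure. -/
abbrev Torus (d : ℕ) : Type := UnitAddTorus (Fin d)

/-- Euclidean `ℝ^d`. -/
abbrev Vec (d : ℕ) : Type := EuclideanSpace ℝ (Fin d)

/-- Lebesgue measure on the space-time slab `(0,T) × 𝕋^d`. -/
def slab (d : ℕ) (T : ℝ) : Measure (ℝ × Torus d) :=
  (volume.restrict (Ioo 0 T)).prod volume

/-! ### Classical derivatives and test functions -/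

/-- Partial derivative in the `i`-th coordinate of a function on the torus. -/
def spaceDeriv {d : ℕ} (i : Fin d) (f : Torus d → ℝ) (x : Torus d) : ℝ :=
  deriv (fun s : ℝ => f (x + Pi.single i (s : UnitAddCircle))) 0

/-- Partial derivative of a function of `(t, x)`: `none` is the time direction, `some i` is the
`i`-th space direction. -/
def partialDeriv {d : ℕ} (a : Option (Fin d)) (f : ℝ → Torus d → ℝ) (t : ℝ) (x : Torus d) : ℝ :=
  match a with
  | none => deriv (fun s : ℝ => f s x) t
  | some i => spaceDeriv i (f t) x

/-- `C^1` functions on the torus: the periodic lift to `ℝ^d` is `C^1`. -/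
def IsC1 {d : ℕ} (φ : Torus d → ℝ) : Prop :=
  ContDiff ℝ 1 (fun y : Fin d → ℝ => φ (fun i => (y i : UnitAddCircle)))

/-- `C^1` test functions of `(t, x)` with compact support in `[0,T) × 𝕋^d` when restricted to
nonnegative times; they need not vanish at `t = 0`. -/
def IsTest {d : ℕ} (T : ℝ) (φ : ℝ → Torus d → ℝ) : Prop :=
  ContDiff ℝ 1 (fun z : ℝ × (Fin d → ℝ) => φ z.1 (fun i => (z.2 i : UnitAddCircle))) ∧
    ∃ b < T, ∀ t, b ≤ t → ∀ x, φ t x = 0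

/-- `C^1` test functions with compact support in the open slab `(0,T) × 𝕋^d`. -/
def IsInteriorTest {d : ℕ} (T : ℝ) (φ : ℝ → Torus d → ℝ) : Prop :=
  IsTest T φ ∧ ∃ a > 0, ∀ t, t ≤ a → ∀ x, φ t x = 0

/-! ### Weak derivatives -/

/-- `g` is the weak (distributional) gradient of `f` on the torus, both being in `L^1`. -/
structure IsWeakGrad {d : ℕ} (f : Torus d → ℝ) (g : Torus d → Vec d) : Prop where
  integrable : Integrable f
  integrable_grad : Integrable g
  parts : ∀ φ : Torus d → ℝ, IsC1 φ → ∀ i : Fin d,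
    ∫ x, f x * spaceDeriv i φ x = -∫ x, g x i * φ x

/-- `g` is the weak partial derivative of `f` in the direction `a` on `(0,T) × 𝕋^d`. -/
structure HasWeakPartial {d : ℕ} (T : ℝ) (a : Option (Fin d)) (f g : ℝ → Torus d → ℝ) :
    Prop where
  integrable : Integrable (Function.uncurry f) (slab d T)
  integrable_deriv : Integrable (Function.uncurry g) (slab d T)
  parts : ∀ φ : ℝ → Torus d → ℝ, IsInteriorTest T φ →
    ∫ t in Ioo 0 T, ∫ x, f t x * partialDeriv a φ t x = -∫ t in Ioo 0 T, ∫ x, g t x * φ t x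

/-- The iterated weak derivative of `f`, taken in the directions listed in `l` (head first),
exists on `(0,T) × 𝕋^d` and is bounded by `L` almost everywhere. -/
def WeakDerivBound {d : ℕ} (T L : ℝ) : List (Option (Fin d)) → (ℝ → Torus d → ℝ) → Prop
  | [], f => AEStronglyMeasurable (Function.uncurry f) (slab d T) ∧
      ∀ᵐ z ∂(slab d T), |f z.1 z.2| ≤ L
  | a :: l, f => ∃ g, HasWeakPartial T a f g ∧ WeakDerivBound T L l g

/-- The iterated weak derivative of `f` in the directions `l` is in `L^∞((0,T) × 𝕋^d)`. -/
def WeakDerivBounded {d : ℕ} (T : ℝ) (l : List (Option (Fin d))) (f : ℝ → Torus d → ℝ) : Prop :=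
  ∃ L, WeakDerivBound T L l f

/-- `f ∈ C([0,T]; L^1(𝕋^d))`. -/
def ContinuousInL1 {d : ℕ} {E : Type*} [NormedAddCommGroup E] (T : ℝ)
    (f : ℝ → Torus d → E) : Prop :=
  (∀ t ∈ Icc 0 T, Integrable (f t)) ∧
    ∀ t ∈ Icc 0 T, Tendsto (fun s => ∫ x, ‖f s x - f t x‖) (𝓝[Icc 0 T] t) (𝓝 0)

/-! ### Energy and stress -/

/-- The energy density `F(ρ,q) = h(ρ) + ½ κ(ρ) |q|²`. -/
def energyF {d : ℕ} (h κ : ℝ → ℝ) (r : ℝ) (q : Vec d) : ℝ :=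
  h r + 1 / 2 * κ r * ‖q‖ ^ 2

/-- The total energy density `½ |m|²/ρ + F(ρ,q)`. -/
def totalEnergy {d : ℕ} (h κ : ℝ → ℝ) (r : ℝ) (q m : Vec d) : ℝ :=
  1 / 2 * (‖m‖ ^ 2 / r) + energyF h κ r q

/-- `s = ρ F_ρ + q · F_q - F = p(ρ) + ½ (ρ κ'(ρ) + κ(ρ)) |q|²`, where `p = ρ h' - h`. -/
def stressScalar {d : ℕ} (h κ : ℝ → ℝ) (r : ℝ) (q : Vec d) : ℝ :=
  (r * deriv h r - h r) + 1 / 2 * (r * deriv κ r + κ r) * ‖q‖ ^ 2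

/-- `ρ F_q = ρ κ(ρ) q`. -/
def stressVector {d : ℕ} (κ : ℝ → ℝ) (r : ℝ) (q : Vec d) : Vec d :=
  (r * κ r) • q

/-- `H = q ⊗ F_q = κ(ρ) q ⊗ q`. -/
def stressTensor {d : ℕ} (κ : ℝ → ℝ) (r : ℝ) (q : Vec d) (i j : Fin d) : ℝ :=
  κ r * q i * q j

/-- The Korteweg stress `S = (-s + D) I - H`, where `D` stands for `div (ρ F_q)`. -/
def kortewegStress {d : ℕ} (h κ : ℝ → ℝ) (r : ℝ) (q : Vec d) (D : ℝ) (i j : Fin d) : ℝ :=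
  (if i = j then -stressScalar h κ r q + D else 0) - stressTensor κ r q i j

/-- The uniform convexity hypotheses on `F = h(ρ) + ½ κ(ρ)|q|²`, for smooth `h`, `κ` on the
half-line `ρ > 0`. -/
structure UniformConvexity (h κ : ℝ → ℝ) : Prop where
  smooth_h : ContDiffOn ℝ ∞ h (Ioi 0)
  smooth_κ : ContDiffOn ℝ ∞ κ (Ioi 0)
  κ_pos : ∀ r > 0, 0 < κ r
  κ_convex : ∀ r > 0, 0 < deriv (deriv κ) r
  h_uniform : ∃ α > 0, ∀ r > 0, α ≤ deriv (deriv h) r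
  κ_uniform : ∃ α > 0, ∀ r > 0, α ≤ κ r - 2 * (deriv κ r) ^ 2 / deriv (deriv κ) r

/-! ### Solutions -/

/-- `(ρ, m)` is a weak solution on `[0,T]` of
`∂_t ρ + div m = 0`, `∂_t m + div (m ⊗ m / ρ) = div S`.

The functions `q` and `D` are determined almost everywhere by `ρ`: `q(t)` is the weak gradient
`∇ρ(t)`, and `D` is the weak divergence `div (ρ κ(ρ) ∇ρ)`, so that
`S = kortewegStress h κ ρ ∇ρ D`. Solutions on `[0,∞)` are those that are solutions on `[0,T]` for
all `T`. -/
structure IsWeakSolution {d : ℕ} (h κ : ℝ → ℝ) (T : ℝ) (ρ : ℝ → Torus d → ℝ)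
    (q : ℝ → Torus d → Vec d) (D : ℝ → Torus d → ℝ) (m : ℝ → Torus d → Vec d) : Prop where
  measurable_ρ : AEStronglyMeasurable (Function.uncurry ρ) (slab d T)
  measurable_m : AEStronglyMeasurable (Function.uncurry m) (slab d T)
  measurable_q : AEStronglyMeasurable (Function.uncurry q) (slab d T)
  continuous_ρ : ContinuousInL1 T ρ
  continuous_m : ContinuousInL1 T m
  nonneg : ∀ t ∈ Icc 0 T, ∀ᵐ x, 0 ≤ ρ t x
  /-- the convention that makes `m ⊗ m / ρ` and `|m|² / ρ` meaningful at vacuum -/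
  vacuum : ∀ t ∈ Icc 0 T, ∀ᵐ x, ρ t x = 0 → m t x = 0
  grad : ∀ t ∈ Icc 0 T, IsWeakGrad (ρ t) (q t)
  integrable_convection : ∀ i j : Fin d,
    Integrable (fun z : ℝ × Torus d => m z.1 z.2 i * m z.1 z.2 j / ρ z.1 z.2) (slab d T)
  integrable_scalar :
    Integrable (fun z : ℝ × Torus d => stressScalar h κ (ρ z.1 z.2) (q z.1 z.2)) (slab d T)
  integrable_vector :
    Integrable (fun z : ℝ × Torus d => stressVector κ (ρ z.1 z.2) (q z.1 z.2)) (slab d T)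
  integrable_tensor : ∀ i j : Fin d,
    Integrable (fun z : ℝ × Torus d => stressTensor κ (ρ z.1 z.2) (q z.1 z.2) i j) (slab d T)
  integrable_div : Integrable (Function.uncurry D) (slab d T)
  div_vector : ∀ φ : ℝ → Torus d → ℝ, IsTest T φ →
    ∫ t in Ioo 0 T, ∫ x, ∑ i, stressVector κ (ρ t x) (q t x) i * spaceDeriv i (φ t) x =
      -∫ t in Ioo 0 T, ∫ x, D t x * φ t x
  mass : ∀ ψ : ℝ → Torus d → ℝ, IsTest T ψ →
    -∫ t in Ioo 0 T, ∫ x,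
        (ρ t x * partialDeriv none ψ t x + ∑ i, m t x i * spaceDeriv i (ψ t) x) =
      ∫ x, ρ 0 x * ψ 0 x
  momentum : ∀ φ : Fin d → ℝ → Torus d → ℝ, (∀ i, IsTest T (φ i)) →
    -∫ t in Ioo 0 T, ∫ x,
        ((∑ i, m t x i * partialDeriv none (φ i) t x) +
          (∑ i, ∑ j, m t x i * m t x j / ρ t x * spaceDeriv j (φ i t) x) -
          ∑ i, ∑ j, kortewegStress h κ (ρ t x) (q t x) (D t x) i j * spaceDeriv j (φ i t) x) =
      ∫ x, ∑ i, m 0 x i * φ i 0 x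

/-- Nonnegative Lipschitz functions of time (that is, `W^{1,∞}`) with compact support in
`[0,T)`. -/
def IsTimeTest (T : ℝ) (θ : ℝ → ℝ) : Prop :=
  (∃ K, LipschitzWith K θ) ∧ (∀ t, 0 ≤ θ t) ∧ ∃ b < T, ∀ t, b ≤ t → θ t = 0

/-- Dissipative weak solutions: weak solutions satisfying the integrated energy inequality. -/
structure IsDissipative {d : ℕ} (h κ : ℝ → ℝ) (T : ℝ) (ρ : ℝ → Torus d → ℝ)
    (q : ℝ → Torus d → Vec d) (D : ℝ → Torus d → ℝ) (m : ℝ → Torus d → Vec d) : Prop where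
  weak : IsWeakSolution h κ T ρ q D m
  continuous_energy : ContinuousInL1 T (fun t x => totalEnergy h κ (ρ t x) (q t x) (m t x))
  energy_le : ∀ θ : ℝ → ℝ, IsTimeTest T θ →
    -∫ t in Ioo 0 T, (∫ x, totalEnergy h κ (ρ t x) (q t x) (m t x)) * deriv θ t ≤
      (∫ x, totalEnergy h κ (ρ 0 x) (q 0 x) (m 0 x)) * θ 0

/-- Conservative weak solutions: weak solutions satisfying the integrated energy identity. -/
structure IsConservative {d : ℕ} (h κ : ℝ → ℝ) (T : ℝ) (ρ : ℝ → Torus d → ℝ)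
    (q : ℝ → Torus d → Vec d) (D : ℝ → Torus d → ℝ) (m : ℝ → Torus d → Vec d) : Prop where
  weak : IsWeakSolution h κ T ρ q D m
  continuous_energy : ContinuousInL1 T (fun t x => totalEnergy h κ (ρ t x) (q t x) (m t x))
  energy_eq : ∀ θ : ℝ → ℝ, IsTimeTest T θ →
    -∫ t in Ioo 0 T, (∫ x, totalEnergy h κ (ρ t x) (q t x) (m t x)) * deriv θ t =
      (∫ x, totalEnergy h κ (ρ 0 x) (q 0 x) (m 0 x)) * θ 0

/-- The momentum `ρ u`. -/
def momentum {d : ℕ} (ρ : ℝ → Torus d → ℝ) (u : ℝ → Torus d → Vec d) (t : ℝ) (x : Torus d) :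
    Vec d :=
  ρ t x • u t x

/-- Strong conservative solutions `(ρ, u)` on `[0,T]`: `(ρ, ρu)` is a conservative solution, and
`ρ`, `∂_t ρ`, `∂_t ∂_i ρ`, `∂_i ∂_j ρ`, `∂_i ∂_j ∂_k ρ`, `u`, `∂_t u`, `∂_j u`, `∂_j ∂_k u` are in
`L^∞((0,T) × 𝕋^d)`. As `ρ` and `u` are then Lipschitz up to modification on a null set, the
continuous representatives on `[0,T] × 𝕋^d` are taken. -/
structure IsStrongSolution {d : ℕ} (h κ : ℝ → ℝ) (T : ℝ) (ρ : ℝ → Torus d → ℝ)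
    (q : ℝ → Torus d → Vec d) (D : ℝ → Torus d → ℝ) (u : ℝ → Torus d → Vec d) : Prop where
  conservative : IsConservative h κ T ρ q D (momentum ρ u)
  continuousOn_ρ : ContinuousOn (Function.uncurry ρ) (Icc 0 T ×ˢ univ)
  continuousOn_u : ContinuousOn (Function.uncurry u) (Icc 0 T ×ˢ univ)
  ρ_bdd : WeakDerivBounded T [] ρ
  ρ_t : WeakDerivBounded T [none] ρ
  ρ_xt : ∀ i, WeakDerivBounded T [some i, none] ρ
  ρ_xx : ∀ i j, WeakDerivBounded T [some i, some j] ρ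
  ρ_xxx : ∀ i j k, WeakDerivBounded T [some i, some j, some k] ρ
  u_bdd : ∀ i, WeakDerivBounded T [] (fun t x => u t x i)
  u_t : ∀ i, WeakDerivBounded T [none] (fun t x => u t x i)
  u_x : ∀ i j, WeakDerivBounded T [some j] (fun t x => u t x i)
  u_xx : ∀ i j k, WeakDerivBounded T [some j, some k] (fun t x => u t x i)

/-! ### The distance -/

/-- The integrand `½ ρ |m/ρ - m'/ρ'|² + |ρ - ρ'|² + |∇ρ - ∇ρ'|²` of `Φ`, where `q` and `q'` are the
gradients of `ρ` and `ρ'`. -/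
def distDensity {d : ℕ} (ρ : ℝ → Torus d → ℝ) (q m : ℝ → Torus d → Vec d)
    (ρ' : ℝ → Torus d → ℝ) (q' m' : ℝ → Torus d → Vec d) (t : ℝ) (x : Torus d) : ℝ :=
  1 / 2 * ρ t x * ‖(ρ t x)⁻¹ • m t x - (ρ' t x)⁻¹ • m' t x‖ ^ 2 +
    |ρ t x - ρ' t x| ^ 2 + ‖q t x - q' t x‖ ^ 2

/-- `Φ(t)`, the integral over the torus of `distDensity`. -/
def distPhi {d : ℕ} (ρ : ℝ → Torus d → ℝ) (q m : ℝ → Torus d → Vec d)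
    (ρ' : ℝ → Torus d → ℝ) (q' m' : ℝ → Torus d → Vec d) (t : ℝ) : ℝ :=
  ∫ x, distDensity ρ q m ρ' q' m' t x

end EulerKorteweg

end

open MeasureTheory Set Filter Topology
open scoped ContDiff

noncomputable section

namespace EulerKorteweg

variable {d : ℕ}

section

/-! ### Calculus of `C^1` functions on the torus -/

/-! The method is that of relative energy. Let `(r, u)` be the strong solution and `y = ∇r`. Regard
the total energy as a function of `(ρ, m, q)` and subtract its first-order Taylor polynomial at the
strong state `(r, ru, y)`. What remains is `½ρ|m/ρ - u|²` plus the linearization remainder of `F`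
(`relEnergy_eq`); the coefficients of the polynomial are the multipliers `u` for `m`, `h'(r) +
½κ'(r)|y|² - ½|u|²` for `ρ` and `κ(r)y` for `q`. The hypotheses on `h` and `κ` make `F` uniformly
convex in `(ρ, q)`: in the second derivative along a segment with increments `f`, `g`, completing a
square with weight `κ''` leaves at least `h'' f² + (κ - 2κ'²/κ'')|g|²` (`relF_lower`). As `ρ` and
`r` stay in a compact part of `(0,∞)` and `y` is bounded, the relative energy is comparable with the
integrand of `Φ` from both sides (`exists_pointwise_bounds`).

The energy of the weak solution does not increase and that of the strong one is constant, so the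
relative energy changes by at most minus the change of the linear part, which the weak equations
determine (`Multiplier.evolution`). When the same computation for the strong solution is subtracted,
all terms linear in the differences cancel, up to the divergence of `(ρ - r)` times the Lie bracket
of `u` and `κ(r)y`, which integrates to zero (`rate_algebra`, `integral_nullForm`). There remain the
contraction of `ρ(m/ρ-u)⊗(m/ρ-u)` with `∇u` and the linearization remainders of the scalar, vector
and tensor parts of the stress, contracted with `div u`, `∇div u` and `∇u`. These parts are
polynomials of degree at most two in `q`, so their remainders are controlled quadratically without
any bound on `q`. Thus the rate is at most a constant times the relative energy, and
`gronwall_of_rate` concludes.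

The analytic difficulty is that the multipliers are only bounded with bounded weak derivatives, not
`C^1`. They are mollified in space by a kernel that is a trigonometric polynomial, hence a finite
sum of products `p(x)q(y)`. A pairing with a mollified multiplier is then a finite sum of products
of absolutely continuous functions of time, to which the one-dimensional product rule applies; the
limit is taken by moving the mollifier onto the integrable factor (`pairing_of_kernel`). Moreover
the kernel factors form a countable family, so a weak identity on the slab holds, at almost every
time, for all admissible multipliers at once (`ae_flux_eq_zero`). The weak divergence `D` is paired
with `div u` and integrated by parts, which is how second derivatives of `u` enter the estimate. -/

/-- The covering map `ℝ^d → 𝕋^d`. -/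
def toTorus (y : Fin d → ℝ) : Torus d := fun i => (y i : UnitAddCircle)

/-- Openness matters here: a product of quotient maps need not be a quotient map, a product of open
ones is. Continuity on the torus is thereby tested on `ℝ^d`. -/
lemma isOpenQuotientMap_toTorus : IsOpenQuotientMap (toTorus : (Fin d → ℝ) → Torus d) :=
  IsOpenQuotientMap.piMap (fun _ => QuotientAddGroup.isOpenQuotientMap_mk)

lemma toTorus_add_single (y : Fin d → ℝ) (i : Fin d) (s : ℝ) :
    toTorus y + Pi.single i (s : UnitAddCircle) = toTorus (y + s • Pi.single i 1) := by
  ext j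
  by_cases hj : j = i
  · subst hj; simp [toTorus]
  · simp [toTorus, hj]

/-- Smooth functions on the torus. -/
def IsSmooth (φ : Torus d → ℝ) : Prop := ContDiff ℝ ∞ (fun y : Fin d → ℝ => φ (toTorus y))

lemma IsSmooth.isC1 {φ : Torus d → ℝ} (h : IsSmooth φ) : IsC1 φ :=
  ContDiff.of_le h (by exact_mod_cast le_top)

lemma IsC1.continuous {φ : Torus d → ℝ} (h : IsC1 φ) : Continuous φ :=
  isOpenQuotientMap_toTorus.isQuotientMap.continuous_iff.2 (ContDiff.continuous h)

lemma hasDerivAt_of_lift {φ : Torus d → ℝ} {y : Fin d → ℝ}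
    (h : DifferentiableAt ℝ (fun y : Fin d → ℝ => φ (toTorus y)) y) (i : Fin d) :
    HasDerivAt (fun s : ℝ => φ (toTorus y + Pi.single i (s : UnitAddCircle)))
      (fderiv ℝ (fun y : Fin d → ℝ => φ (toTorus y)) y (Pi.single i 1)) 0 := by
  simp_rw [toTorus_add_single]
  have h1 : HasDerivAt (fun s : ℝ => y + s • (Pi.single i 1 : Fin d → ℝ))
      ((1 : ℝ) • (Pi.single i 1 : Fin d → ℝ)) 0 :=
    ((hasDerivAt_id (0 : ℝ)).smul_const _).const_add _
  have h2 : HasFDerivAt (fun y : Fin d → ℝ => φ (toTorus y))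
      (fderiv ℝ (fun y : Fin d → ℝ => φ (toTorus y)) y)
      (y + (0 : ℝ) • (Pi.single i 1 : Fin d → ℝ)) := by simpa using h.hasFDerivAt
  have h3 := h2.comp_hasDerivAt (0 : ℝ) h1
  rw [one_smul] at h3
  exact h3

lemma spaceDeriv_toTorus {φ : Torus d → ℝ} {y : Fin d → ℝ}
    (h : DifferentiableAt ℝ (fun y : Fin d → ℝ => φ (toTorus y)) y) (i : Fin d) :
    spaceDeriv i φ (toTorus y) =
      fderiv ℝ (fun y : Fin d → ℝ => φ (toTorus y)) y (Pi.single i 1) :=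
  (hasDerivAt_of_lift h i).deriv

lemma IsC1.differentiable {φ : Torus d → ℝ} (h : IsC1 φ) :
    Differentiable ℝ (fun y : Fin d → ℝ => φ (toTorus y)) := ContDiff.differentiable h one_ne_zero

lemma IsC1.hasDerivAt {φ : Torus d → ℝ} (h : IsC1 φ) (i : Fin d) (x : Torus d) :
    HasDerivAt (fun s : ℝ => φ (x + Pi.single i (s : UnitAddCircle))) (spaceDeriv i φ x) 0 := by
  obtain ⟨y, rfl⟩ := isOpenQuotientMap_toTorus.surjective x
  rw [spaceDeriv_toTorus (h.differentiable y)]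
  exact hasDerivAt_of_lift (h.differentiable y) i

lemma IsC1.hasDerivAt_shift {φ : Torus d → ℝ} (h : IsC1 φ) (i : Fin d) (x : Torus d) (s : ℝ) :
    HasDerivAt (fun s : ℝ => φ (x + Pi.single i (s : UnitAddCircle)))
      (spaceDeriv i φ (x + Pi.single i (s : UnitAddCircle))) s := by
  have h1 := h.hasDerivAt i (x + Pi.single i (s : UnitAddCircle))
  have h2 : HasDerivAt (fun r : ℝ => r - s) 1 s := (hasDerivAt_id s).sub_const s
  -- The base point `0` is written as `s - s`, so that the derivative at the translated point
  -- composes with `r ↦ r - s`.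
  rw [← sub_self s] at h1
  have h3 := HasDerivAt.comp (h := fun r : ℝ => r - s) s h1 h2
  rw [mul_one] at h3
  refine h3.congr_of_eventuallyEq (Eventually.of_forall fun r => ?_)
  simp only [Function.comp]
  rw [add_assoc, ← Pi.single_add]
  congr 3
  rw [← AddCircle.coe_add]
  congr 1
  ring

lemma IsC1.continuous_spaceDeriv {φ : Torus d → ℝ} (h : IsC1 φ) (i : Fin d) :
    Continuous (spaceDeriv i φ) := by
  refine isOpenQuotientMap_toTorus.isQuotientMap.continuous_iff.2 ?_
  have : spaceDeriv i φ ∘ toTorus =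
      fun y => fderiv ℝ (fun y : Fin d → ℝ => φ (toTorus y)) y (Pi.single i 1) := by
    ext y; exact spaceDeriv_toTorus (h.differentiable y) i
  rw [this]
  exact (ContDiff.continuous_fderiv h one_ne_zero).clm_apply continuous_const

lemma IsSmooth.spaceDeriv {φ : Torus d → ℝ} (h : IsSmooth φ) (i : Fin d) :
    IsSmooth (spaceDeriv i φ) := by
  have : (fun y => EulerKorteweg.spaceDeriv i φ (toTorus y)) =
      fun y => fderiv ℝ (fun y : Fin d → ℝ => φ (toTorus y)) y (Pi.single i 1) := by
    ext y; exact spaceDeriv_toTorus (h.isC1.differentiable y) i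
  unfold IsSmooth
  rw [this]
  exact (ContDiff.fderiv_right (m := ∞) h (by simp)).clm_apply contDiff_const

lemma IsC1.mul {φ ψ : Torus d → ℝ} (h : IsC1 φ) (h' : IsC1 ψ) : IsC1 (fun x => φ x * ψ x) :=
  ContDiff.mul h h'

lemma IsSmooth.mul {φ ψ : Torus d → ℝ} (h : IsSmooth φ) (h' : IsSmooth ψ) :
    IsSmooth (fun x => φ x * ψ x) := ContDiff.mul h h'

lemma IsSmooth.const (c : ℝ) : IsSmooth (fun _ : Torus d => c) := contDiff_const

lemma IsC1.const (c : ℝ) : IsC1 (fun _ : Torus d => c) := contDiff_const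

lemma IsC1.sum {ι : Type*} {s : Finset ι} {φ : ι → Torus d → ℝ} (h : ∀ i ∈ s, IsC1 (φ i)) :
    IsC1 (fun x => ∑ i ∈ s, φ i x) := ContDiff.sum h

lemma IsSmooth.sum {ι : Type*} {s : Finset ι} {φ : ι → Torus d → ℝ}
    (h : ∀ i ∈ s, IsSmooth (φ i)) : IsSmooth (fun x => ∑ i ∈ s, φ i x) := ContDiff.sum h

lemma spaceDeriv_mul {φ ψ : Torus d → ℝ} (h : IsC1 φ) (h' : IsC1 ψ) (i : Fin d) (x : Torus d) :
    spaceDeriv i (fun x => φ x * ψ x) x = spaceDeriv i φ x * ψ x + φ x * spaceDeriv i ψ x := by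
  have := ((h.hasDerivAt i x).fun_mul (h'.hasDerivAt i x)).deriv
  simpa [spaceDeriv] using this

lemma spaceDeriv_const_mul {φ : Torus d → ℝ} (c : ℝ) (i : Fin d)
    (x : Torus d) : spaceDeriv i (fun x => c * φ x) x = c * spaceDeriv i φ x := by
  simp [spaceDeriv]

lemma spaceDeriv_sum {ι : Type*} {s : Finset ι} {φ : ι → Torus d → ℝ} (h : ∀ a ∈ s, IsC1 (φ a))
    (i : Fin d) (x : Torus d) :
    spaceDeriv i (fun x => ∑ a ∈ s, φ a x) x = ∑ a ∈ s, spaceDeriv i (φ a) x :=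
  (HasDerivAt.fun_sum fun a ha => (h a ha).hasDerivAt i x).deriv

lemma exists_bound_of_continuous {φ : Torus d → ℝ} (h : Continuous φ) : ∃ M, 0 ≤ M ∧ ∀ x, |φ x| ≤ M := by
  obtain ⟨M, hM⟩ := isCompact_univ.exists_bound_of_continuousOn h.continuousOn
  exact ⟨M, (abs_nonneg _).trans (hM 0 (mem_univ _)), fun x => hM x (mem_univ _)⟩

lemma _root_.Continuous.integrable_torus {φ : Torus d → ℝ} (h : Continuous φ) : Integrable φ := by
  obtain ⟨M, -, hM⟩ := exists_bound_of_continuous h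
  exact Integrable.of_bound h.aestronglyMeasurable M (Eventually.of_forall hM)

lemma continuous_shift {f : Torus d → ℝ} (hf : Continuous f) (i : Fin d) (s : ℝ) :
    Continuous fun x : Torus d => f (x + Pi.single i (s : UnitAddCircle)) :=
  hf.comp (continuous_id.add continuous_const)

/-- By translation invariance the integral of a shifted function does not depend on the shift; its
derivative in the shift, taken under the integral sign, is the integral of the partial derivative.
-/
lemma IsC1.integral_spaceDeriv {φ : Torus d → ℝ} (h : IsC1 φ) (i : Fin d) :
    ∫ x, spaceDeriv i φ x = 0 := by
  obtain ⟨M, hM0, hM⟩ := exists_bound_of_continuous (h.continuous_spaceDeriv i)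
  have key : HasDerivAt (fun s : ℝ => ∫ x : Torus d, φ (x + Pi.single i (s : UnitAddCircle)))
      (∫ x : Torus d, spaceDeriv i φ (x + Pi.single i ((0 : ℝ) : UnitAddCircle))) 0 := by
    refine (hasDerivAt_integral_of_dominated_loc_of_deriv_le (s := univ) (bound := fun _ => M)
      (F := fun (s : ℝ) (x : Torus d) => φ (x + Pi.single i (s : UnitAddCircle)))
      (F' := fun (s : ℝ) (x : Torus d) => spaceDeriv i φ (x + Pi.single i (s : UnitAddCircle)))
      univ_mem ?_ ?_ ?_ ?_ ?_ ?_).2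
    · exact Eventually.of_forall fun s => (continuous_shift h.continuous i s).aestronglyMeasurable
    · exact (continuous_shift h.continuous i 0).integrable_torus
    · exact (continuous_shift (h.continuous_spaceDeriv i) i 0).aestronglyMeasurable
    · exact Eventually.of_forall fun x s _ => hM _
    · exact integrable_const M
    · exact Eventually.of_forall fun x s _ => h.hasDerivAt_shift i x s
  have h2 : (fun s : ℝ => ∫ x : Torus d, φ (x + Pi.single i (s : UnitAddCircle))) =
      fun _ => ∫ x, φ x := by
    ext s; exact integral_add_right_eq_self (μ := volume) φ _
  rw [h2] at key
  have h3 := key.unique (hasDerivAt_const (0 : ℝ) (∫ x, φ x))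
  rw [integral_add_right_eq_self (μ := volume) (spaceDeriv i φ)] at h3
  exact h3

lemma IsC1.integral_mul_spaceDeriv {φ ψ : Torus d → ℝ} (h : IsC1 φ) (h' : IsC1 ψ) (i : Fin d) :
    ∫ x, φ x * spaceDeriv i ψ x = -∫ x, spaceDeriv i φ x * ψ x := by
  have h0 := (h.mul h').integral_spaceDeriv i
  simp_rw [spaceDeriv_mul h h'] at h0
  have h1 := ((h.continuous_spaceDeriv i).mul h'.continuous).integrable_torus
  have h2 := (h.continuous.mul (h'.continuous_spaceDeriv i)).integrable_torus
  rw [integral_add (by exact h1) (by exact h2)] at h0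
  linarith

/-! ### Kernels that are finite sums of products -/

/-- Finite sums of products `p(x) q(y)` of smooth functions. -/
def IsSeparable (K : Torus d → Torus d → ℝ) : Prop :=
  ∃ (N : ℕ) (p q : Fin N → Torus d → ℝ), (∀ a, IsSmooth (p a)) ∧ (∀ a, IsSmooth (q a)) ∧
    ∀ x y, K x y = ∑ a, p a x * q a y

lemma IsSeparable.of_fintype {ι : Type*} [Fintype ι] {K : Torus d → Torus d → ℝ}
    {p q : ι → Torus d → ℝ} (hp : ∀ a, IsSmooth (p a)) (hq : ∀ a, IsSmooth (q a))
    (h : ∀ x y, K x y = ∑ a, p a x * q a y) : IsSeparable K := by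
  refine ⟨Fintype.card ι, fun a => p ((Fintype.equivFin ι).symm a),
    fun a => q ((Fintype.equivFin ι).symm a), fun a => hp _, fun a => hq _, fun x y => ?_⟩
  rw [h]
  exact (Equiv.sum_comp (Fintype.equivFin ι).symm fun a => p a x * q a y).symm

lemma IsSeparable.mul {K K' : Torus d → Torus d → ℝ} (h : IsSeparable K) (h' : IsSeparable K') :
    IsSeparable (fun x y => K x y * K' x y) := by
  obtain ⟨N, p, q, hp, hq, h⟩ := h
  obtain ⟨N', p', q', hp', hq', h'⟩ := h'
  refine IsSeparable.of_fintype (ι := Fin N × Fin N') (p := fun a x => p a.1 x * p' a.2 x)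
    (q := fun a x => q a.1 x * q' a.2 x) (fun a => (hp _).mul (hp' _))
    (fun a => (hq _).mul (hq' _)) fun x y => ?_
  rw [h, h', Finset.sum_mul_sum, Fintype.sum_prod_type]
  refine Finset.sum_congr rfl fun a _ => Finset.sum_congr rfl fun b _ => by ring

lemma IsSeparable.const (c : ℝ) : IsSeparable (fun _ _ : Torus d => c) :=
  IsSeparable.of_fintype (ι := Unit) (p := fun _ _ => c) (q := fun _ _ => 1)
    (fun _ => IsSmooth.const c) (fun _ => IsSmooth.const 1) (by simp)

lemma IsSeparable.pow {K : Torus d → Torus d → ℝ} (h : IsSeparable K) (n : ℕ) :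
    IsSeparable (fun x y => K x y ^ n) := by
  induction n with
  | zero => simpa using IsSeparable.const 1
  | succ n ih => simpa only [pow_succ] using ih.mul h

lemma IsSeparable.prod {ι : Type*} (s : Finset ι) {K : ι → Torus d → Torus d → ℝ}
    (h : ∀ i, IsSeparable (K i)) : IsSeparable (fun x y => ∏ i ∈ s, K i x y) := by
  classical
  induction s using Finset.induction_on with
  | empty => simpa using IsSeparable.const 1
  | insert a s ha ih => simpa only [Finset.prod_insert ha] using (h a).mul ih

/-! ### The mollifying kernel -/

/-- `cos 2πx` on the circle. -/
def circleCos (x : UnitAddCircle) : ℝ := (AddCircle.toCircle x : ℂ).re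

/-- `sin 2πx` on the circle. -/
def circleSin (x : UnitAddCircle) : ℝ := (AddCircle.toCircle x : ℂ).im

lemma circleCos_coe (y : ℝ) : circleCos (y : UnitAddCircle) = Real.cos (2 * Real.pi * y) := by
  rw [circleCos, AddCircle.toCircle_apply_mk, Circle.coe_exp, Complex.exp_ofReal_mul_I_re, div_one]

lemma circleSin_coe (y : ℝ) : circleSin (y : UnitAddCircle) = Real.sin (2 * Real.pi * y) := by
  rw [circleSin, AddCircle.toCircle_apply_mk, Circle.coe_exp, Complex.exp_ofReal_mul_I_im, div_one]

/-- The addition formula is the source of separability: it splits a function of `x - y` into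
products of functions of `x` and of `y`. -/
lemma circleCos_sub (x y : UnitAddCircle) :
    circleCos (x - y) = circleCos x * circleCos y + circleSin x * circleSin y := by
  induction x using QuotientAddGroup.induction_on with
  | H x =>
    induction y using QuotientAddGroup.induction_on with
    | H y =>
      change circleCos ((x : UnitAddCircle) - (y : UnitAddCircle)) =
        circleCos (x : UnitAddCircle) * circleCos (y : UnitAddCircle)
          + circleSin (x : UnitAddCircle) * circleSin (y : UnitAddCircle)
      rw [← AddCircle.coe_sub, circleCos_coe, circleCos_coe, circleCos_coe, circleSin_coe,
        circleSin_coe, mul_sub, Real.cos_sub]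

lemma circleCos_neg (x : UnitAddCircle) : circleCos (-x) = circleCos x := by
  induction x using QuotientAddGroup.induction_on with
  | H x =>
    change circleCos (-(x : UnitAddCircle)) = circleCos (x : UnitAddCircle)
    rw [← AddCircle.coe_neg, circleCos_coe, circleCos_coe, mul_neg, Real.cos_neg]

lemma abs_circleCos_le (x : UnitAddCircle) : |circleCos x| ≤ 1 := by
  exact (Complex.abs_re_le_norm (AddCircle.toCircle x : ℂ)).trans (Circle.norm_coe _).le

lemma circleCos_eq_one {x : UnitAddCircle} (h : circleCos x = 1) : x = 0 := by
  have h1 : ‖(AddCircle.toCircle x : ℂ)‖ = 1 := Circle.norm_coe _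
  have h2 : (AddCircle.toCircle x : ℂ) = 1 := by
    have h3 : (AddCircle.toCircle x : ℂ).im = 0 := by
      have h4 := Complex.sq_norm (AddCircle.toCircle x : ℂ)
      rw [h1, Complex.normSq_apply] at h4
      have h5 : (AddCircle.toCircle x : ℂ).re = 1 := h
      rw [h5] at h4
      nlinarith
    exact Complex.ext h h3
  apply AddCircle.injective_toCircle one_ne_zero
  rw [AddCircle.toCircle_zero]
  exact Circle.ext h2

lemma continuous_circleCos : Continuous circleCos :=
  Complex.continuous_re.comp (continuous_subtype_val.comp AddCircle.continuous_toCircle)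

lemma isSmooth_circleCos (i : Fin d) : IsSmooth (fun x : Torus d => circleCos (x i)) := by
  unfold IsSmooth toTorus
  simp_rw [circleCos_coe]
  fun_prop

lemma isSmooth_circleSin (i : Fin d) : IsSmooth (fun x : Torus d => circleSin (x i)) := by
  unfold IsSmooth toTorus
  simp_rw [circleSin_coe]
  fun_prop

/-- A nonnegative trigonometric polynomial with a unique maximum at the origin. -/
def bump (x : Torus d) : ℝ := ∏ i, (1 + circleCos (x i)) / 2

lemma continuous_bump : Continuous (bump : Torus d → ℝ) := by
  unfold bump
  refine continuous_finsetProd _ fun i _ => ?_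
  exact (continuous_const.add (continuous_circleCos.comp (continuous_apply i))).div_const _

lemma bump_nonneg (x : Torus d) : 0 ≤ bump x :=
  Finset.prod_nonneg fun i _ => by have := abs_le.1 (abs_circleCos_le (x i)); linarith

lemma bump_zero : bump (0 : Torus d) = 1 := by
  have : circleCos 0 = 1 := by simpa using circleCos_coe 0
  simp [bump, this]

lemma bump_neg (x : Torus d) : bump (-x) = bump x := by simp [bump, circleCos_neg]

/-- Strictness away from the origin is what makes the normalized powers of `bump` concentrate there.
-/
lemma bump_lt_one {x : Torus d} (hx : x ≠ 0) : bump x < 1 := by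
  obtain ⟨i, hi⟩ := Function.ne_iff.1 hx
  have hle : ∀ j, (1 + circleCos (x j)) / 2 ≤ 1 := fun j => by
    have := abs_le.1 (abs_circleCos_le (x j)); linarith
  have hnn : ∀ j, 0 ≤ (1 + circleCos (x j)) / 2 := fun j => by
    have := abs_le.1 (abs_circleCos_le (x j)); linarith
  have hlt : (1 + circleCos (x i)) / 2 < 1 := by
    have h1 := (abs_le.1 (abs_circleCos_le (x i))).2
    have h2 : circleCos (x i) ≠ 1 := fun h => hi (circleCos_eq_one h)
    have := lt_of_le_of_ne h1 h2
    linarith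
  unfold bump
  rw [← Finset.mul_prod_erase _ _ (Finset.mem_univ i)]
  calc _ ≤ (1 + circleCos (x i)) / 2 * 1 :=
        mul_le_mul_of_nonneg_left (Finset.prod_le_one (fun j _ => hnn j) fun j _ => hle j) (hnn i)
    _ < 1 := by linarith

/-- Each coordinate contributes `½ + ½ cos cos + ½ sin sin`, a sum of three products, and separable
kernels are closed under multiplication. -/
lemma isSeparable_bump : IsSeparable (fun x y : Torus d => bump (x - y)) := by
  unfold bump
  refine IsSeparable.prod _ fun i => ?_
  refine IsSeparable.of_fintype (ι := Fin 3)
    (p := ![fun _ => 1 / 2, fun x => circleCos (x i), fun x => circleSin (x i)])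
    (q := ![fun _ => 1, fun x => 1 / 2 * circleCos (x i), fun x => 1 / 2 * circleSin (x i)])
    (fun a => ?_) (fun a => ?_) fun x y => ?_
  · fin_cases a
    · exact IsSmooth.const _
    · exact isSmooth_circleCos i
    · exact isSmooth_circleSin i
  · fin_cases a
    · exact IsSmooth.const _
    · exact (IsSmooth.const _).mul (isSmooth_circleCos i)
    · exact (IsSmooth.const _).mul (isSmooth_circleSin i)
  · simp [Fin.sum_univ_three, circleCos_sub]
    ring

/-- The mollifying kernel. -/
def eta (n : ℕ) (z : Torus d) : ℝ := (∫ x : Torus d, bump x ^ n)⁻¹ * bump z ^ n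

lemma integral_bump_pos (n : ℕ) : 0 < ∫ x : Torus d, bump x ^ n := by
  have hc : Continuous fun x : Torus d => bump x ^ n := continuous_bump.pow n
  refine (hc.integral_pos_of_hasCompactSupport_nonneg_nonzero
    (HasCompactSupport.of_compactSpace _) (fun x => pow_nonneg (bump_nonneg x) n) (x := 0) ?_)
  simp [bump_zero]

lemma eta_nonneg (n : ℕ) (z : Torus d) : 0 ≤ eta n z :=
  mul_nonneg (inv_nonneg.2 (integral_bump_pos n).le) (pow_nonneg (bump_nonneg z) n)

lemma eta_neg (n : ℕ) (z : Torus d) : eta n (-z) = eta n z := by simp [eta, bump_neg]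

lemma eta_sub_comm (n : ℕ) (x y : Torus d) : eta n (x - y) = eta n (y - x) := by
  rw [← eta_neg, neg_sub]

lemma continuous_eta (n : ℕ) : Continuous (eta n : Torus d → ℝ) :=
  continuous_const.mul (continuous_bump.pow n)

lemma integral_eta (n : ℕ) : ∫ z : Torus d, eta n z = 1 := by
  unfold eta
  rw [integral_const_mul, inv_mul_cancel₀ (integral_bump_pos n).ne']

lemma isSeparable_eta (n : ℕ) : IsSeparable (fun x y : Torus d => eta n (x - y)) :=
  (IsSeparable.const _).mul (isSeparable_bump.pow n)

/-- Normalized powers of a nonnegative continuous function with a unique maximum on a compact space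
form an approximate identity at the maximum point. -/
lemma tendsto_integral_eta {g : Torus d → ℝ} (hg : Continuous g) :
    Tendsto (fun n => ∫ z, eta n z * g z) atTop (𝓝 (g 0)) := by
  have := tendsto_setIntegral_pow_smul_of_unique_maximum_of_isCompact_of_continuousOn
    (μ := (volume : Measure (Torus d))) (s := univ) (x₀ := (0 : Torus d)) isCompact_univ
    continuous_bump.continuousOn (fun y _ hy => by rw [bump_zero]; exact bump_lt_one hy)
    (fun x _ => bump_nonneg x) (by simp [bump_zero]) (by simp) hg.continuousOn
  simp only [Measure.restrict_univ, smul_eq_mul] at this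
  refine this.congr fun n => ?_
  rw [← integral_const_mul]
  simp only [eta, mul_assoc]

end

section

/-! ### Mollification -/

/-- Convolution with the mollifying kernel. -/
def mollify (n : ℕ) (f : Torus d → ℝ) (x : Torus d) : ℝ := ∫ y, eta n (x - y) * f y

/-- The number of terms in a separable representation of the kernel. -/
def kerCard (d n : ℕ) : ℕ := (isSeparable_eta (d := d) n).choose

/-- The left factors in a separable representation of the kernel. -/
def kerL (n : ℕ) : Fin (kerCard d n) → Torus d → ℝ := (isSeparable_eta n).choose_spec.choose

/-- The right factors in a separable representation of the kernel. -/
def kerR (n : ℕ) : Fin (kerCard d n) → Torus d → ℝ :=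
  (isSeparable_eta n).choose_spec.choose_spec.choose

lemma isSmooth_kerL (n : ℕ) (a : Fin (kerCard d n)) : IsSmooth (kerL n a) :=
  (isSeparable_eta n).choose_spec.choose_spec.choose_spec.1 a

lemma isSmooth_kerR (n : ℕ) (a : Fin (kerCard d n)) : IsSmooth (kerR n a) :=
  (isSeparable_eta n).choose_spec.choose_spec.choose_spec.2.1 a

lemma eta_sub_eq_sum (n : ℕ) (x y : Torus d) : eta n (x - y) = ∑ a, kerL n a x * kerR n a y :=
  (isSeparable_eta n).choose_spec.choose_spec.choose_spec.2.2 x y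

lemma IsSmooth.continuous {φ : Torus d → ℝ} (h : IsSmooth φ) : Continuous φ := h.isC1.continuous

lemma _root_.MeasureTheory.Integrable.continuous_mul {f g : Torus d → ℝ} (hf : Integrable f)
    (hg : Continuous g) : Integrable (fun x => g x * f x) := by
  obtain ⟨M, -, hM⟩ := exists_bound_of_continuous hg
  exact hf.bdd_mul hg.aestronglyMeasurable (Eventually.of_forall hM)

lemma _root_.MeasureTheory.Integrable.mul_continuous {f g : Torus d → ℝ} (hf : Integrable f)
    (hg : Continuous g) : Integrable (fun x => f x * g x) := by
  simpa only [mul_comm] using hf.continuous_mul hg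

lemma mollify_eq_sum {f : Torus d → ℝ} (hf : Integrable f) (n : ℕ) (x : Torus d) :
    mollify n f x = ∑ a, kerL n a x * ∫ y, kerR n a y * f y := by
  unfold mollify
  simp_rw [eta_sub_eq_sum, Finset.sum_mul, mul_assoc]
  rw [integral_finsetSum _ fun a _ =>
    (hf.continuous_mul (isSmooth_kerR n a).continuous).const_mul _]
  simp_rw [integral_const_mul]

/-- Since the kernel is even, the left and right factors may be exchanged; this gives the second
expansion needed for self-adjointness. -/
lemma mollify_eq_sum' {f : Torus d → ℝ} (hf : Integrable f) (n : ℕ) (x : Torus d) :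
    mollify n f x = ∑ a, kerR n a x * ∫ y, kerL n a y * f y := by
  unfold mollify
  have e : ∀ y, eta n (x - y) * f y = ∑ a, kerR n a x * (kerL n a y * f y) := fun y => by
    rw [eta_sub_comm, eta_sub_eq_sum, Finset.sum_mul]
    exact Finset.sum_congr rfl fun a _ => by ring
  simp_rw [e]
  rw [integral_finsetSum _ fun a _ =>
    (hf.continuous_mul (isSmooth_kerL n a).continuous).const_mul _]
  simp_rw [integral_const_mul]

lemma isSmooth_mollify {f : Torus d → ℝ} (hf : Integrable f) (n : ℕ) : IsSmooth (mollify n f) := by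
  have : mollify n f = fun x => ∑ a, kerL n a x * ∫ y, kerR n a y * f y :=
    funext fun x => mollify_eq_sum hf n x
  rw [this]
  exact IsSmooth.sum fun a _ => (isSmooth_kerL n a).mul (IsSmooth.const _)

lemma continuous_eta_sub (n : ℕ) (x : Torus d) : Continuous fun y => eta n (x - y) :=
  (continuous_eta n).comp (continuous_const.sub continuous_id)

lemma integral_eta_sub (n : ℕ) (x : Torus d) : ∫ y, eta n (x - y) = 1 := by
  simp_rw [eta_sub_comm n x]
  rw [integral_sub_right_eq_self (μ := volume) (eta n), integral_eta]

lemma abs_mollify_le {f : Torus d → ℝ} {M : ℝ} (hf : Integrable f)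
    (h : ∀ᵐ x, |f x| ≤ M) (n : ℕ) (x : Torus d) : |mollify n f x| ≤ M := by
  unfold mollify
  calc |∫ y, eta n (x - y) * f y| ≤ ∫ y, |eta n (x - y) * f y| := abs_integral_le_integral_abs
    _ ≤ ∫ y, eta n (x - y) * M := by
        refine integral_mono_ae (hf.continuous_mul (continuous_eta_sub n x)).abs
          ((continuous_eta_sub n x).mul continuous_const).integrable_torus ?_
        filter_upwards [h] with y hy
        rw [abs_mul, abs_of_nonneg (eta_nonneg _ _)]
        exact mul_le_mul_of_nonneg_left hy (eta_nonneg _ _)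
    _ = M := by rw [integral_mul_const, integral_eta_sub, one_mul]

/-- One function is expanded with left factors outside and the other with right factors outside.
Both sides become the same finite sum of products of moments, so no Fubini argument is involved. -/
lemma integral_mollify_mul {f g : Torus d → ℝ} (hf : Integrable f) (hg : Integrable g) (n : ℕ) :
    ∫ x, mollify n f x * g x = ∫ x, f x * mollify n g x := by
  simp_rw [mollify_eq_sum hf, mollify_eq_sum' hg, Finset.sum_mul, Finset.mul_sum]
  rw [integral_finsetSum, integral_finsetSum]
  · refine Finset.sum_congr rfl fun a _ => ?_
    simp_rw [mul_right_comm, ← mul_assoc]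
    rw [integral_mul_const, integral_mul_const, mul_comm]
    simp_rw [mul_comm]
  · intro a _
    simp_rw [← mul_assoc]
    exact (hf.mul_continuous (isSmooth_kerR n a).continuous).mul_const _
  · intro a _
    simp_rw [mul_right_comm]
    exact (hg.continuous_mul (isSmooth_kerL n a).continuous).mul_const _

lemma integrable_mollify {f : Torus d → ℝ} (hf : Integrable f) (n : ℕ) :
    Integrable (mollify n f) := (isSmooth_mollify hf n).continuous.integrable_torus

lemma mollify_sub {f g : Torus d → ℝ} (hf : Integrable f) (hg : Integrable g) (n : ℕ)
    (x : Torus d) : mollify n (fun y => f y - g y) x = mollify n f x - mollify n g x := by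
  unfold mollify
  simp_rw [mul_sub]
  exact integral_sub (hf.continuous_mul (continuous_eta_sub n x))
    (hg.continuous_mul (continuous_eta_sub n x))

lemma mollify_one (n : ℕ) (x : Torus d) : mollify n (fun _ => 1) x = 1 := by
  simp [mollify, integral_eta_sub]

/-- Pointwise, `|mollify f|` is at most `mollify |f|`; by self-adjointness the integral of the
latter is the pairing of `|f|` with the mollification of `1`, which is `1`. -/
lemma integral_abs_mollify_le {f : Torus d → ℝ} (hf : Integrable f) (n : ℕ) :
    ∫ x, |mollify n f x| ≤ ∫ x, |f x| := by
  calc ∫ x, |mollify n f x| ≤ ∫ x, mollify n (fun y => |f y|) x * 1 := by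
        refine integral_mono (integrable_mollify hf n).abs
          ((integrable_mollify hf.abs n).mul_const _) fun x => ?_
        simp only [mul_one]
        refine (abs_integral_le_integral_abs).trans (le_of_eq ?_)
        unfold mollify
        congr 1; ext y
        rw [abs_mul, abs_of_nonneg (eta_nonneg _ _)]
    _ = ∫ x, |f x| := by
        rw [integral_mollify_mul hf.abs (integrable_const _)]
        simp [mollify_one]

lemma tendsto_mollify_of_continuous {g : Torus d → ℝ} (hg : Continuous g) (x : Torus d) :
    Tendsto (fun n => mollify n g x) atTop (𝓝 (g x)) := by
  have h := tendsto_integral_eta (g := fun z => g (z + x)) (hg.comp (continuous_id.add continuous_const))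
  simp only [zero_add] at h
  refine h.congr fun n => ?_
  unfold mollify
  simp_rw [eta_sub_comm n x]
  have := integral_sub_right_eq_self (μ := volume) (fun z => eta n z * g (z + x)) x
  simpa using this.symm

/-- Density argument: for a continuous approximant the convergence is pointwise and bounded, and the
approximation error is not increased by mollification because it contracts `L^1`. -/
lemma tendsto_integral_abs_mollify_sub {f : Torus d → ℝ} (hf : Integrable f) :
    Tendsto (fun n => ∫ x, |mollify n f x - f x|) atTop (𝓝 0) := by
  rw [Metric.tendsto_atTop]
  intro ε hε
  obtain ⟨g, hg1, hg2⟩ := hf.exists_boundedContinuous_integral_sub_le (ε := ε / 4) (by positivity)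
  have hgc : Continuous g := g.continuous
  have h1 : Tendsto (fun n => ∫ x, |mollify n g x - g x|) atTop (𝓝 (∫ _ : Torus d, (0 : ℝ))) := by
    obtain ⟨M, hM0, hM⟩ := exists_bound_of_continuous hgc
    refine tendsto_integral_of_dominated_convergence (fun _ => M + M)
      (fun n => ((integrable_mollify hg2 n).sub hg2).abs.aestronglyMeasurable)
      (integrable_const _) (fun n => Eventually.of_forall fun x => ?_)
      (Eventually.of_forall fun x => ?_)
    · rw [Real.norm_eq_abs, abs_abs]
      exact (abs_sub _ _).trans
        (add_le_add (abs_mollify_le hg2 (Eventually.of_forall hM) n x) (hM x))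
    · have := ((tendsto_mollify_of_continuous hgc x).sub_const (g x)).abs
      simpa using this
  simp only [integral_zero] at h1
  obtain ⟨N, hN⟩ := Metric.tendsto_atTop.1 h1 (ε / 4) (by positivity)
  refine ⟨N, fun n hn => ?_⟩
  have h2 := hN n hn
  rw [Real.dist_0_eq_abs, abs_of_nonneg (integral_nonneg fun _ => abs_nonneg _)] at h2 ⊢
  have hfg : Integrable fun x => f x - g x := hf.sub hg2
  have h3 := integral_abs_mollify_le hfg n
  simp only [Real.norm_eq_abs] at hg1
  have i1 := (integrable_mollify hfg n).abs
  have i2 := ((integrable_mollify hg2 n).sub hg2).abs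
  have i3 := hfg.abs
  have h4 : ∫ x, |mollify n f x - f x| ≤ ∫ x, (|mollify n (fun y => f y - g y) x| +
      |mollify n g x - g x| + |f x - g x|) := by
    refine integral_mono ((integrable_mollify hf n).sub hf).abs ((i1.add i2).add i3) fun x => ?_
    simp only
    rw [mollify_sub hf hg2]
    have : mollify n f x - f x = (mollify n f x - mollify n g x) + (mollify n g x - g x)
      - (f x - g x) := by ring
    rw [this]
    exact (abs_sub _ _).trans (add_le_add (abs_add_le _ _) le_rfl)
  rw [integral_add (by exact i1.add i2) i3, integral_add i1 (by exact i2)] at h4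
  linarith

/-- Essentially bounded measurable functions on the torus. -/
def EssBdd (f : Torus d → ℝ) : Prop :=
  AEStronglyMeasurable f volume ∧ ∃ M, 0 ≤ M ∧ ∀ᵐ x, |f x| ≤ M

lemma EssBdd.integrable {f : Torus d → ℝ} (h : EssBdd f) : Integrable f := by
  obtain ⟨hm, M, -, hM⟩ := h
  exact Integrable.of_bound hm M hM

lemma _root_.Continuous.essBdd {f : Torus d → ℝ} (h : Continuous f) : EssBdd f := by
  obtain ⟨M, h0, hM⟩ := exists_bound_of_continuous h
  exact ⟨h.aestronglyMeasurable, M, h0, Eventually.of_forall hM⟩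

lemma EssBdd.mul_integrable {f g : Torus d → ℝ} (hf : EssBdd f) (hg : Integrable g) :
    Integrable (fun x => f x * g x) := by
  obtain ⟨hm, M, -, hM⟩ := hf
  exact hg.bdd_mul hm hM

lemma EssBdd.integrable_mul {f g : Torus d → ℝ} (hf : EssBdd f) (hg : Integrable g) :
    Integrable (fun x => g x * f x) := by
  simpa only [mul_comm] using hf.mul_integrable hg

lemma EssBdd.mul {f g : Torus d → ℝ} (hf : EssBdd f) (hg : EssBdd g) :
    EssBdd (fun x => f x * g x) := by
  obtain ⟨hm, M, h0, hM⟩ := hf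
  obtain ⟨hm', M', h0', hM'⟩ := hg
  refine ⟨hm.mul hm', M * M', by positivity, ?_⟩
  filter_upwards [hM, hM'] with x h1 h2
  rw [abs_mul]
  exact mul_le_mul h1 h2 (abs_nonneg _) h0

lemma EssBdd.add {f g : Torus d → ℝ} (hf : EssBdd f) (hg : EssBdd g) :
    EssBdd (fun x => f x + g x) := by
  obtain ⟨hm, M, h0, hM⟩ := hf
  obtain ⟨hm', M', h0', hM'⟩ := hg
  refine ⟨hm.add hm', M + M', by positivity, ?_⟩
  filter_upwards [hM, hM'] with x h1 h2
  exact (abs_add_le _ _).trans (add_le_add h1 h2)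

/-- Mollifying the bounded factor of a pairing does not change it in the limit. -/
lemma tendsto_integral_mul_mollify {f g : Torus d → ℝ} (hf : Integrable f) (hg : EssBdd g) :
    Tendsto (fun n => ∫ x, f x * mollify n g x) atTop (𝓝 (∫ x, f x * g x)) := by
  rw [tendsto_iff_norm_sub_tendsto_zero]
  obtain ⟨M, h0, hM⟩ := hg.2
  have h1 := (tendsto_integral_abs_mollify_sub hf).mul_const M
  rw [zero_mul] at h1
  refine squeeze_zero (fun n => norm_nonneg _) (fun n => ?_) h1
  have e1 := hg.integrable_mul (integrable_mollify hf n)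
  have e2 := hg.integrable_mul hf
  -- Self-adjointness moves the mollifier to the integrable factor, where it converges in `L^1`. No
  -- convergence of `mollify n g` is used.
  rw [← integral_mollify_mul hf hg.integrable, ← integral_sub e1 e2, ← integral_mul_const]
  refine (norm_integral_le_integral_norm _).trans (integral_mono_ae (e1.sub e2).norm
    (((integrable_mollify hf n).sub hf).abs.mul_const M) ?_)
  filter_upwards [hM] with x hx
  rw [← sub_mul, norm_mul, Real.norm_eq_abs, Real.norm_eq_abs]
  exact mul_le_mul_of_nonneg_left hx (abs_nonneg _)

lemma abs_integral_mul_le {f g : Torus d → ℝ} {M : ℝ} (hf : Integrable f)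
    (hM : ∀ᵐ x, |g x| ≤ M) : |∫ x, f x * g x| ≤ M * ∫ x, |f x| := by
  rw [← integral_const_mul, ← Real.norm_eq_abs]
  refine norm_integral_le_of_norm_le (hf.abs.const_mul M) ?_
  filter_upwards [hM] with x hx
  rw [norm_mul, mul_comm, Real.norm_eq_abs, Real.norm_eq_abs]
  exact mul_le_mul_of_nonneg_right hx (abs_nonneg _)

/-- `L^1` functions with the same moments against the kernel factors agree. -/
lemma ae_eq_of_forall_kerR {f g : Torus d → ℝ} (hf : Integrable f) (hg : Integrable g)
    (h : ∀ n (a : Fin (kerCard d n)), ∫ y, kerR n a y * f y = ∫ y, kerR n a y * g y) :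
    f =ᵐ[volume] g := by
  have h1 : ∀ n x, mollify n f x = mollify n g x := fun n x => by
    rw [mollify_eq_sum hf, mollify_eq_sum hg]; simp_rw [h]
  have hfg : Integrable fun x => f x - g x := hf.sub hg
  have h2 := tendsto_integral_abs_mollify_sub hfg
  simp_rw [mollify_sub hf hg, h1, sub_self, zero_sub, abs_neg] at h2
  have h3 := tendsto_nhds_unique tendsto_const_nhds h2
  rw [integral_eq_zero_iff_of_nonneg (fun _ => abs_nonneg _) hfg.abs] at h3
  filter_upwards [h3] with x hx
  exact sub_eq_zero.1 (abs_eq_zero.1 hx)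

/-! ### Weak derivatives at a fixed time -/

/-- `g` is the weak derivative of `f` in the direction `i`. -/
structure WkD (i : Fin d) (f g : Torus d → ℝ) : Prop where
  int_f : Integrable f
  int_g : Integrable g
  parts : ∀ φ : Torus d → ℝ, IsC1 φ → ∫ x, f x * spaceDeriv i φ x = -∫ x, g x * φ x

lemma IsC1.wkD {φ : Torus d → ℝ} (h : IsC1 φ) (i : Fin d) : WkD i φ (spaceDeriv i φ) :=
  ⟨h.continuous.integrable_torus, (h.continuous_spaceDeriv i).integrable_torus,
    fun _ hψ => h.integral_mul_spaceDeriv hψ i⟩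

lemma isC1_eta_sub (n : ℕ) (x : Torus d) : IsC1 fun y => eta n (x - y) := by
  simp_rw [eta_sub_eq_sum]
  exact IsC1.sum fun a _ => (IsC1.const _).mul (isSmooth_kerR n a).isC1

/-- The weak derivative is tested with `y ↦ eta n (x - y)`, whose derivative in `y` is minus its
derivative in `x`; the two signs cancel. -/
lemma spaceDeriv_mollify {i : Fin d} {f g : Torus d → ℝ} (h : WkD i f g) (n : ℕ) (x : Torus d) :
    spaceDeriv i (mollify n f) x = mollify n g x := by
  have h1 := h.parts _ (isC1_eta_sub n x)
  have h2 : ∀ y, spaceDeriv i (fun y => eta n (x - y)) y =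
      ∑ a, kerL n a x * spaceDeriv i (kerR n a) y := fun y => by
    simp_rw [eta_sub_eq_sum]
    rw [spaceDeriv_sum fun a _ => (IsC1.const _).mul (isSmooth_kerR n a).isC1]
    simp_rw [spaceDeriv_const_mul]
  -- The same one-dimensional function is differentiated through the left factors, that is, in `x`
  -- and with reversed sign. Uniqueness of derivatives gives the formula.
  have h3 : ∀ y, spaceDeriv i (fun y => eta n (x - y)) y =
      -∑ a, spaceDeriv i (kerL n a) x * kerR n a y := fun y => by
    have e1 : HasDerivAt (fun s : ℝ => eta n (x - (y + Pi.single i (s : UnitAddCircle))))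
        (spaceDeriv i (fun y => eta n (x - y)) y) 0 := (isC1_eta_sub n x).hasDerivAt i y
    have e2 : HasDerivAt (fun s : ℝ => ∑ a, kerL n a (x + Pi.single i (s : UnitAddCircle)) *
        kerR n a y) (∑ a, spaceDeriv i (kerL n a) x * kerR n a y) 0 :=
      HasDerivAt.fun_sum fun a _ => ((isSmooth_kerL n a).isC1.hasDerivAt i x).mul_const _
    have e3 : HasDerivAt (fun s : ℝ => eta n (x - (y + Pi.single i (s : UnitAddCircle))))
        (-∑ a, spaceDeriv i (kerL n a) x * kerR n a y) 0 := by
      rw [← neg_zero] at e2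
      have e4 := e2.scomp (h := fun s : ℝ => -s) (0 : ℝ) (hasDerivAt_neg (0 : ℝ))
      simp only [neg_smul, one_smul] at e4
      refine e4.congr_of_eventuallyEq (Eventually.of_forall fun s => ?_)
      simp only [Function.comp, ← eta_sub_eq_sum]
      congr 1
      rw [AddCircle.coe_neg, Pi.single_neg]
      abel
    exact e1.unique e3
  have h4 : spaceDeriv i (mollify n f) x =
      ∑ a, spaceDeriv i (kerL n a) x * ∫ y, kerR n a y * f y := by
    have : mollify n f = fun x => ∑ a, (∫ y, kerR n a y * f y) * kerL n a x :=
      funext fun x => by rw [mollify_eq_sum h.int_f]; simp_rw [mul_comm]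
    rw [this, spaceDeriv_sum fun a _ => (IsC1.const _).mul (isSmooth_kerL n a).isC1]
    simp_rw [spaceDeriv_const_mul, mul_comm]
  rw [h4]
  simp_rw [h3] at h1
  have h5 : ∫ y, f y * -∑ a, spaceDeriv i (kerL n a) x * kerR n a y =
      -∑ a, spaceDeriv i (kerL n a) x * ∫ y, kerR n a y * f y := by
    simp_rw [mul_neg, Finset.mul_sum]
    rw [integral_neg, integral_finsetSum]
    · congr 1
      refine Finset.sum_congr rfl fun a _ => ?_
      rw [← integral_const_mul]
      congr 1; ext y; ring
    · intro a _
      have := (h.int_f.continuous_mul (isSmooth_kerR n a).continuous).const_mul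
        (spaceDeriv i (kerL n a) x)
      refine this.congr (Eventually.of_forall fun y => ?_)
      simp only; ring
  rw [h5] at h1
  have h6 := neg_injective h1
  rw [h6]
  unfold mollify
  simp_rw [mul_comm]

/-- An identity `∫ ∑ f_j ∂_j φ + g φ = 0` for the kernel factors `φ` extends to bounded functions
with bounded weak derivatives. -/
lemma flux_extend {ι : Type*} [Fintype ι] {dir : ι → Fin d} {f : ι → Torus d → ℝ}
    {g : Torus d → ℝ} (hf : ∀ j, Integrable (f j)) (hg : Integrable g)
    (h : ∀ n (a : Fin (kerCard d n)),
      ∫ x, ((∑ j, f j x * spaceDeriv (dir j) (kerL n a) x) + g x * kerL n a x) = 0)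
    {b : Torus d → ℝ} {b' : ι → Torus d → ℝ} (hb : EssBdd b) (hb' : ∀ j, EssBdd (b' j))
    (hbb' : ∀ j, WkD (dir j) b (b' j)) :
    ∫ x, ((∑ j, f j x * b' j x) + g x * b x) = 0 := by
  -- The mollification of `b` is a linear combination of left kernel factors with coefficients `∫
  -- kerR b`, and its derivatives are the mollifications of the `b' j`. The hypothesis therefore
  -- extends to it by linearity.
  have key : ∀ n, (∑ j, ∫ x, f j x * mollify n (b' j) x) + ∫ x, g x * mollify n b x = 0 := by
    intro n
    have i1 : ∀ j a, Integrable fun x => f j x * spaceDeriv (dir j) (kerL n a) x := fun j a =>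
      (hf j).mul_continuous ((isSmooth_kerL n a).isC1.continuous_spaceDeriv _)
    have i2 : ∀ a, Integrable fun x => g x * kerL n a x := fun a =>
      hg.mul_continuous (isSmooth_kerL n a).continuous
    have h' : ∀ a, (∑ j, ∫ x, f j x * spaceDeriv (dir j) (kerL n a) x) +
        ∫ x, g x * kerL n a x = 0 := fun a => by
      rw [← integral_finsetSum _ fun j _ => i1 j a, ← integral_add _ (i2 a)]
      · exact h n a
      · exact integrable_finsetSum _ fun j _ => i1 j a
    have e : ∀ j x, mollify n (b' j) x =
        ∑ a, spaceDeriv (dir j) (kerL n a) x * ∫ y, kerR n a y * b y := fun j x => by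
      rw [← spaceDeriv_mollify (hbb' j)]
      have : mollify n b = fun x => ∑ a, (∫ y, kerR n a y * b y) * kerL n a x :=
        funext fun x => by rw [mollify_eq_sum hb.integrable]; simp_rw [mul_comm]
      rw [this, spaceDeriv_sum fun a _ => (IsC1.const _).mul (isSmooth_kerL n a).isC1]
      simp_rw [spaceDeriv_const_mul, mul_comm]
    simp_rw [e, mollify_eq_sum hb.integrable, Finset.mul_sum, ← mul_assoc]
    have e1 : ∀ j, ∫ x, ∑ a, f j x * spaceDeriv (dir j) (kerL n a) x * ∫ y, kerR n a y * b y =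
        ∑ a, (∫ x, f j x * spaceDeriv (dir j) (kerL n a) x) * ∫ y, kerR n a y * b y := fun j => by
      rw [integral_finsetSum _ fun a _ => (i1 j a).mul_const _]
      simp_rw [integral_mul_const]
    have e2 : ∫ x, ∑ a, g x * kerL n a x * ∫ y, kerR n a y * b y =
        ∑ a, (∫ x, g x * kerL n a x) * ∫ y, kerR n a y * b y := by
      rw [integral_finsetSum _ fun a _ => (i2 a).mul_const _]
      simp_rw [integral_mul_const]
    simp_rw [e1, e2]
    rw [Finset.sum_comm, ← Finset.sum_add_distrib]
    refine Finset.sum_eq_zero fun a _ => ?_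
    rw [← Finset.sum_mul, ← add_mul, h' a, zero_mul]
  have lim : Tendsto (fun n => (∑ j, ∫ x, f j x * mollify n (b' j) x) +
      ∫ x, g x * mollify n b x) atTop
      (𝓝 ((∑ j, ∫ x, f j x * b' j x) + ∫ x, g x * b x)) :=
    (tendsto_finsetSum _ fun j _ => tendsto_integral_mul_mollify (hf j) (hb' j)).add
      (tendsto_integral_mul_mollify hg hb)
  simp_rw [key] at lim
  have := tendsto_nhds_unique lim tendsto_const_nhds
  rw [integral_add, integral_finsetSum]
  · exact this
  · exact fun j _ => (hb' j).integrable_mul (hf j)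
  · exact integrable_finsetSum _ fun j _ => (hb' j).integrable_mul (hf j)
  · exact hb.integrable_mul hg

/-- Countably many test functions decide whether `g` is the weak derivative. This is what allows one
exceptional null set of times when slicing. -/
lemma WkD.of_kerL {i : Fin d} {f g : Torus d → ℝ} (hf : Integrable f) (hg : Integrable g)
    (h : ∀ n (a : Fin (kerCard d n)),
      ∫ x, (f x * spaceDeriv i (kerL n a) x + g x * kerL n a x) = 0) : WkD i f g := by
  refine ⟨hf, hg, fun φ hφ => ?_⟩
  have := flux_extend (ι := Unit) (dir := fun _ => i) (f := fun _ => f) (g := g) (fun _ => hf) hg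
    (by simpa using h) hφ.continuous.essBdd (b' := fun _ => spaceDeriv i φ)
    (fun _ => (hφ.continuous_spaceDeriv i).essBdd) (fun _ => hφ.wkD i)
  simp only [Finset.univ_unique, Finset.sum_const, Finset.card_singleton, one_smul] at this
  rw [integral_add (hf.mul_continuous (hφ.continuous_spaceDeriv i))
    (hg.mul_continuous hφ.continuous)] at this
  linarith

/-- Integration by parts against a bounded function with bounded weak derivative. -/
lemma WkD.integral_mul {i : Fin d} {f g b b' : Torus d → ℝ} (h : WkD i f g) (hb : EssBdd b)
    (hb' : EssBdd b') (hbb' : WkD i b b') : ∫ x, f x * b' x = -∫ x, g x * b x := by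
  have := flux_extend (ι := Unit) (dir := fun _ => i) (f := fun _ => f) (g := g)
    (fun _ => h.int_f) h.int_g (fun n a => by
      simp only [Finset.univ_unique, Finset.sum_const, Finset.card_singleton, one_smul]
      have hk := isSmooth_kerL (d := d) n a
      rw [integral_add (h.int_f.mul_continuous (hk.isC1.continuous_spaceDeriv i))
        (h.int_g.mul_continuous hk.continuous), h.parts _ hk.isC1]
      ring) hb (b' := fun _ => b') (fun _ => hb') (fun _ => hbb')
  simp only [Finset.univ_unique, Finset.sum_const, Finset.card_singleton, one_smul] at this
  rw [integral_add (hb'.integrable_mul h.int_f) (hb.integrable_mul h.int_g)] at this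
  linarith

lemma WkD.add {i : Fin d} {f g f' g' : Torus d → ℝ} (h : WkD i f g) (h' : WkD i f' g') :
    WkD i (fun x => f x + f' x) (fun x => g x + g' x) := by
  refine ⟨h.int_f.add h'.int_f, h.int_g.add h'.int_g, fun φ hφ => ?_⟩
  simp_rw [add_mul]
  have c := hφ.continuous_spaceDeriv i
  rw [integral_add (h.int_f.mul_continuous c) (h'.int_f.mul_continuous c),
    integral_add (h.int_g.mul_continuous hφ.continuous) (h'.int_g.mul_continuous hφ.continuous),
    h.parts _ hφ, h'.parts _ hφ]
  ring

lemma WkD.const_mul {i : Fin d} {f g : Torus d → ℝ} (h : WkD i f g) (c : ℝ) :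
    WkD i (fun x => c * f x) (fun x => c * g x) := by
  refine ⟨h.int_f.const_mul c, h.int_g.const_mul c, fun φ hφ => ?_⟩
  simp_rw [mul_assoc]
  rw [integral_const_mul, integral_const_mul, h.parts _ hφ]
  ring

/-- The product of a weakly differentiable function and a bounded one with bounded derivative. -/
lemma WkD.mul {i : Fin d} {f g f' g' : Torus d → ℝ} (h : WkD i f g) (h' : WkD i f' g')
    (hf' : EssBdd f') (hg' : EssBdd g') :
    WkD i (fun x => f x * f' x) (fun x => g x * f' x + f x * g' x) := by
  refine ⟨hf'.integrable_mul h.int_f,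
    (hf'.integrable_mul h.int_g).add (hg'.integrable_mul h.int_f), fun φ hφ => ?_⟩
  have c := hφ.continuous_spaceDeriv i
  have b1 : EssBdd fun x => f' x * φ x := hf'.mul hφ.continuous.essBdd
  have b2 : EssBdd fun x => g' x * φ x + f' x * spaceDeriv i φ x :=
    (hg'.mul hφ.continuous.essBdd).add (hf'.mul c.essBdd)
  -- The product of `f'` with a test function is not `C^1`, but it is bounded with bounded weak
  -- derivative, hence admissible in `WkD.integral_mul`.
  have b3 : WkD i (fun x => f' x * φ x) fun x => g' x * φ x + f' x * spaceDeriv i φ x := by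
    refine ⟨b1.integrable, b2.integrable, fun ψ hψ => ?_⟩
    have e := h'.parts _ (hφ.mul hψ)
    have c' := hψ.continuous_spaceDeriv i
    simp_rw [spaceDeriv_mul hφ hψ, mul_add, ← mul_assoc] at e
    simp_rw [add_mul]
    have i1 : Integrable fun x => f' x * spaceDeriv i φ x * ψ x :=
      (h'.int_f.mul_continuous c).mul_continuous hψ.continuous
    have i2 : Integrable fun x => g' x * φ x * ψ x :=
      (h'.int_g.mul_continuous hφ.continuous).mul_continuous hψ.continuous
    rw [integral_add i1 ((h'.int_f.mul_continuous hφ.continuous).mul_continuous c')] at e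
    rw [integral_add i2 i1]
    linarith
  have e := h.integral_mul b1 b2 b3
  have i1 : Integrable fun x => f x * (g' x * φ x) :=
    (hg'.mul hφ.continuous.essBdd).integrable_mul h.int_f
  have i2 : Integrable fun x => f x * (f' x * spaceDeriv i φ x) :=
    (hf'.mul c.essBdd).integrable_mul h.int_f
  have i3 : Integrable fun x => g x * (f' x * φ x) := b1.integrable_mul h.int_g
  simp_rw [mul_add] at e
  rw [integral_add i1 i2] at e
  simp_rw [add_mul, mul_assoc]
  rw [integral_add i3 i1]
  linarith

lemma WkD.const (i : Fin d) (c : ℝ) : WkD i (fun _ => c) (fun _ => 0) := by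
  have := (IsC1.const c).wkD i
  have e : (spaceDeriv i fun _ : Torus d => c) = fun _ => 0 := by ext; simp [spaceDeriv]
  rwa [e] at this

lemma WkD.congr {i : Fin d} {f g f' g' : Torus d → ℝ} (h : WkD i f g) (hf : f =ᵐ[volume] f')
    (hg : g =ᵐ[volume] g') : WkD i f' g' := by
  refine ⟨h.int_f.congr hf, h.int_g.congr hg, fun φ hφ => ?_⟩
  have e1 : ∫ x, f' x * spaceDeriv i φ x = ∫ x, f x * spaceDeriv i φ x :=
    integral_congr_ae (by filter_upwards [hf] with x hx; rw [hx])
  have e2 : ∫ x, g' x * φ x = ∫ x, g x * φ x :=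
    integral_congr_ae (by filter_upwards [hg] with x hx; rw [hx])
  rw [e1, e2]
  exact h.parts φ hφ

lemma WkD.unique {i : Fin d} {f g g' : Torus d → ℝ} (h : WkD i f g) (h' : WkD i f g') :
    g =ᵐ[volume] g' := by
  refine ae_eq_of_forall_kerR h.int_g h'.int_g fun n a => ?_
  have e1 := h.parts _ (isSmooth_kerR n a).isC1
  have e2 := h'.parts _ (isSmooth_kerR n a).isC1
  simp_rw [mul_comm (kerR n a _)]
  linarith

/-- Weak derivatives commute. -/
lemma WkD.comm {i j : Fin d} {f g g' w w' : Torus d → ℝ} (h : WkD i f g) (hw : WkD j g w)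
    (h' : WkD j f g') (hw' : WkD i g' w') : w =ᵐ[volume] w' := by
  refine ae_eq_of_forall_kerR hw.int_g hw'.int_g fun n a => ?_
  have hs := isSmooth_kerR (d := d) n a
  have e1 := hw.parts _ hs.isC1
  have e2 := hw'.parts _ hs.isC1
  have e3 := h.parts _ (hs.spaceDeriv j).isC1
  have e4 := h'.parts _ (hs.spaceDeriv i).isC1
  have e5 : ∀ x, spaceDeriv i (spaceDeriv j (kerR n a)) x =
      spaceDeriv j (spaceDeriv i (kerR n a)) x := by
    intro x
    obtain ⟨y, rfl⟩ := isOpenQuotientMap_toTorus.surjective x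
    set F : (Fin d → ℝ) → ℝ := fun y => kerR n a (toTorus y) with hF
    have hFs : ContDiff ℝ ∞ F := hs
    have e6 : ∀ (k l : Fin d), spaceDeriv k (spaceDeriv l (kerR n a)) (toTorus y) =
        fderiv ℝ (fderiv ℝ F) y (Pi.single k 1) (Pi.single l 1) := by
      intro k l
      rw [spaceDeriv_toTorus ((hs.spaceDeriv l).isC1.differentiable y)]
      have e7 : (fun y => spaceDeriv l (kerR n a) (toTorus y)) =
          fun y => fderiv ℝ F y (Pi.single l 1) := by
        ext z; exact spaceDeriv_toTorus (hs.isC1.differentiable z) l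
      rw [e7, fderiv_clm_apply]
      · simp
      · exact ((ContDiff.fderiv_right (m := 1) hFs (by norm_cast)).differentiable
          (by norm_num)) y
      · exact differentiableAt_const _
    rw [e6, e6]
    have : IsSymmSndFDerivAt ℝ F y :=
      (hFs.contDiffAt (x := y)).isSymmSndFDerivAt (by simpa using (ENat.LEInfty.out : (2 : WithTop ℕ∞) ≤ ∞))
    exact this _ _
  simp_rw [e5] at e3
  simp_rw [mul_comm (kerR n a _)]
  linarith

/-! ### Composition with functions of one variable -/

lemma exists_polynomial_derivative (p : Polynomial ℝ) : ∃ P : Polynomial ℝ, P.derivative = p := by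
  induction p using Polynomial.induction_on' with
  | add p q hp hq =>
    obtain ⟨P, hP⟩ := hp
    obtain ⟨Q, hQ⟩ := hq
    exact ⟨P + Q, by simp [hP, hQ]⟩
  | monomial n a =>
    refine ⟨Polynomial.monomial (n + 1) (a / (n + 1)), ?_⟩
    rw [Polynomial.derivative_monomial]
    congr 1
    push_cast
    field_simp

/-- A `C^1` function on an interval is approximated by polynomials together with its derivative. -/
lemma exists_polynomial_approx {δ R : ℝ} {G G' : ℝ → ℝ}
    (hG : ∀ r ∈ Icc δ R, HasDerivAt G (G' r) r) (hG' : ContinuousOn G' (Icc δ R)) {ε : ℝ}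
    (hε : 0 < ε) : ∃ P : Polynomial ℝ, ∀ r ∈ Icc δ R,
      |P.eval r - G r| ≤ ε ∧ |P.derivative.eval r - G' r| ≤ ε := by
  rcases lt_or_ge R δ with h | hδR
  · exact ⟨0, fun r hr => absurd (hr.1.trans hr.2) (not_le.2 h)⟩
  -- An error `ε'` in the derivative costs at most `ε' (R - δ)` in the function. The summand `1`
  -- keeps the denominator positive and also gives `ε' ≤ ε`.
  set ε' := ε / (1 + (R - δ)) with hε'
  have hpos : 0 < 1 + (R - δ) := by linarith
  have hε0 : 0 < ε' := by positivity
  have hle : ε' ≤ ε := by rw [hε', div_le_iff₀ hpos]; nlinarith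
  obtain ⟨p, hp⟩ := exists_polynomial_near_of_continuousOn δ R G' hG' ε' hε0
  obtain ⟨P, hP⟩ := exists_polynomial_derivative p
  -- The constant makes polynomial and function agree at the left endpoint, from which the mean
  -- value inequality is applied.
  refine ⟨P + Polynomial.C (G δ - P.eval δ), fun r hr => ⟨?_, ?_⟩⟩
  · have hd : ∀ s ∈ Icc δ R, HasDerivWithinAt (fun s => P.eval s - G s) (p.eval s - G' s)
        (Icc δ R) s := fun s hs => by
      have := (P.hasDerivAt s).sub (hG s hs)
      rw [hP] at this
      exact this.hasDerivWithinAt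
    have := (convex_Icc δ R).norm_image_sub_le_of_norm_hasDerivWithin_le hd
      (fun s hs => (hp s hs).le) (left_mem_Icc.2 hδR) hr
    simp only [Real.norm_eq_abs, Polynomial.eval_add, Polynomial.eval_C] at this ⊢
    have e : P.eval r + (G δ - P.eval δ) - G r = P.eval r - G r - (P.eval δ - G δ) := by ring
    rw [e]
    refine this.trans ?_
    rw [abs_of_nonneg (by linarith [hr.1])]
    calc ε' * (r - δ) ≤ ε' * (1 + (R - δ)) :=
          mul_le_mul_of_nonneg_left (by linarith [hr.2]) hε0.le
      _ = ε := by rw [hε']; field_simp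
  · simp only [Polynomial.derivative_add, Polynomial.derivative_C, add_zero, hP]
    exact (hp r hr).le.trans hle

lemma EssBdd.comp_of_mem_Icc {δ R : ℝ} {G : ℝ → ℝ} {r : Torus d → ℝ}
    (hr : AEStronglyMeasurable r volume) (hmem : ∀ᵐ x, r x ∈ Icc δ R)
    (hG : ContinuousOn G (Icc δ R)) : EssBdd (fun x => G (r x)) := by
  rcases lt_or_ge R δ with h | hδR
  · exfalso
    obtain ⟨x, hx⟩ := hmem.exists
    exact absurd (hx.1.trans hx.2) (not_le.2 h)
  obtain ⟨M, hM⟩ := isCompact_Icc.exists_bound_of_continuousOn hG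
  refine ⟨?_, M, (norm_nonneg _).trans (hM δ (left_mem_Icc.2 hδR)), ?_⟩
  -- Continuity of `G` is known on the interval only. Its constant extension is continuous on the
  -- whole line, which yields measurability of the composition.
  · have hc : Continuous (IccExtend hδR ((Icc δ R).domRestrict G)) :=
      (continuousOn_iff_continuous_domRestrict.1 hG).Icc_extend'
    refine (hc.comp_aestronglyMeasurable hr).congr ?_
    filter_upwards [hmem] with x hx
    exact IccExtend_of_mem hδR _ hx
  · filter_upwards [hmem] with x hx using hM _ hx

lemma WkD.polynomial {i : Fin d} {r q : Torus d → ℝ} (h : WkD i r q) (hr : EssBdd r)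
    (hq : EssBdd q) (P : Polynomial ℝ) :
    WkD i (fun x => P.eval (r x)) (fun x => P.derivative.eval (r x) * q x) := by
  have hb : ∀ P : Polynomial ℝ, EssBdd fun x => P.eval (r x) := by
    obtain ⟨M, -, hM⟩ := hr.2
    exact fun P => EssBdd.comp_of_mem_Icc (δ := -M) (R := M) hr.1
      (hM.mono fun x hx => abs_le.1 hx) P.continuous.continuousOn
  induction P using Polynomial.induction_on with
  | C a => simpa using WkD.const i a
  | add p p' hp hp' =>
    refine (hp.add hp').congr (Eventually.of_forall fun x => ?_) (Eventually.of_forall fun x => ?_)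
    · simp
    · simp [add_mul]
  | monomial n a ih =>
    refine (ih.mul h hr hq).congr (Eventually.of_forall fun x => ?_)
      (Eventually.of_forall fun x => ?_)
    · simp [pow_succ, mul_assoc]
    · simp only [Polynomial.derivative_mul, Polynomial.derivative_C, Polynomial.derivative_X_pow,
        Polynomial.eval_mul, Polynomial.eval_C, Polynomial.eval_pow,
        Polynomial.eval_X, zero_mul, zero_add]
      rcases n with _ | n
      · simp
      · simp; ring

/-- The chain rule for `G ∘ r`. -/
lemma WkD.comp {i : Fin d} {r q : Torus d → ℝ} (h : WkD i r q)
    (hq : EssBdd q) {δ R : ℝ} (hmem : ∀ᵐ x, r x ∈ Icc δ R) {G G' : ℝ → ℝ}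
    (hG : ∀ s ∈ Icc δ R, HasDerivAt G (G' s) s) (hG' : ContinuousOn G' (Icc δ R)) :
    WkD i (fun x => G (r x)) (fun x => G' (r x) * q x) := by
  have hm := h.int_f.aestronglyMeasurable
  have hr : EssBdd r := EssBdd.comp_of_mem_Icc hm hmem continuousOn_id
  have b1 : EssBdd fun x => G (r x) :=
    EssBdd.comp_of_mem_Icc hm hmem fun s hs => (hG s hs).continuousAt.continuousWithinAt
  have b2 : EssBdd fun x => G' (r x) * q x := (EssBdd.comp_of_mem_Icc hm hmem hG').mul hq
  refine ⟨b1.integrable, b2.integrable, fun φ hφ => ?_⟩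
  have cφ := hφ.continuous_spaceDeriv i
  have i1 := b1.integrable.mul_continuous cφ
  have i2 := b2.integrable.mul_continuous hφ.continuous
  rw [← sub_eq_zero, ← abs_eq_zero]
  refine le_antisymm (le_of_forall_pos_le_add fun ε hε => ?_) (abs_nonneg _)
  -- The chain rule is known for polynomials. Replacing `G` by a polynomial that is `C^1`-close on
  -- the interval changes the two sides by at most `K` times the distance, and `ε / (K + 1)` makes
  -- this less than `ε`.
  set K := (∫ x, |spaceDeriv i φ x|) + ∫ x, |q x * φ x| with hK
  have i3 := hq.integrable.mul_continuous hφ.continuous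
  have hK0 : 0 ≤ K := add_nonneg (integral_nonneg fun _ => abs_nonneg _)
    (integral_nonneg fun _ => abs_nonneg _)
  obtain ⟨P, hP⟩ := exists_polynomial_approx hG hG' (ε := ε / (K + 1)) (by positivity)
  have hw := h.polynomial hr hq P
  have e := hw.parts φ hφ
  have j1 := hw.int_f.mul_continuous cφ
  have j2 := hw.int_g.mul_continuous hφ.continuous
  have e1 : (∫ x, G (r x) * spaceDeriv i φ x) - -∫ x, G' (r x) * q x * φ x =
      (∫ x, (G (r x) - P.eval (r x)) * spaceDeriv i φ x) +
      ∫ x, (G' (r x) - P.derivative.eval (r x)) * (q x * φ x) := by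
    have k1 : ∫ x, (G (r x) - P.eval (r x)) * spaceDeriv i φ x =
        (∫ x, G (r x) * spaceDeriv i φ x) - ∫ x, P.eval (r x) * spaceDeriv i φ x := by
      simp_rw [sub_mul]; exact integral_sub i1 j1
    have k2 : ∫ x, (G' (r x) - P.derivative.eval (r x)) * (q x * φ x) =
        (∫ x, G' (r x) * q x * φ x) - ∫ x, P.derivative.eval (r x) * q x * φ x := by
      simp_rw [sub_mul, ← mul_assoc]; exact integral_sub i2 j2
    rw [k1, k2]; linarith
  rw [e1, zero_add]
  have f1 : |∫ x, (G (r x) - P.eval (r x)) * spaceDeriv i φ x| ≤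
      ε / (K + 1) * ∫ x, |spaceDeriv i φ x| := by
    simp_rw [mul_comm _ (spaceDeriv i φ _)]
    refine abs_integral_mul_le cφ.integrable_torus ?_
    filter_upwards [hmem] with x hx
    rw [abs_sub_comm]; exact (hP _ hx).1
  have f2 : |∫ x, (G' (r x) - P.derivative.eval (r x)) * (q x * φ x)| ≤
      ε / (K + 1) * ∫ x, |q x * φ x| := by
    simp_rw [mul_comm _ (q _ * φ _)]
    refine abs_integral_mul_le i3 ?_
    filter_upwards [hmem] with x hx
    rw [abs_sub_comm]; exact (hP _ hx).2
  refine (abs_add_le _ _).trans ((add_le_add f1 f2).trans ?_)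
  rw [← mul_add, ← hK, div_mul_eq_mul_div, div_le_iff₀ (by positivity)]
  nlinarith

end

section

/-! ### Functions of time -/

lemma intervalIntegrable_of_Ioo {T t : ℝ} {c : ℝ → ℝ} (hc : IntegrableOn c (Ioo 0 T))
    (ht : t ∈ Icc 0 T) : IntervalIntegrable c volume 0 t := by
  rw [intervalIntegrable_iff_integrableOn_Ioc_of_le ht.1]
  exact (hc.congr_set_ae Ioo_ae_eq_Ioc.symm).mono_set (Ioc_subset_Ioc_right ht.2)

lemma ae_Ioc_of_ae_Ioo {T t : ℝ} {P : ℝ → Prop} (h : ∀ᵐ s ∂(volume.restrict (Ioo 0 T)), P s)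
    (ht : t ∈ Icc 0 T) : ∀ᵐ s ∂(volume.restrict (Ioc 0 t)), P s := by
  rw [restrict_Ioo_eq_restrict_Ioc] at h
  exact ae_restrict_of_ae_restrict_of_subset (Ioc_subset_Ioc_right ht.2) h

lemma intervalIntegral_congr_Ioo {T t : ℝ} {c e : ℝ → ℝ}
    (h : ∀ᵐ s ∂(volume.restrict (Ioo 0 T)), c s = e s) (ht : t ∈ Icc 0 T) :
    ∫ s in (0 : ℝ)..t, c s = ∫ s in (0 : ℝ)..t, e s := by
  rw [intervalIntegral.integral_of_le ht.1, intervalIntegral.integral_of_le ht.1]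
  exact integral_congr_ae (ae_Ioc_of_ae_Ioo h ht)

lemma integral_Ioo_eq {T : ℝ} (hT : 0 ≤ T) (c : ℝ → ℝ) :
    ∫ s in Ioo 0 T, c s = ∫ s in (0 : ℝ)..T, c s := by
  rw [intervalIntegral.integral_of_le hT, integral_Ioc_eq_integral_Ioo]

/-- The product rule for indefinite integrals. -/
lemma intervalIntegral_mul_primitive {T : ℝ} {A B a b : ℝ → ℝ} (ha : IntegrableOn a (Ioo 0 T))
    (hb : IntegrableOn b (Ioo 0 T)) (hA : ∀ t ∈ Icc 0 T, A t - A 0 = ∫ s in (0 : ℝ)..t, a s)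
    (hB : ∀ t ∈ Icc 0 T, B t - B 0 = ∫ s in (0 : ℝ)..t, b s) {t : ℝ} (ht : t ∈ Icc 0 T) :
    A t * B t - A 0 * B 0 = ∫ s in (0 : ℝ)..t, (a s * B s + A s * b s) := by
  have h0t : (0 : ℝ) ≤ t := ht.1
  -- `A` and `B` are known to be primitives on `[0,T]` only, so they are replaced by explicit
  -- primitives, which are absolutely continuous and have the right derivative almost everywhere.
  have main : ∀ {F f : ℝ → ℝ} (F0 : ℝ), IntegrableOn f (Ioo 0 T) →
      AbsolutelyContinuousOnInterval (fun t => F0 + ∫ s in (0 : ℝ)..t, f s) 0 t ∧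
      ∀ᵐ s ∂(volume.restrict (Ioc 0 t)), deriv (fun t => F0 + ∫ s in (0 : ℝ)..t, f s) s = f s := by
    intro F f F0 hf
    have hi := intervalIntegrable_of_Ioo hf ht
    constructor
    · have h1 : AbsolutelyContinuousOnInterval (fun _ : ℝ => F0) 0 t :=
        (LipschitzOnWith.absolutelyContinuousOnInterval
          (K := 0) (LipschitzWith.const F0).lipschitzOnWith)
      exact h1.add (hi.absolutelyContinuousOnInterval_intervalIntegral left_mem_uIcc)
    · have := hi.ae_hasDerivAt_integral
      rw [ae_restrict_iff' measurableSet_Ioc]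
      filter_upwards [this] with s hs hst
      have hs' : s ∈ uIcc 0 t := by rw [uIcc_of_le h0t]; exact Ioc_subset_Icc_self hst
      exact ((hs hs' 0 left_mem_uIcc).const_add F0).deriv
  obtain ⟨acA, dA⟩ := main (F := A) (A 0) ha
  obtain ⟨acB, dB⟩ := main (F := B) (B 0) hb
  have key := acA.integral_deriv_mul_eq_sub acB
  simp only [intervalIntegral.integral_same, add_zero] at key
  have eA := hA t ht
  have eB := hB t ht
  have : A t * B t - A 0 * B 0 = (A 0 + ∫ s in (0 : ℝ)..t, a s) * (B 0 + ∫ s in (0 : ℝ)..t, b s) -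
      A 0 * B 0 := by rw [← eA, ← eB]; ring
  rw [this, ← key, intervalIntegral.integral_of_le h0t, intervalIntegral.integral_of_le h0t]
  refine integral_congr_ae ?_
  filter_upwards [dA, dB, ae_restrict_mem measurableSet_Ioc] with s h1 h2 hs
  have hsT : s ∈ Icc 0 T := ⟨hs.1.le, hs.2.trans ht.2⟩
  rw [h1, h2, ← hA s hsT, ← hB s hsT]
  ring

lemma continuousOn_of_primitive {T : ℝ} {A a : ℝ → ℝ} (ha : IntegrableOn a (Ioo 0 T))
    (hA : ∀ t ∈ Icc 0 T, A t - A 0 = ∫ s in (0 : ℝ)..t, a s) : ContinuousOn A (Icc 0 T) := by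
  rcases lt_or_ge T 0 with hT | hT
  · simp [Icc_eq_empty (not_le.2 hT)]
  have := intervalIntegral.continuousOn_primitive_interval'
    (intervalIntegrable_of_Ioo ha (right_mem_Icc.2 hT)) left_mem_uIcc
  rw [uIcc_of_le hT] at this
  exact (this.const_add (A 0)).congr fun t ht => by simp only [← hA t ht]; ring

lemma integrableOn_mul_primitive {T : ℝ} {A B a b : ℝ → ℝ} (ha : IntegrableOn a (Ioo 0 T))
    (hb : IntegrableOn b (Ioo 0 T)) (hA : ∀ t ∈ Icc 0 T, A t - A 0 = ∫ s in (0 : ℝ)..t, a s)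
    (hB : ∀ t ∈ Icc 0 T, B t - B 0 = ∫ s in (0 : ℝ)..t, b s) :
    IntegrableOn (fun s => a s * B s + A s * b s) (Ioo 0 T) := by
  have main : ∀ {A a b : ℝ → ℝ}, IntegrableOn a (Ioo 0 T) → IntegrableOn b (Ioo 0 T) →
      (∀ t ∈ Icc 0 T, A t - A 0 = ∫ s in (0 : ℝ)..t, a s) →
      IntegrableOn (fun s => A s * b s) (Ioo 0 T) := by
    intro A a b ha hb hA
    have hc := continuousOn_of_primitive ha hA
    obtain ⟨M, hM⟩ := isCompact_Icc.exists_bound_of_continuousOn hc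
    exact hb.bdd_mul (c := M)
      ((hc.mono Ioo_subset_Icc_self).aestronglyMeasurable measurableSet_Ioo)
      ((ae_restrict_mem measurableSet_Ioo).mono fun s hs => hM s (Ioo_subset_Icc_self hs))
  have h1 := main hb ha hB
  simp_rw [mul_comm (B _)] at h1
  exact h1.add (main ha hb hA)

/-- By Lebesgue differentiation the primitive has derivative `c` almost everywhere, and it is
locally constant inside the interval. -/
lemma ae_eq_zero_of_primitive_eq_zero {T : ℝ} (hT : 0 < T) {c : ℝ → ℝ}
    (hc : IntegrableOn c (Ioo 0 T))
    (h : ∀ t ∈ Icc 0 T, ∫ s in (0 : ℝ)..t, c s = 0) :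
    ∀ᵐ t ∂(volume.restrict (Ioo 0 T)), c t = 0 := by
  have hi := intervalIntegrable_of_Ioo hc (right_mem_Icc.2 hT.le)
  rw [ae_restrict_iff' measurableSet_Ioo]
  filter_upwards [hi.ae_hasDerivAt_integral] with s hs hsT
  have hs' : s ∈ uIcc 0 T := by rw [uIcc_of_le hT.le]; exact Ioo_subset_Icc_self hsT
  have h1 := hs hs' 0 left_mem_uIcc
  have h2 : HasDerivAt (fun x => ∫ t in (0 : ℝ)..x, c t) 0 s := by
    refine (hasDerivAt_const s (0 : ℝ)).congr_of_eventuallyEq ?_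
    filter_upwards [Ioo_mem_nhds hsT.1 hsT.2] with r hr
    exact h r (Ioo_subset_Icc_self hr)
  exact h1.unique h2

/-- `C^1` functions of time with compact support in `(0,T)`. -/
def IsCut (T : ℝ) (χ : ℝ → ℝ) : Prop :=
  ContDiff ℝ 1 χ ∧ (∃ a > 0, ∀ t, t ≤ a → χ t = 0) ∧ ∃ b < T, ∀ t, b ≤ t → χ t = 0

/-- Product rule on `[0,T]`: the boundary terms vanish because the primitive is zero at `0` and the
cutoff is zero at `T`. -/
lemma IsCut.integral_primitive_mul_deriv {T : ℝ} (hT : 0 < T) {χ C : ℝ → ℝ} (hχ : IsCut T χ)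
    (hC : IntegrableOn C (Ioo 0 T)) :
    ∫ t in Ioo 0 T, (∫ s in (0 : ℝ)..t, C s) * deriv χ t = -∫ t in Ioo 0 T, C t * χ t := by
  obtain ⟨hc, ⟨a, ha, hχa⟩, b, hb, hχb⟩ := hχ
  have hTT : T ∈ Icc 0 T := right_mem_Icc.2 hT.le
  have hd : Continuous (deriv χ) := hc.continuous_deriv le_rfl
  have hdi : IntegrableOn (deriv χ) (Ioo 0 T) :=
    (hd.integrableOn_Icc (a := 0) (b := T)).mono_set Ioo_subset_Icc_self
  have key := intervalIntegral_mul_primitive (A := fun t => ∫ s in (0 : ℝ)..t, C s) (B := χ) hC hdi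
    (fun t _ => by simp) (fun t _ => by
      rw [intervalIntegral.integral_deriv_eq_sub
        (fun x _ => hc.differentiable one_ne_zero x) (hd.intervalIntegrable _ _)]) hTT
  rw [hχb T hb.le] at key
  simp only [mul_zero, intervalIntegral.integral_same, zero_mul, sub_zero] at key
  rw [← integral_Ioo_eq hT.le, integral_add] at key
  · linarith
  · obtain ⟨M, hM⟩ := isCompact_Icc.exists_bound_of_continuousOn (hc.continuous.continuousOn (s := Icc 0 T))
    refine hC.mul_bdd (c := M) hc.continuous.aestronglyMeasurable ?_
    filter_upwards [ae_restrict_mem measurableSet_Ioo] with t ht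
    exact hM t (Ioo_subset_Icc_self ht)
  · have hF : ContinuousOn (fun t => ∫ s in (0 : ℝ)..t, C s) (Icc 0 T) := by
      have := intervalIntegral.continuousOn_primitive_interval'
        (intervalIntegrable_of_Ioo hC hTT) left_mem_uIcc
      rwa [uIcc_of_le hT.le] at this
    exact ((hF.mul hd.continuousOn).integrableOn_Icc).mono_set Ioo_subset_Icc_self

lemma exists_Icc_of_tsupport_subset {T : ℝ} (hT : 0 < T) {ψ : ℝ → ℝ} (hψ : HasCompactSupport ψ)
    (h : tsupport ψ ⊆ Ioo 0 T) :
    ∃ a b, 0 < a ∧ a < T ∧ 0 < b ∧ b < T ∧ (∀ t, t < a → ψ t = 0) ∧ ∀ t, b < t → ψ t = 0 := by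
  -- The midpoint is added so that the set is nonempty even for `ψ = 0`, and extremal points exist.
  have hK : IsCompact (insert (T / 2) (tsupport ψ)) := hψ.isCompact.insert _
  have hsub : insert (T / 2) (tsupport ψ) ⊆ Ioo 0 T := by
    intro x hx
    rcases hx with rfl | hx
    · exact ⟨by linarith, by linarith⟩
    · exact h hx
  obtain ⟨a, ha, hla⟩ := hK.exists_isLeast (insert_nonempty _ _)
  obtain ⟨b, hb, hlb⟩ := hK.exists_isGreatest (insert_nonempty _ _)
  refine ⟨a, b, (hsub ha).1, (hsub ha).2, (hsub hb).1, (hsub hb).2, fun t ht => ?_, fun t ht => ?_⟩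
  · by_contra hne
    exact absurd (hla (mem_insert_of_mem _ (subset_tsupport _ hne))) (not_le.2 ht)
  · by_contra hne
    exact absurd (hlb (mem_insert_of_mem _ (subset_tsupport _ hne))) (not_le.2 ht)

/-- A continuous function with vanishing weak derivative on `(0,T)` is constant. -/
lemma eq_of_forall_integral_mul_deriv {T : ℝ} (hT : 0 < T) {B : ℝ → ℝ}
    (hB : ContinuousOn B (Icc 0 T))
    (h : ∀ χ, IsCut T χ → ∫ t in Ioo 0 T, B t * deriv χ t = 0) :
    ∀ t ∈ Icc 0 T, B t = B 0 := by
  have hBi : IntegrableOn B (Ioo 0 T) := hB.integrableOn_Icc.mono_set Ioo_subset_Icc_self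
  -- As in the du Bois-Reymond lemma, a fixed bump of mass one inside `(0,T)` is used to correct the
  -- mean of an arbitrary test function.
  let bump0 : ContDiffBump (T / 2) := ⟨T / 8, T / 4, by positivity, by linarith⟩
  set ψ₀ : ℝ → ℝ := bump0.normed volume with hψ₀
  have h0c : ContDiff ℝ ∞ ψ₀ := bump0.contDiff_normed
  have h0s : HasCompactSupport ψ₀ := bump0.hasCompactSupport_normed
  have h0t : tsupport ψ₀ ⊆ Ioo 0 T := by
    rw [hψ₀, bump0.tsupport_normed_eq, Real.closedBall_eq_Icc]
    intro x hx
    have h1 : T / 2 - T / 4 ≤ x := hx.1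
    have h2 : x ≤ T / 2 + T / 4 := hx.2
    exact ⟨by linarith, by linarith⟩
  have h0i : ∫ t, ψ₀ t = 1 := bump0.integral_normed
  obtain ⟨a₀, b₀, ha₀, -, hb₀p, hb₀, hz₀, hz₀'⟩ := exists_Icc_of_tsupport_subset hT h0s h0t
  have mulint : ∀ ψ : ℝ → ℝ, Continuous ψ → IntegrableOn (fun t => B t * ψ t) (Ioo 0 T) :=
    fun ψ hψ => ((hB.mul hψ.continuousOn).integrableOn_Icc).mono_set Ioo_subset_Icc_self
  set c := ∫ t in Ioo 0 T, B t * ψ₀ t with hc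
  have key : ∀ ψ : ℝ → ℝ, ContDiff ℝ ∞ ψ → HasCompactSupport ψ → tsupport ψ ⊆ Ioo 0 T →
      ∫ t in Ioo 0 T, ψ t • (B t - c) = 0 := by
    intro ψ hψ hψs hψt
    obtain ⟨a, b, ha, -, hbp, hb, hz, hz'⟩ := exists_Icc_of_tsupport_subset hT hψs hψt
    set I := ∫ t, ψ t with hI
    -- `ζ` has zero mean and support inside `(0,T)`, so its primitive vanishes near both ends and is
    -- an admissible cutoff with derivative `ζ`.
    set ζ : ℝ → ℝ := fun t => ψ t - I * ψ₀ t with hζ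
    have hζc : Continuous ζ := hψ.continuous.sub (continuous_const.mul h0c.continuous)
    have hd : ∀ t, HasDerivAt (fun t => ∫ s in (0 : ℝ)..t, ζ s) (ζ t) t := fun t =>
      hζc.integral_hasStrictDerivAt 0 t |>.hasDerivAt
    have hde : deriv (fun t => ∫ s in (0 : ℝ)..t, ζ s) = ζ := funext fun t => (hd t).deriv
    have hζl : ∀ t, t < min a a₀ → ζ t = 0 := fun t ht => by
      simp [hζ, hz t (ht.trans_le (min_le_left _ _)), hz₀ t (ht.trans_le (min_le_right _ _))]
    have hζr : ∀ t, max b b₀ < t → ζ t = 0 := fun t ht => by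
      simp [hζ, hz' t ((le_max_left _ _).trans_lt ht), hz₀' t ((le_max_right _ _).trans_lt ht)]
    have hmin : 0 < min a a₀ := lt_min ha ha₀
    have hmax : max b b₀ < T := max_lt hb hb₀
    have hζi : ∫ t, ζ t = 0 := by
      rw [hζ, integral_sub (hψ.continuous.integrable_of_hasCompactSupport hψs)
        ((h0c.continuous.integrable_of_hasCompactSupport h0s).const_mul _), integral_const_mul,
        h0i]
      simp [hI]
    have hcut : IsCut T (fun t => ∫ s in (0 : ℝ)..t, ζ s) := by
      refine ⟨contDiff_one_iff_deriv.2 ⟨fun t => (hd t).differentiableAt, by rwa [hde]⟩,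
        ⟨min a a₀ / 2, by positivity, fun t ht => ?_⟩, (max b b₀ + T) / 2, by linarith,
        fun t ht => ?_⟩
      · have hz0 : ∫ s in (0 : ℝ)..t, ζ s = ∫ _ in (0 : ℝ)..t, (0 : ℝ) := by
          refine intervalIntegral.integral_congr fun s hs => hζl s ?_
          have h3 : max 0 t ≤ min a a₀ / 2 := max_le (by positivity) ht
          exact (hs.2.trans h3).trans_lt (by linarith)
        simpa using hz0
      · change ∫ s in (0 : ℝ)..t, ζ s = 0
        rw [intervalIntegral.integral_eq_integral_of_support_subset, hζi]
        intro s hs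
        refine ⟨?_, ?_⟩
        · by_contra hn
          exact hs (hζl s ((not_lt.1 hn).trans_lt hmin))
        · by_contra hn
          exact hs (hζr s (lt_of_lt_of_le (by linarith) (not_le.1 hn).le))
    have e := h _ hcut
    rw [hde] at e
    have e1 : ∫ t in Ioo 0 T, B t * ζ t =
        (∫ t in Ioo 0 T, B t * ψ t) - I * ∫ t in Ioo 0 T, B t * ψ₀ t := by
      rw [← integral_const_mul, ← integral_sub (mulint ψ hψ.continuous)
        ((mulint ψ₀ h0c.continuous).const_mul I)]
      congr 1; ext t; simp only [hζ]; ring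
    have e2 : ∫ t in Ioo 0 T, ψ t = I := by
      refine setIntegral_eq_integral_of_forall_compl_eq_zero fun t ht => ?_
      by_contra hn
      exact ht (hψt (subset_tsupport _ hn))
    have e3 : ∫ t in Ioo 0 T, ψ t • (B t - c) = (∫ t in Ioo 0 T, B t * ψ t) - I * c := by
      rw [← e2, ← integral_mul_const, ← integral_sub (mulint ψ hψ.continuous)
        ((hψ.continuous.integrable_of_hasCompactSupport hψs).integrableOn.mul_const c)]
      congr 1; ext t; simp only [smul_eq_mul]; ring
    rw [e3, hc, ← e1, e]
  have hloc : LocallyIntegrableOn (fun t => B t - c) (Ioo 0 T) volume :=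
    (hBi.sub (integrableOn_const (by simp))).locallyIntegrableOn
  have hloc' : LocallyIntegrableOn (fun t => B t - c) (Ioo 0 T) (volume.restrict (Ioo 0 T)) := by
    have : IntegrableOn (fun t => B t - c) (Ioo 0 T) (volume.restrict (Ioo 0 T)) := by
      rw [IntegrableOn, Measure.restrict_restrict measurableSet_Ioo, inter_self]
      exact hBi.sub (integrableOn_const (by simp))
    exact this.locallyIntegrableOn
  have hae := isOpen_Ioo.ae_eq_zero_of_integral_contDiff_smul_eq_zero
    (μ := volume.restrict (Ioo 0 T)) hloc' key
  have hae' : B =ᵐ[volume.restrict (Icc 0 T)] fun _ => c := by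
    rw [← restrict_Ioo_eq_restrict_Icc]
    filter_upwards [hae, ae_restrict_mem measurableSet_Ioo] with t h1 h2
    exact sub_eq_zero.1 (h1 h2)
  have := Measure.eqOn_Icc_of_ae_eq volume hT.ne hae' hB continuousOn_const
  intro t ht
  rw [this ht, this (left_mem_Icc.2 hT.le)]

/-- A continuous function with integrable weak derivative is a primitive of it. -/
lemma sub_eq_primitive_of_weak {T : ℝ} (hT : 0 < T) {A C : ℝ → ℝ} (hA : ContinuousOn A (Icc 0 T))
    (hC : IntegrableOn C (Ioo 0 T))
    (h : ∀ χ, IsCut T χ → ∫ t in Ioo 0 T, A t * deriv χ t = -∫ t in Ioo 0 T, C t * χ t) :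
    ∀ t ∈ Icc 0 T, A t - A 0 = ∫ s in (0 : ℝ)..t, C s := by
  have hF : ContinuousOn (fun t => ∫ s in (0 : ℝ)..t, C s) (Icc 0 T) := by
    have := intervalIntegral.continuousOn_primitive_interval'
      (intervalIntegrable_of_Ioo hC (right_mem_Icc.2 hT.le)) left_mem_uIcc
    rwa [uIcc_of_le hT.le] at this
  have key := eq_of_forall_integral_mul_deriv hT (B := fun t => A t - ∫ s in (0 : ℝ)..t, C s)
    (hA.sub hF) (fun χ hχ => by
      have hd : Continuous (deriv χ) := hχ.1.continuous_deriv le_rfl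
      have i1 : IntegrableOn (fun t => A t * deriv χ t) (Ioo 0 T) :=
        ((hA.mul hd.continuousOn).integrableOn_Icc).mono_set Ioo_subset_Icc_self
      have i2 : IntegrableOn (fun t => (∫ s in (0 : ℝ)..t, C s) * deriv χ t) (Ioo 0 T) :=
        ((hF.mul hd.continuousOn).integrableOn_Icc).mono_set Ioo_subset_Icc_self
      simp_rw [sub_mul]
      rw [integral_sub i1 i2, h χ hχ, hχ.integral_primitive_mul_deriv hT hC, sub_self])
  intro t ht
  have := key t ht
  simp only [intervalIntegral.integral_same, sub_zero] at this
  linarith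

/-! ### Product test functions -/

lemma isC1_time_mul {χ : ℝ → ℝ} {p : Torus d → ℝ} (hχ : ContDiff ℝ 1 χ) (hp : IsC1 p) :
    ContDiff ℝ 1 (fun z : ℝ × (Fin d → ℝ) => χ z.1 * p (fun i => (z.2 i : UnitAddCircle))) :=
  (hχ.comp contDiff_fst).mul
    (ContDiff.comp (g := fun y : Fin d → ℝ => p (fun i => (y i : UnitAddCircle))) hp contDiff_snd)

lemma isInteriorTest_mul {T : ℝ} {χ : ℝ → ℝ} {p : Torus d → ℝ} (hχ : IsCut T χ) (hp : IsC1 p) :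
    IsInteriorTest T (fun t x => χ t * p x) := by
  obtain ⟨hc, ⟨a, ha, hχa⟩, b, hb, hχb⟩ := hχ
  refine ⟨⟨isC1_time_mul hc hp, b, hb, fun t ht x => ?_⟩,
    a, ha, fun t ht x => ?_⟩
  · simp only [hχb t ht, zero_mul]
  · simp only [hχa t ht, zero_mul]

lemma partialDeriv_none_mul {χ : ℝ → ℝ} {p : Torus d → ℝ} (t : ℝ) (x : Torus d) :
    partialDeriv none (fun t x => χ t * p x) t x = deriv χ t * p x := by
  simp [partialDeriv]

lemma partialDeriv_some_mul {χ : ℝ → ℝ} {p : Torus d → ℝ} (i : Fin d) (t : ℝ) (x : Torus d) :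
    partialDeriv (some i) (fun t x => χ t * p x) t x = χ t * spaceDeriv i p x := by
  simp [partialDeriv, spaceDeriv_const_mul]

lemma isTest_zero {T : ℝ} (hT : 0 < T) : IsTest T (fun _ (_ : Torus d) => (0 : ℝ)) :=
  ⟨contDiff_const, 0, hT, fun _ _ _ => rfl⟩

/-! ### Slices of functions on the slab -/

lemma slab_ae {T : ℝ} {P : ℝ → Torus d → Prop} (h : ∀ᵐ z ∂(slab d T), P z.1 z.2) :
    ∀ᵐ t ∂(volume.restrict (Ioo 0 T)), ∀ᵐ x, P t x := Measure.ae_ae_of_ae_prod h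

lemma slab_integrable {T : ℝ} {f : ℝ → Torus d → ℝ}
    (h : Integrable (Function.uncurry f) (slab d T)) :
    ∀ᵐ t ∂(volume.restrict (Ioo 0 T)), Integrable (f t) := h.prod_right_ae

lemma slab_integrableOn {T : ℝ} {f : ℝ → Torus d → ℝ}
    (h : Integrable (Function.uncurry f) (slab d T)) :
    IntegrableOn (fun t => ∫ x, f t x) (Ioo 0 T) := h.integral_prod_left

lemma slab_mul_continuous {T : ℝ} {f : ℝ → Torus d → ℝ} {p : Torus d → ℝ}
    (h : Integrable (Function.uncurry f) (slab d T)) (hp : Continuous p) :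
    Integrable (Function.uncurry fun t x => f t x * p x) (slab d T) := by
  obtain ⟨M, -, hM⟩ := exists_bound_of_continuous hp
  exact h.mul_bdd (c := M) (hp.comp continuous_snd).aestronglyMeasurable
    (Eventually.of_forall fun z => hM z.2)

/-- The integrand `∑ f_j ∂_j p + g p` of a weak equation. -/
def fluxIntegrand {ι : Type*} [Fintype ι] (dir : ι → Fin d) (f : ι → ℝ → Torus d → ℝ)
    (g : ℝ → Torus d → ℝ) (p : Torus d → ℝ) (t : ℝ) (x : Torus d) : ℝ :=
  (∑ j, f j t x * spaceDeriv (dir j) p x) + g t x * p x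

lemma slab_fluxIntegrand {T : ℝ} {ι : Type*} [Fintype ι] {dir : ι → Fin d}
    {f : ι → ℝ → Torus d → ℝ} {g : ℝ → Torus d → ℝ} {p : Torus d → ℝ}
    (hf : ∀ j, Integrable (Function.uncurry (f j)) (slab d T))
    (hg : Integrable (Function.uncurry g) (slab d T)) (hp : IsC1 p) :
    Integrable (Function.uncurry (fluxIntegrand dir f g p)) (slab d T) :=
  (integrable_finsetSum _ fun j _ => slab_mul_continuous (hf j) (hp.continuous_spaceDeriv _)).add
    (slab_mul_continuous hg hp.continuous)

/-- A weak equation on the slab holds at almost every time. -/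
lemma ae_flux_eq_zero {T : ℝ} (hT : 0 < T) {ι : Type*} [Fintype ι] {dir : ι → Fin d}
    {f : ι → ℝ → Torus d → ℝ} {g : ℝ → Torus d → ℝ}
    (hf : ∀ j, Integrable (Function.uncurry (f j)) (slab d T))
    (hg : Integrable (Function.uncurry g) (slab d T))
    (h : ∀ p : Torus d → ℝ, IsSmooth p → ∀ t ∈ Icc 0 T,
      ∫ s in (0 : ℝ)..t, ∫ x, fluxIntegrand dir f g p s x = 0) :
    ∀ᵐ t ∂(volume.restrict (Ioo 0 T)), ∀ {b : Torus d → ℝ} {b' : ι → Torus d → ℝ}, EssBdd b →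
      (∀ j, EssBdd (b' j)) → (∀ j, WkD (dir j) b (b' j)) →
      ∫ x, ((∑ j, f j t x * b' j x) + g t x * b x) = 0 := by
  -- The exceptional times are collected over the countable family of kernel factors; `flux_extend`
  -- then handles all bounded multipliers at the remaining times simultaneously.
  have h1 : ∀ n (a : Fin (kerCard d n)), ∀ᵐ t ∂(volume.restrict (Ioo 0 T)),
      ∫ x, fluxIntegrand dir f g (kerL n a) t x = 0 := fun n a => by
    have hp := isSmooth_kerL (d := d) n a
    exact ae_eq_zero_of_primitive_eq_zero hT
      (slab_integrableOn (slab_fluxIntegrand hf hg hp.isC1)) (h _ hp)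
  have h2 : ∀ᵐ t ∂(volume.restrict (Ioo 0 T)), ∀ j, Integrable (f j t) :=
    ae_all_iff.2 fun j => slab_integrable (hf j)
  filter_upwards [ae_all_iff.2 fun n => ae_all_iff.2 (h1 n), h2, slab_integrable hg]
    with t e1 e2 e3 b b' hb hb' hbb'
  exact flux_extend e2 e3 e1 hb hb' hbb'

/-- A function of time that is orthogonal to all cutoffs has vanishing primitive. -/
lemma primitive_eq_zero_of_weak {T : ℝ} (hT : 0 < T) {C : ℝ → ℝ}
    (hC : IntegrableOn C (Ioo 0 T)) (h : ∀ χ, IsCut T χ → ∫ t in Ioo 0 T, C t * χ t = 0) :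
    ∀ t ∈ Icc 0 T, ∫ s in (0 : ℝ)..t, C s = 0 := fun t ht => by
  rw [← sub_eq_primitive_of_weak hT (A := fun _ => 0) continuousOn_const hC
    (fun χ hχ => by simp [h χ hχ]) t ht, sub_self]

lemma IsCut.mul_integrableOn {T : ℝ} {χ c : ℝ → ℝ} (hχ : IsCut T χ)
    (hc : IntegrableOn c (Ioo 0 T)) : IntegrableOn (fun t => c t * χ t) (Ioo 0 T) := by
  obtain ⟨M, hM⟩ := isCompact_Icc.exists_bound_of_continuousOn
    (hχ.1.continuous.continuousOn (s := Icc 0 T))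
  exact hc.mul_bdd (c := M) hχ.1.continuous.aestronglyMeasurable
    ((ae_restrict_mem measurableSet_Ioo).mono fun t ht => hM t (Ioo_subset_Icc_self ht))

/-- Testing with products `χ(t) p(x)` and removing `χ` gives the identity at almost every time for
each `p`; the countable family of kernel factors makes the null set independent of `p`. -/
lemma HasWeakPartial.ae_wkD {T : ℝ} (hT : 0 < T) {i : Fin d} {f g : ℝ → Torus d → ℝ}
    (h : HasWeakPartial T (some i) f g) :
    ∀ᵐ t ∂(volume.restrict (Ioo 0 T)), WkD i (f t) (g t) := by
  have key : ∀ p : Torus d → ℝ, IsSmooth p → ∀ t ∈ Icc 0 T,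
      ∫ s in (0 : ℝ)..t, ∫ x, fluxIntegrand (fun _ : Unit => i) (fun _ => f) g p s x = 0 := by
    intro p hp
    have i1 := slab_mul_continuous h.integrable (hp.isC1.continuous_spaceDeriv i)
    have i2 := slab_mul_continuous h.integrable_deriv hp.isC1.continuous
    refine primitive_eq_zero_of_weak hT
      (slab_integrableOn (slab_fluxIntegrand (fun _ => h.integrable) h.integrable_deriv hp.isC1))
      fun χ hχ => ?_
    have e := h.parts _ (isInteriorTest_mul hχ hp.isC1)
    simp_rw [partialDeriv_some_mul, ← mul_assoc, mul_right_comm _ (χ _), integral_mul_const] at e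
    have e1 : ∫ t in Ioo 0 T, (∫ x, fluxIntegrand (fun _ : Unit => i) (fun _ => f) g p t x) * χ t =
        ∫ t in Ioo 0 T, ((∫ x, f t x * spaceDeriv i p x) * χ t + (∫ x, g t x * p x) * χ t) := by
      refine integral_congr_ae ?_
      filter_upwards [slab_integrable i1, slab_integrable i2] with s h1 h2
      simp only [fluxIntegrand, Finset.univ_unique, Finset.sum_const, Finset.card_singleton,
        one_smul]
      rw [integral_add h1 h2, add_mul]
    rw [e1, integral_add (hχ.mul_integrableOn (slab_integrableOn i1))
      (hχ.mul_integrableOn (slab_integrableOn i2)), e]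
    ring
  filter_upwards [ae_flux_eq_zero hT (fun _ => h.integrable) h.integrable_deriv key,
    slab_integrable h.integrable, slab_integrable h.integrable_deriv] with t ht h1 h2
  refine WkD.of_kerL h1 h2 fun n a => ?_
  have hs := (isSmooth_kerL (d := d) n a).isC1
  simpa using ht hs.continuous.essBdd (fun _ => (hs.continuous_spaceDeriv i).essBdd)
    (fun _ => hs.wkD i)

/-- A weakly continuous function with a weak time derivative is a primitive of it. -/
lemma HasWeakPartial.eq_primitive {T : ℝ} (hT : 0 < T) {f g : ℝ → Torus d → ℝ}
    (h : HasWeakPartial T none f g)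
    (hc : ∀ p : Torus d → ℝ, IsC1 p → ContinuousOn (fun t => ∫ x, f t x * p x) (Icc 0 T))
    {p : Torus d → ℝ} (hp : IsC1 p) {t : ℝ} (ht : t ∈ Icc 0 T) :
    (∫ x, f t x * p x) - ∫ x, f 0 x * p x = ∫ s in (0 : ℝ)..t, ∫ x, g s x * p x := by
  refine sub_eq_primitive_of_weak hT (hc p hp)
    (slab_integrableOn (slab_mul_continuous h.integrable_deriv hp.continuous))
    (fun χ hχ => ?_) t ht
  have e := h.parts _ (isInteriorTest_mul hχ hp)
  simp_rw [partialDeriv_none_mul, mul_comm (deriv χ _), mul_comm (χ _), ← mul_assoc,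
    integral_mul_const] at e
  exact e

lemma HasWeakPartial.congr_left {T : ℝ} {a : Option (Fin d)} {f f' g : ℝ → Torus d → ℝ}
    (h : HasWeakPartial T a f g) (hf : Function.uncurry f =ᵐ[slab d T] Function.uncurry f') :
    HasWeakPartial T a f' g := by
  refine ⟨h.integrable.congr hf, h.integrable_deriv, fun φ hφ => ?_⟩
  rw [← h.parts φ hφ]
  refine integral_congr_ae ?_
  filter_upwards [slab_ae (P := fun t x => f t x = f' t x) hf] with t ht
  refine integral_congr_ae ?_
  filter_upwards [ht] with x hx
  rw [hx]

end

section

/-! ### Bounded functions on the slab -/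

/-- Essentially bounded measurable functions on the slab. -/
def SlabBdd (T : ℝ) (f : ℝ → Torus d → ℝ) : Prop :=
  AEStronglyMeasurable (Function.uncurry f) (slab d T) ∧
    ∃ M, 0 ≤ M ∧ ∀ᵐ z ∂(slab d T), |f z.1 z.2| ≤ M

instance (T : ℝ) : IsFiniteMeasure (slab d T) := by unfold slab; infer_instance

lemma SlabBdd.integrable {T : ℝ} {f : ℝ → Torus d → ℝ} (h : SlabBdd T f) :
    Integrable (Function.uncurry f) (slab d T) := by
  obtain ⟨hm, M, -, hM⟩ := h
  exact Integrable.of_bound hm M hM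

lemma SlabBdd.mul {T : ℝ} {f g : ℝ → Torus d → ℝ} (hf : SlabBdd T f) (hg : SlabBdd T g) :
    SlabBdd T (fun t x => f t x * g t x) := by
  obtain ⟨hm, M, h0, hM⟩ := hf
  obtain ⟨hm', M', h0', hM'⟩ := hg
  refine ⟨hm.mul hm', M * M', by positivity, ?_⟩
  filter_upwards [hM, hM'] with x h1 h2
  rw [abs_mul]
  exact mul_le_mul h1 h2 (abs_nonneg _) h0

lemma SlabBdd.add {T : ℝ} {f g : ℝ → Torus d → ℝ} (hf : SlabBdd T f) (hg : SlabBdd T g) :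
    SlabBdd T (fun t x => f t x + g t x) := by
  obtain ⟨hm, M, h0, hM⟩ := hf
  obtain ⟨hm', M', h0', hM'⟩ := hg
  refine ⟨hm.add hm', M + M', by positivity, ?_⟩
  filter_upwards [hM, hM'] with x h1 h2
  exact (abs_add_le _ _).trans (add_le_add h1 h2)

lemma SlabBdd.const (T c : ℝ) : SlabBdd T (fun _ (_ : Torus d) => c) :=
  ⟨aestronglyMeasurable_const, |c|, abs_nonneg _, Eventually.of_forall fun _ => le_rfl⟩

lemma SlabBdd.const_mul {T : ℝ} {f : ℝ → Torus d → ℝ} (hf : SlabBdd T f) (c : ℝ) :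
    SlabBdd T (fun t x => c * f t x) := (SlabBdd.const T c).mul hf

lemma SlabBdd.sum {T : ℝ} {ι : Type*} (s : Finset ι) {f : ι → ℝ → Torus d → ℝ}
    (hf : ∀ i, SlabBdd T (f i)) : SlabBdd T (fun t x => ∑ i ∈ s, f i t x) := by
  classical
  induction s using Finset.induction_on with
  | empty => simpa using SlabBdd.const T 0
  | insert a s ha ih => simpa only [Finset.sum_insert ha] using (hf a).add ih

lemma SlabBdd.congr {T : ℝ} {f g : ℝ → Torus d → ℝ} (hf : SlabBdd T f)
    (h : Function.uncurry f =ᵐ[slab d T] Function.uncurry g) : SlabBdd T g := by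
  obtain ⟨hm, M, h0, hM⟩ := hf
  refine ⟨hm.congr h, M, h0, ?_⟩
  filter_upwards [hM, h] with z h1 h2
  have : f z.1 z.2 = g z.1 z.2 := h2
  rwa [← this]

lemma SlabBdd.ae_essBdd {T : ℝ} {f : ℝ → Torus d → ℝ} (hf : SlabBdd T f) :
    ∀ᵐ t ∂(volume.restrict (Ioo 0 T)), EssBdd (f t) := by
  obtain ⟨hm, M, h0, hM⟩ := hf
  filter_upwards [hm.prodMk_left, slab_ae (P := fun t x => |f t x| ≤ M) hM] with t h1 h2
  exact ⟨h1, M, h0, h2⟩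

lemma SlabBdd.mul_integrable {T : ℝ} {f g : ℝ → Torus d → ℝ} (hf : SlabBdd T f)
    (hg : Integrable (Function.uncurry g) (slab d T)) :
    Integrable (Function.uncurry fun t x => g t x * f t x) (slab d T) := by
  obtain ⟨hm, M, -, hM⟩ := hf
  exact hg.mul_bdd (c := M) hm hM

lemma SlabBdd.comp {T : ℝ} {δ R : ℝ} {G : ℝ → ℝ} {r : ℝ → Torus d → ℝ}
    (hr : AEStronglyMeasurable (Function.uncurry r) (slab d T))
    (hmem : ∀ᵐ z ∂(slab d T), r z.1 z.2 ∈ Icc δ R) (hδR : δ ≤ R)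
    (hG : ContinuousOn G (Icc δ R)) : SlabBdd T (fun t x => G (r t x)) := by
  obtain ⟨M, hM⟩ := isCompact_Icc.exists_bound_of_continuousOn hG
  refine ⟨?_, M, (norm_nonneg _).trans (hM δ (left_mem_Icc.2 hδR)), ?_⟩
  · have hc : Continuous (IccExtend hδR ((Icc δ R).domRestrict G)) :=
      (continuousOn_iff_continuous_domRestrict.1 hG).Icc_extend'
    refine (hc.comp_aestronglyMeasurable hr).congr ?_
    filter_upwards [hmem] with x hx
    exact IccExtend_of_mem hδR _ hx
  · filter_upwards [hmem] with x hx using hM _ hx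

/-! ### Bounded weak space derivatives on the slab -/

/-- `f` is bounded with bounded weak derivative `g` in the direction `i`. -/
structure XD (T : ℝ) (i : Fin d) (f g : ℝ → Torus d → ℝ) : Prop where
  bdd_f : SlabBdd T f
  bdd_g : SlabBdd T g
  wkD : ∀ᵐ t ∂(volume.restrict (Ioo 0 T)), WkD i (f t) (g t)

lemma XD.add {T : ℝ} {i : Fin d} {f g f' g' : ℝ → Torus d → ℝ} (h : XD T i f g)
    (h' : XD T i f' g') : XD T i (fun t x => f t x + f' t x) (fun t x => g t x + g' t x) :=
  ⟨h.bdd_f.add h'.bdd_f, h.bdd_g.add h'.bdd_g, by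
    filter_upwards [h.wkD, h'.wkD] with t h1 h2 using h1.add h2⟩

lemma XD.const (T : ℝ) (i : Fin d) (c : ℝ) : XD T i (fun _ _ => c) (fun _ _ => 0) :=
  ⟨SlabBdd.const T c, SlabBdd.const T 0, Eventually.of_forall fun _ => WkD.const i c⟩

lemma XD.const_mul {T : ℝ} {i : Fin d} {f g : ℝ → Torus d → ℝ} (h : XD T i f g) (c : ℝ) :
    XD T i (fun t x => c * f t x) (fun t x => c * g t x) :=
  ⟨h.bdd_f.const_mul c, h.bdd_g.const_mul c, h.wkD.mono fun _ h => h.const_mul c⟩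

lemma XD.mul {T : ℝ} {i : Fin d} {f g f' g' : ℝ → Torus d → ℝ} (h : XD T i f g)
    (h' : XD T i f' g') : XD T i (fun t x => f t x * f' t x)
      (fun t x => g t x * f' t x + f t x * g' t x) :=
  ⟨h.bdd_f.mul h'.bdd_f, (h.bdd_g.mul h'.bdd_f).add (h.bdd_f.mul h'.bdd_g), by
    filter_upwards [h.wkD, h'.wkD, h'.bdd_f.ae_essBdd, h'.bdd_g.ae_essBdd] with t h1 h2 h3 h4
      using h1.mul h2 h3 h4⟩

lemma XD.sum {T : ℝ} {i : Fin d} {ι : Type*} (s : Finset ι) {f g : ι → ℝ → Torus d → ℝ}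
    (h : ∀ j, XD T i (f j) (g j)) :
    XD T i (fun t x => ∑ j ∈ s, f j t x) (fun t x => ∑ j ∈ s, g j t x) := by
  classical
  induction s using Finset.induction_on with
  | empty => simpa using XD.const T i 0
  | insert a s ha ih => simpa only [Finset.sum_insert ha] using (h a).add ih

lemma XD.comp {T : ℝ} {i : Fin d} {r q : ℝ → Torus d → ℝ} (h : XD T i r q) {δ R : ℝ}
    (hmem : ∀ᵐ z ∂(slab d T), r z.1 z.2 ∈ Icc δ R) (hδR : δ ≤ R) {G G' : ℝ → ℝ}
    (hG : ∀ s ∈ Icc δ R, HasDerivAt G (G' s) s) (hG' : ContinuousOn G' (Icc δ R)) :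
    XD T i (fun t x => G (r t x)) (fun t x => G' (r t x) * q t x) :=
  ⟨SlabBdd.comp h.bdd_f.1 hmem hδR fun s hs => (hG s hs).continuousAt.continuousWithinAt,
    (SlabBdd.comp h.bdd_f.1 hmem hδR hG').mul h.bdd_g, by
    filter_upwards [h.wkD, h.bdd_g.ae_essBdd, slab_ae (P := fun t x => r t x ∈ Icc δ R) hmem] with t h1 h2 h3
      using h1.comp h2 h3 hG hG'⟩

/-- Slab functions that agree at almost every point of almost every slice agree. -/
lemma slab_ae_eq {T : ℝ} {f g : ℝ → Torus d → ℝ}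
    (hf : AEStronglyMeasurable (Function.uncurry f) (slab d T))
    (hg : AEStronglyMeasurable (Function.uncurry g) (slab d T))
    (h : ∀ᵐ t ∂(volume.restrict (Ioo 0 T)), f t =ᵐ[volume] g t) :
    Function.uncurry f =ᵐ[slab d T] Function.uncurry g := by
  have h1 : ∀ᵐ z ∂(slab d T), hf.mk _ z = hg.mk _ z := by
    refine (Measure.ae_prod_iff_ae_ae ?_).2 ?_
    · exact hf.stronglyMeasurable_mk.measurableSet_eq_fun hg.stronglyMeasurable_mk
    · filter_upwards [h, Measure.ae_ae_of_ae_prod hf.ae_eq_mk, Measure.ae_ae_of_ae_prod hg.ae_eq_mk]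
        with t h1 h2 h3
      filter_upwards [h1, h2, h3] with x e1 e2 e3
      rw [← e2, ← e3]
      exact e1
  filter_upwards [h1, hf.ae_eq_mk, hg.ae_eq_mk] with z e1 e2 e3
  rw [e2, e3, e1]

/-! ### Weak time derivatives and pairings -/

/-- `f` is bounded, at every time, and has the bounded weak time derivative `g`. -/
structure TD (T : ℝ) (f g : ℝ → Torus d → ℝ) : Prop where
  bdd_f : SlabBdd T f
  slice : ∃ M, 0 ≤ M ∧ ∀ t ∈ Icc 0 T, AEStronglyMeasurable (f t) volume ∧ ∀ᵐ x, |f t x| ≤ M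
  bdd_g : SlabBdd T g
  eq : ∀ p : Torus d → ℝ, IsC1 p → ∀ t ∈ Icc 0 T,
    (∫ x, f t x * p x) - ∫ x, f 0 x * p x = ∫ s in (0 : ℝ)..t, ∫ x, g s x * p x

lemma TD.essBdd {T : ℝ} {f g : ℝ → Torus d → ℝ} (h : TD T f g) {t : ℝ} (ht : t ∈ Icc 0 T) :
    EssBdd (f t) := by
  obtain ⟨M, h0, hM⟩ := h.slice
  exact ⟨(hM t ht).1, M, h0, (hM t ht).2⟩

/-- `∂_t a = -∑ ∂_j f_j + g` weakly, where `∂_j` is the derivative in the direction `dir j`. -/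
structure FluxEq (T : ℝ) {ι : Type*} [Fintype ι] (dir : ι → Fin d) (a : ℝ → Torus d → ℝ)
    (f : ι → ℝ → Torus d → ℝ) (g : ℝ → Torus d → ℝ) : Prop where
  int_slice : ∀ t ∈ Icc 0 T, Integrable (a t)
  int_a : Integrable (Function.uncurry a) (slab d T)
  int_f : ∀ j, Integrable (Function.uncurry (f j)) (slab d T)
  int_g : Integrable (Function.uncurry g) (slab d T)
  eq : ∀ p : Torus d → ℝ, IsC1 p → ∀ t ∈ Icc 0 T,
    (∫ x, a t x * p x) - ∫ x, a 0 x * p x =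
      ∫ s in (0 : ℝ)..t, ∫ x, fluxIntegrand dir f g p s x

lemma mollify_abs_le_of_essBdd {f : Torus d → ℝ} (hf : Integrable f) {M : ℝ}
    (hM : ∀ᵐ x, |f x| ≤ M) {g : Torus d → ℝ} (hg : Integrable g) (n : ℕ) :
    |∫ x, g x * mollify n f x| ≤ M * ∫ x, |g x| :=
  abs_integral_mul_le hg (Eventually.of_forall fun x => abs_mollify_le hf hM n x)

lemma integral_mul_mollify {f g : Torus d → ℝ} (hf : Integrable f) (hg : Integrable g) (n : ℕ) :
    ∫ x, g x * mollify n f x = ∑ a, (∫ x, g x * kerL n a x) * ∫ y, kerR n a y * f y := by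
  simp_rw [mollify_eq_sum hf, Finset.mul_sum, ← mul_assoc]
  rw [integral_finsetSum _ fun a _ =>
    (hg.mul_continuous (isSmooth_kerL n a).continuous).mul_const _]
  simp_rw [integral_mul_const]

lemma mollify_wkD_eq_sum {i : Fin d} {f g : Torus d → ℝ} (h : WkD i f g) (n : ℕ) (x : Torus d) :
    mollify n g x = ∑ a, spaceDeriv i (kerL n a) x * ∫ y, kerR n a y * f y := by
  rw [← spaceDeriv_mollify h]
  have : mollify n f = fun x => ∑ a, (∫ y, kerR n a y * f y) * kerL n a x :=
    funext fun x => by rw [mollify_eq_sum h.int_f]; simp_rw [mul_comm]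
  rw [this, spaceDeriv_sum fun a _ => (IsC1.const _).mul (isSmooth_kerL n a).isC1]
  simp_rw [spaceDeriv_const_mul, mul_comm]

lemma integral_mul_mollify_wkD {i : Fin d} {f f' g : Torus d → ℝ} (h : WkD i f f')
    (hg : Integrable g) (n : ℕ) :
    ∫ x, g x * mollify n f' x =
      ∑ a, (∫ x, g x * spaceDeriv i (kerL n a) x) * ∫ y, kerR n a y * f y := by
  simp_rw [mollify_wkD_eq_sum h, Finset.mul_sum, ← mul_assoc]
  rw [integral_finsetSum _ fun a _ =>
    (hg.mul_continuous ((isSmooth_kerL n a).isC1.continuous_spaceDeriv i)).mul_const _]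
  simp_rw [integral_mul_const]

/-- The evolution of a pairing `∫ a b`, given the evolution of the pairings of `a` with the factors
of the mollifying kernel. -/
theorem pairing_of_kernel {T : ℝ} {ι : Type*} [Fintype ι] {a b bt : ℝ → Torus d → ℝ}
    {f b' : ι → ℝ → Torus d → ℝ} (ha : ∀ t ∈ Icc 0 T, Integrable (a t))
    (ha' : Integrable (Function.uncurry a) (slab d T))
    (hf : ∀ j, Integrable (Function.uncurry (f j)) (slab d T)) (hb : TD T b bt)
    (hb' : ∀ j, SlabBdd T (b' j)) {c : (n : ℕ) → Fin (kerCard d n) → ℝ → ℝ}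
    (ic : ∀ n α, IntegrableOn (c n α) (Ioo 0 T))
    (pA : ∀ n α, ∀ t ∈ Icc 0 T, (∫ x, a t x * kerL n α x) - ∫ x, a 0 x * kerL n α x =
      ∫ s in (0 : ℝ)..t, c n α s)
    (hc : ∀ n, ∀ᵐ s ∂(volume.restrict (Ioo 0 T)), ∑ α, c n α s * ∫ x, kerR n α x * b s x =
      ∑ j, ∫ x, f j s x * mollify n (b' j s) x) {t : ℝ} (ht : t ∈ Icc 0 T) :
    (∫ x, a t x * b t x) - ∫ x, a 0 x * b 0 x =
      ∫ s in (0 : ℝ)..t, ∫ x, ((∑ j, f j s x * b' j s x) + a s x * bt s x) := by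
  have h0T : (0 : ℝ) ∈ Icc 0 T := ⟨le_rfl, ht.1.trans ht.2⟩
  set P : ℕ → ℝ → ℝ := fun n s => (∑ j, ∫ x, f j s x * mollify n (b' j s) x) +
    ∫ x, a s x * mollify n (bt s) x with hP
  have hIcc : ∀ᵐ s ∂(volume.restrict (Ioo 0 T)), s ∈ Icc 0 T :=
    (ae_restrict_mem measurableSet_Ioo).mono fun s hs => Ioo_subset_Icc_self hs
  have hfa : ∀ᵐ s ∂(volume.restrict (Ioo 0 T)), ∀ j, Integrable (f j s) :=
    ae_all_iff.2 fun j => slab_integrable (hf j)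
  have hb'a : ∀ᵐ s ∂(volume.restrict (Ioo 0 T)), ∀ j, EssBdd (b' j s) :=
    ae_all_iff.2 fun j => (hb' j).ae_essBdd
  have hbta := hb.bdd_g.ae_essBdd
  -- With the mollified `b`, the pairing is a finite sum of products of a moment of `a` and a moment
  -- of `b`. Both moments are primitives in time, so the product rule applies to each term.
  have key : ∀ n, IntegrableOn (P n) (Ioo 0 T) ∧
      (∫ x, a t x * mollify n (b t) x) - ∫ x, a 0 x * mollify n (b 0) x =
      ∫ s in (0 : ℝ)..t, P n s := by
    intro n
    set A : Fin (kerCard d n) → ℝ → ℝ := fun α s => ∫ x, a s x * kerL n α x with hA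
    set B : Fin (kerCard d n) → ℝ → ℝ := fun α s => ∫ x, kerR n α x * b s x with hB
    set e : Fin (kerCard d n) → ℝ → ℝ := fun α s => ∫ x, bt s x * kerR n α x with he
    have ie : ∀ α, IntegrableOn (e α) (Ioo 0 T) := fun α =>
      slab_integrableOn (slab_mul_continuous hb.bdd_g.integrable (isSmooth_kerR n α).continuous)
    have pB : ∀ α, ∀ t ∈ Icc 0 T, B α t - B α 0 = ∫ s in (0 : ℝ)..t, e α s := fun α t ht => by
      simp only [hB, he, mul_comm (kerR n α _)]
      exact hb.eq _ (isSmooth_kerR n α).isC1 t ht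
    have ice : ∀ α, IntegrableOn (fun s => c n α s * B α s + A α s * e α s) (Ioo 0 T) := fun α =>
      integrableOn_mul_primitive (ic n α) (ie α) (pA n α) (pB α)
    have hPe : ∀ᵐ s ∂(volume.restrict (Ioo 0 T)),
        ∑ α, (c n α s * B α s + A α s * e α s) = P n s := by
      filter_upwards [hIcc, hbta, hc n] with s k1 k6 k7
      rw [hP]
      simp only
      rw [integral_mul_mollify k6.integrable (ha s k1), ← k7, ← Finset.sum_add_distrib]
      refine Finset.sum_congr rfl fun α _ => ?_
      simp only [hA, he, hB, mul_comm (bt s _)]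
    refine ⟨(integrable_finsetSum _ fun α _ => ice α).congr hPe, ?_⟩
    rw [integral_mul_mollify (hb.essBdd ht).integrable (ha t ht),
      integral_mul_mollify (hb.essBdd h0T).integrable (ha 0 h0T),
      ← intervalIntegral_congr_Ioo hPe ht, intervalIntegral.integral_finsetSum fun α _ =>
        intervalIntegrable_of_Ioo (ice α) ht, ← Finset.sum_sub_distrib]
    exact Finset.sum_congr rfl fun α _ =>
      intervalIntegral_mul_primitive (ic n α) (ie α) (pA n α) (pB α) ht
  have lim1 := (tendsto_integral_mul_mollify (ha t ht) (hb.essBdd ht)).sub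
    (tendsto_integral_mul_mollify (ha 0 h0T) (hb.essBdd h0T))
  choose M' hM'0 hM' using fun j => (hb' j).2
  obtain ⟨Mt, hMt0, hMt⟩ := hb.bdd_g.2
  -- Mollification does not increase sup norms, so the rates `P n` have a majorant independent of
  -- `n` and integrable in time; dominated convergence then gives the limit of the right-hand side.
  set bound : ℝ → ℝ := fun s => (∑ j, M' j * ∫ x, |f j s x|) + Mt * ∫ x, |a s x| with hbound
  have ibound : IntegrableOn bound (Ioo 0 T) := by
    refine (integrable_finsetSum _ fun j _ => ?_).add ?_
    · exact (slab_integrableOn (f := fun s x => |f j s x|) (hf j).abs).const_mul _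
    · exact (slab_integrableOn (f := fun s x => |a s x|) ha'.abs).const_mul _
  have hM'a : ∀ᵐ s ∂(volume.restrict (Ioo 0 T)), ∀ j, ∀ᵐ x, |b' j s x| ≤ M' j :=
    ae_all_iff.2 fun j => slab_ae (P := fun s x => |b' j s x| ≤ M' j) (hM' j)
  have good : ∀ᵐ s ∂(volume.restrict (Ioo 0 T)), (∀ n, ‖P n s‖ ≤ bound s) ∧
      Tendsto (fun n => P n s) atTop
        (𝓝 (∫ x, ((∑ j, f j s x * b' j s x) + a s x * bt s x))) := by
    filter_upwards [hIcc, hfa, hb'a, hbta, hM'a,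
      slab_ae (P := fun s x => |bt s x| ≤ Mt) hMt] with s k1 k2 k5 k6 k7 k8
    have ka := ha s k1
    constructor
    · intro n
      rw [hP, hbound]
      simp only [Real.norm_eq_abs]
      refine (abs_add_le _ _).trans (add_le_add ?_ ?_)
      · exact (Finset.abs_sum_le_sum_abs _ _).trans (Finset.sum_le_sum fun j _ =>
          mollify_abs_le_of_essBdd (k5 j).integrable (k7 j) (k2 j) n)
      · exact mollify_abs_le_of_essBdd k6.integrable k8 ka n
    · rw [integral_add, integral_finsetSum]
      · exact (tendsto_finsetSum _ fun j _ => tendsto_integral_mul_mollify (k2 j) (k5 j)).add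
          (tendsto_integral_mul_mollify ka k6)
      · exact fun j _ => (k5 j).integrable_mul (k2 j)
      · exact integrable_finsetSum _ fun j _ => (k5 j).integrable_mul (k2 j)
      · exact k6.integrable_mul ka
  have good' := (ae_restrict_iff' measurableSet_Ioc).1 (ae_Ioc_of_ae_Ioo good ht)
  have lim2 := intervalIntegral.tendsto_integral_filter_of_dominated_convergence
    (μ := volume) (a := (0 : ℝ)) (b := t) (F := P) (l := atTop) bound
    (Eventually.of_forall fun n => by
      rw [uIoc_of_le ht.1]
      exact ((intervalIntegrable_iff_integrableOn_Ioc_of_le ht.1).1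
        (intervalIntegrable_of_Ioo (key n).1 ht)).aestronglyMeasurable)
    (Eventually.of_forall fun n => by
      rw [uIoc_of_le ht.1]
      exact good'.mono fun s hs hst => (hs hst).1 n)
    (intervalIntegrable_of_Ioo ibound ht)
    (by rw [uIoc_of_le ht.1]; exact good'.mono fun s hs hst => (hs hst).2)
  simp_rw [fun n => (key n).2] at lim1
  exact tendsto_nhds_unique lim1 lim2

/-- The evolution of the pairing of a weak solution with a bounded function that has bounded weak
derivatives. -/
theorem FluxEq.pairing {T : ℝ} {ι : Type*} [Fintype ι] {dir : ι → Fin d}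
    {a : ℝ → Torus d → ℝ} {f : ι → ℝ → Torus d → ℝ} {g : ℝ → Torus d → ℝ}
    (h : FluxEq T dir a f g) {b bt : ℝ → Torus d → ℝ} (hb : TD T b bt)
    {b' : ι → ℝ → Torus d → ℝ} (hb' : ∀ j, XD T (dir j) b (b' j)) {t : ℝ} (ht : t ∈ Icc 0 T) :
    (∫ x, a t x * b t x) - ∫ x, a 0 x * b 0 x =
      ∫ s in (0 : ℝ)..t, ∫ x, ((∑ j, f j s x * b' j s x) + g s x * b s x + a s x * bt s x) := by
  -- The source `g` is treated as one more flux, indexed by `none`, whose companion is `b` itself in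
  -- place of a derivative of `b`.
  have := pairing_of_kernel (ι := Option ι) (f := fun o => o.elim g f) (b' := fun o => o.elim b b')
    h.int_slice h.int_a (fun o => by cases o; exacts [h.int_g, h.int_f _]) hb
    (fun o => by cases o; exacts [hb.bdd_f, (hb' _).bdd_g])
    (fun n α => slab_integrableOn (slab_fluxIntegrand h.int_f h.int_g (isSmooth_kerL n α).isC1))
    (fun n α => h.eq _ (isSmooth_kerL n α).isC1) (fun n => ?_) ht
  · simpa only [Fintype.sum_option, Option.elim_none, Option.elim_some, add_comm] using this
  · filter_upwards [hb.bdd_f.ae_essBdd, ae_all_iff.2 fun j => slab_integrable (h.int_f j),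
      slab_integrable h.int_g, ae_all_iff.2 fun j => (hb' j).wkD] with s kb k2 k3 k4
    simp only [Fintype.sum_option, Option.elim_none, Option.elim_some]
    rw [integral_mul_mollify kb.integrable k3]
    simp_rw [fun j => integral_mul_mollify_wkD (k4 j) (k2 j) n]
    rw [Finset.sum_comm, ← Finset.sum_add_distrib]
    refine Finset.sum_congr rfl fun α _ => ?_
    have hs := isSmooth_kerL (d := d) n α
    have hcα : ∫ x, fluxIntegrand dir f g (kerL n α) s x = (∫ x, g s x * kerL n α x) +
        ∑ j, ∫ x, f j s x * spaceDeriv (dir j) (kerL n α) x := by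
      simp only [fluxIntegrand]
      have i1 : ∀ j, Integrable fun x => f j s x * spaceDeriv (dir j) (kerL n α) x :=
        fun j => (k2 j).mul_continuous (hs.isC1.continuous_spaceDeriv _)
      rw [integral_add (integrable_finsetSum _ fun j _ => i1 j)
        (k3.mul_continuous hs.continuous), integral_finsetSum _ fun j _ => i1 j, add_comm]
    rw [hcα, ← Finset.sum_mul, ← add_mul]

/-- The evolution of the pairing of the gradient of the density with a function that has two
bounded weak space derivatives. -/
theorem FluxEq.pairing_grad {T : ℝ} {i : Fin d} {a q : ℝ → Torus d → ℝ}
    {m : Fin d → ℝ → Torus d → ℝ} (h : FluxEq T id a m (fun _ _ => 0))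
    (hq : ∀ t ∈ Icc 0 T, WkD i (a t) (q t)) (iq : Integrable (Function.uncurry q) (slab d T))
    {b bt X : ℝ → Torus d → ℝ} {Y : Fin d → ℝ → Torus d → ℝ} (hb : TD T b bt)
    (hX : XD T i b X) (hY : ∀ j, XD T j X (Y j)) {t : ℝ} (ht : t ∈ Icc 0 T) :
    (∫ x, q t x * b t x) - ∫ x, q 0 x * b 0 x =
      ∫ s in (0 : ℝ)..t, ∫ x, ((∑ j, -m j s x * Y j s x) + q s x * bt s x) := by
  have h0T : (0 : ℝ) ∈ Icc 0 T := ⟨le_rfl, ht.1.trans ht.2⟩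
  have hsm := fun n α => (isSmooth_kerL (d := d) n α).spaceDeriv i
  refine pairing_of_kernel (c := fun n α s => -∫ x, fluxIntegrand id m (fun _ _ => 0)
    (spaceDeriv i (kerL n α)) s x) (fun t ht => (hq t ht).int_g) iq (f := fun j t x => -m j t x)
    (fun j => (h.int_f j).neg) hb (fun j => (hY j).bdd_g) (fun n α =>
      (slab_integrableOn (slab_fluxIntegrand h.int_f h.int_g (hsm n α).isC1)).neg)
    (fun n α t ht => ?_) (fun n => ?_) ht
  -- A moment of the gradient against a kernel factor is minus the moment of the density against its
  -- `i`-th derivative, which the equation for the density evolves.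
  · have e := h.eq _ (hsm n α).isC1 t ht
    rw [(hq t ht).parts _ (isSmooth_kerL n α).isC1,
      (hq 0 h0T).parts _ (isSmooth_kerL n α).isC1] at e
    rw [intervalIntegral.integral_neg, ← e]
    ring
  · filter_upwards [ae_all_iff.2 fun j => slab_integrable (h.int_f j), hX.wkD,
      ae_all_iff.2 fun j => (hY j).wkD] with s k2 k3 k4
    -- The two derivatives of the left factor reproduce the mollified second derivative `Y j = ∂_j
    -- ∂_i b`; of the first derivatives of `b` only `∂_i b` is involved.
    have e1 : ∀ j x, mollify n (Y j s) x =
        ∑ α, spaceDeriv j (spaceDeriv i (kerL n α)) x * ∫ y, kerR n α y * b s y := fun j x => by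
      rw [← spaceDeriv_mollify (k4 j)]
      have : mollify n (X s) = fun x => ∑ α, (∫ y, kerR n α y * b s y) *
          spaceDeriv i (kerL n α) x :=
        funext fun x => by rw [mollify_wkD_eq_sum k3]; simp_rw [mul_comm]
      rw [this, spaceDeriv_sum fun α _ => (IsC1.const _).mul (hsm n α).isC1]
      simp_rw [spaceDeriv_const_mul, mul_comm]
    have i1 : ∀ j α, Integrable fun x => m j s x * spaceDeriv j (spaceDeriv i (kerL n α)) x :=
      fun j α => (k2 j).mul_continuous ((hsm n α).isC1.continuous_spaceDeriv _)
    have e2 : ∀ j, ∫ x, -m j s x * mollify n (Y j s) x =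
        ∑ α, -(∫ x, m j s x * spaceDeriv j (spaceDeriv i (kerL n α)) x) *
          ∫ y, kerR n α y * b s y := fun j => by
      simp_rw [e1, Finset.mul_sum, ← mul_assoc, neg_mul, Finset.sum_neg_distrib]
      rw [integral_neg, integral_finsetSum _ fun α _ => (i1 j α).mul_const _]
      simp_rw [integral_mul_const]
    rw [Finset.sum_congr rfl fun j _ => e2 j, Finset.sum_comm]
    refine Finset.sum_congr rfl fun α _ => ?_
    simp only [fluxIntegrand, zero_mul, add_zero, id]
    rw [integral_finsetSum _ fun j _ => i1 j α, ← Finset.sum_mul, Finset.sum_neg_distrib]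

/-! ### Algebra of weak time derivatives -/

/-- A weak time derivative is a flux equation with an empty set of fluxes. Through this, the pairing
theorem also serves as the product rule in time. -/
lemma TD.fluxEq {T : ℝ} {f g : ℝ → Torus d → ℝ} (h : TD T f g) (dir : Fin 0 → Fin d) :
    FluxEq T dir f (fun j => j.elim0) g :=
  ⟨fun _ ht => (h.essBdd ht).integrable, h.bdd_f.integrable, fun j => j.elim0,
    h.bdd_g.integrable, fun p hp t ht => by simpa [fluxIntegrand] using h.eq p hp t ht⟩

lemma TD.mul_static {T : ℝ} {f g : ℝ → Torus d → ℝ} (h : TD T f g) {p : Torus d → ℝ}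
    (hp : IsC1 p) : TD T (fun t x => f t x * p x) (fun t x => g t x * p x) := by
  obtain ⟨M', h0', hM'⟩ := exists_bound_of_continuous hp.continuous
  have hpb : SlabBdd T (fun _ => p) := ⟨(hp.continuous.comp continuous_snd).aestronglyMeasurable,
    M', h0', Eventually.of_forall fun z => hM' z.2⟩
  obtain ⟨M, h0, hM⟩ := h.slice
  refine ⟨h.bdd_f.mul hpb, ⟨M * M', by positivity, fun t ht =>
    ⟨(hM t ht).1.mul hp.continuous.aestronglyMeasurable, ?_⟩⟩, h.bdd_g.mul hpb,
    fun q hq t ht => ?_⟩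
  · filter_upwards [(hM t ht).2] with x hx
    rw [abs_mul]
    exact mul_le_mul hx (hM' x) (abs_nonneg _) h0
  · simp_rw [mul_assoc]
    exact h.eq _ (hp.mul hq) t ht

/-- Tested with a static function `p`, the product rule is the evolution of the pairing of `f` with
`f' p`. -/
lemma TD.mul {T : ℝ} {f g f' g' : ℝ → Torus d → ℝ} (h : TD T f g) (h' : TD T f' g') :
    TD T (fun t x => f t x * f' t x) (fun t x => g t x * f' t x + f t x * g' t x) := by
  obtain ⟨M, h0, hM⟩ := h.slice
  obtain ⟨M', h0', hM'⟩ := h'.slice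
  refine ⟨h.bdd_f.mul h'.bdd_f, ⟨M * M', by positivity, fun t ht =>
    ⟨(hM t ht).1.mul (hM' t ht).1, ?_⟩⟩, (h.bdd_g.mul h'.bdd_f).add (h.bdd_f.mul h'.bdd_g),
    fun p hp t ht => ?_⟩
  · filter_upwards [(hM t ht).2, (hM' t ht).2] with x hx hx'
    rw [abs_mul]
    exact mul_le_mul hx hx' (abs_nonneg _) h0
  · have := (h.fluxEq (d := d) (fun j => j.elim0)).pairing (h'.mul_static hp)
      (b' := fun j => j.elim0) (fun j => j.elim0) ht
    simp only [Finset.univ_eq_empty, Finset.sum_empty, zero_add, ← mul_assoc] at this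
    simp_rw [add_mul]
    exact this

lemma TD.add {T : ℝ} {f g f' g' : ℝ → Torus d → ℝ} (h : TD T f g) (h' : TD T f' g') :
    TD T (fun t x => f t x + f' t x) (fun t x => g t x + g' t x) := by
  obtain ⟨M, h0, hM⟩ := h.slice
  obtain ⟨M', h0', hM'⟩ := h'.slice
  refine ⟨h.bdd_f.add h'.bdd_f, ⟨M + M', by positivity, fun t ht =>
    ⟨(hM t ht).1.add (hM' t ht).1, ?_⟩⟩, h.bdd_g.add h'.bdd_g, fun p hp t ht => ?_⟩
  · filter_upwards [(hM t ht).2, (hM' t ht).2] with x hx hx'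
    exact (abs_add_le _ _).trans (add_le_add hx hx')
  · have h0T : (0 : ℝ) ∈ Icc 0 T := ⟨le_rfl, ht.1.trans ht.2⟩
    have e : ∀ {t}, t ∈ Icc 0 T → ∫ x, (f t x + f' t x) * p x =
        (∫ x, f t x * p x) + ∫ x, f' t x * p x := fun ht => by
      simp_rw [add_mul]
      exact integral_add ((h.essBdd ht).integrable.mul_continuous hp.continuous)
        ((h'.essBdd ht).integrable.mul_continuous hp.continuous)
    have i1 := slab_mul_continuous h.bdd_g.integrable hp.continuous
    have i2 := slab_mul_continuous h'.bdd_g.integrable hp.continuous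
    have e2 : ∀ᵐ s ∂(volume.restrict (Ioo 0 T)), ∫ x, (g s x + g' s x) * p x =
        (∫ x, g s x * p x) + ∫ x, g' s x * p x := by
      filter_upwards [slab_integrable i1, slab_integrable i2] with s k1 k2
      simp_rw [add_mul]
      exact integral_add k1 k2
    rw [e ht, e h0T, intervalIntegral_congr_Ioo e2 ht, intervalIntegral.integral_add
      (intervalIntegrable_of_Ioo (slab_integrableOn i1) ht)
      (intervalIntegrable_of_Ioo (slab_integrableOn i2) ht), ← h.eq p hp t ht, ← h'.eq p hp t ht]
    ring

lemma TD.const (T c : ℝ) : TD T (fun _ (_ : Torus d) => c) (fun _ _ => 0) :=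
  ⟨SlabBdd.const T c, ⟨|c|, abs_nonneg _, fun _ _ =>
    ⟨aestronglyMeasurable_const, Eventually.of_forall fun _ => le_rfl⟩⟩, SlabBdd.const T 0,
    fun p hp t ht => by simp⟩

lemma TD.const_mul {T : ℝ} {f g : ℝ → Torus d → ℝ} (h : TD T f g) (c : ℝ) :
    TD T (fun t x => c * f t x) (fun t x => c * g t x) := by
  simpa using (TD.const T c).mul h

lemma TD.sum {T : ℝ} {ι : Type*} (s : Finset ι) {f g : ι → ℝ → Torus d → ℝ}
    (h : ∀ j, TD T (f j) (g j)) :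
    TD T (fun t x => ∑ j ∈ s, f j t x) (fun t x => ∑ j ∈ s, g j t x) := by
  classical
  induction s using Finset.induction_on with
  | empty => simpa using TD.const T 0
  | insert a s ha ih => simpa only [Finset.sum_insert ha] using (h a).add ih

lemma TD.polynomial {T : ℝ} {r q : ℝ → Torus d → ℝ} (h : TD T r q) (P : Polynomial ℝ) :
    TD T (fun t x => P.eval (r t x)) (fun t x => P.derivative.eval (r t x) * q t x) := by
  induction P using Polynomial.induction_on with
  | C a => simpa using TD.const T a
  | add p p' hp hp' => simpa [add_mul] using hp.add hp'
  | monomial n a ih =>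
    have := ih.mul h
    convert this using 3
    · simp [pow_succ, mul_assoc]
    · simp only [Polynomial.derivative_mul, Polynomial.derivative_C, Polynomial.derivative_X_pow,
        Polynomial.eval_mul, Polynomial.eval_C, Polynomial.eval_pow, Polynomial.eval_X, zero_mul,
        zero_add]
      rcases n with _ | n
      · simp
      · simp; ring

lemma abs_integral_sub_mul_le {u v p : Torus d → ℝ} {ε : ℝ} (hu : EssBdd u) (hv : EssBdd v)
    (hp : Integrable p) (h : ∀ᵐ x, |u x - v x| ≤ ε) :
    |(∫ x, u x * p x) - ∫ x, v x * p x| ≤ ε * ∫ x, |p x| := by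
  rw [← integral_sub (hu.mul_integrable hp) (hv.mul_integrable hp)]
  simp_rw [← sub_mul, mul_comm _ (p _)]
  exact abs_integral_mul_le hp h

/-- The chain rule in time. -/
lemma TD.comp {T : ℝ} {r q : ℝ → Torus d → ℝ} (h : TD T r q) {δ R : ℝ} (hδR : δ ≤ R)
    (hmem : ∀ t ∈ Icc 0 T, ∀ᵐ x, r t x ∈ Icc δ R)
    (hmem' : ∀ᵐ z ∂(slab d T), r z.1 z.2 ∈ Icc δ R) {G G' : ℝ → ℝ}
    (hG : ∀ s ∈ Icc δ R, HasDerivAt G (G' s) s) (hG' : ContinuousOn G' (Icc δ R)) :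
    TD T (fun t x => G (r t x)) (fun t x => G' (r t x) * q t x) := by
  have hGc : ContinuousOn G (Icc δ R) := fun s hs => (hG s hs).continuousAt.continuousWithinAt
  have hbd : ∀ t ∈ Icc 0 T, EssBdd fun x => G (r t x) := fun t ht =>
    EssBdd.comp_of_mem_Icc (h.essBdd ht).1 (hmem t ht) hGc
  have hbg : SlabBdd T (fun t x => G' (r t x) * q t x) :=
    (SlabBdd.comp h.bdd_f.1 hmem' hδR hG').mul h.bdd_g
  obtain ⟨M, hM⟩ := isCompact_Icc.exists_bound_of_continuousOn hGc
  refine ⟨SlabBdd.comp h.bdd_f.1 hmem' hδR hGc, ⟨M, (norm_nonneg _).trans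
    (hM δ (left_mem_Icc.2 hδR)), fun t ht => ⟨(hbd t ht).1, (hmem t ht).mono fun x hx => hM _ hx⟩⟩,
    hbg, fun p hp t ht => ?_⟩
  have h0T : (0 : ℝ) ∈ Icc 0 T := ⟨le_rfl, ht.1.trans ht.2⟩
  have hpi : Integrable p := hp.continuous.integrable_torus
  have iqp := slab_mul_continuous h.bdd_g.integrable hp.continuous
  -- As for the chain rule in space, the error of a polynomial approximation is at most `K` times
  -- its size: one term for each of the two endpoint times and one for the time integral.
  set K := 2 * (∫ x, |p x|) + ∫ s in (0 : ℝ)..t, ∫ x, |q s x * p x| with hK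
  have hK0 : 0 ≤ K := add_nonneg (mul_nonneg zero_le_two (integral_nonneg fun _ => abs_nonneg _))
    (intervalIntegral.integral_nonneg ht.1 fun _ _ => integral_nonneg fun _ => abs_nonneg _)
  rw [← sub_eq_zero, ← abs_eq_zero]
  refine le_antisymm (le_of_forall_pos_le_add fun ε hε => ?_) (abs_nonneg _)
  set ε' := ε / (K + 1) with hε'
  have hε'0 : 0 < ε' := by positivity
  obtain ⟨P, hP⟩ := exists_polynomial_approx hG hG' hε'0
  have hw := h.polynomial P
  have e := hw.eq p hp t ht
  have b1 : ∀ {t}, t ∈ Icc 0 T →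
      |(∫ x, G (r t x) * p x) - ∫ x, P.eval (r t x) * p x| ≤ ε' * ∫ x, |p x| := fun ht =>
    abs_integral_sub_mul_le (hbd _ ht) (hw.essBdd ht) hpi
      ((hmem _ ht).mono fun x hx => by rw [abs_sub_comm]; exact (hP _ hx).1)
  have i1 := slab_mul_continuous hbg.integrable hp.continuous
  have i2 := slab_mul_continuous hw.bdd_g.integrable hp.continuous
  have b3 : |(∫ s in (0 : ℝ)..t, ∫ x, G' (r s x) * q s x * p x) -
      ∫ s in (0 : ℝ)..t, ∫ x, P.derivative.eval (r s x) * q s x * p x| ≤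
      ε' * ∫ s in (0 : ℝ)..t, ∫ x, |q s x * p x| := by
    rw [← intervalIntegral.integral_sub (intervalIntegrable_of_Ioo (slab_integrableOn i1) ht)
      (intervalIntegrable_of_Ioo (slab_integrableOn i2) ht), ← intervalIntegral.integral_const_mul,
      ← Real.norm_eq_abs]
    refine intervalIntegral.norm_integral_le_of_norm_le ht.1 ?_
      (intervalIntegrable_of_Ioo ((slab_integrableOn (f := fun s x => |q s x * p x|)
        iqp.abs).const_mul _) ht)
    rw [← ae_restrict_iff' measurableSet_Ioc]
    refine ae_Ioc_of_ae_Ioo ?_ ht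
    filter_upwards [slab_integrable i1, slab_integrable i2, slab_integrable iqp,
      slab_ae (P := fun s x => r s x ∈ Icc δ R) hmem'] with s k1 k2 k3 k4
    rw [Real.norm_eq_abs, ← integral_sub k1 k2]
    have : ∀ x, G' (r s x) * q s x * p x - P.derivative.eval (r s x) * q s x * p x =
        (q s x * p x) * (G' (r s x) - P.derivative.eval (r s x)) := fun x => by ring
    simp_rw [this]
    exact abs_integral_mul_le k3 (k4.mono fun x hx => by rw [abs_sub_comm]; exact (hP _ hx).2)
  have hsum : ε' * K ≤ ε := by
    rw [hε', div_mul_eq_mul_div, div_le_iff₀ (by positivity)]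
    nlinarith
  have b0 := abs_le.1 (b1 h0T)
  have bt := abs_le.1 (b1 ht)
  have b3 := abs_le.1 b3
  rw [zero_add]
  refine le_trans ?_ hsum
  rw [abs_le, hK]
  constructor <;> nlinarith [b0.1, b0.2, bt.1, bt.2, b3.1, b3.2, e]

end

section

/-! ### Weak continuity in time -/

lemma ContinuousInL1.continuousOn_integral {T : ℝ} {f : ℝ → Torus d → ℝ}
    (h : ContinuousInL1 T f) {p : Torus d → ℝ} (hp : Continuous p) :
    ContinuousOn (fun t => ∫ x, f t x * p x) (Icc 0 T) := by
  intro t ht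
  obtain ⟨M, hM0, hM⟩ := exists_bound_of_continuous hp
  change Tendsto _ _ _
  rw [tendsto_iff_norm_sub_tendsto_zero]
  have h1 := (h.2 t ht).const_mul M
  rw [mul_zero] at h1
  refine squeeze_zero' (Eventually.of_forall fun _ => norm_nonneg _) ?_ h1
  filter_upwards [self_mem_nhdsWithin] with s hs
  have e1 := (h.1 s hs).mul_continuous hp
  have e2 := (h.1 t ht).mul_continuous hp
  rw [← integral_sub e1 e2]
  simp_rw [← sub_mul]
  exact abs_integral_mul_le ((h.1 s hs).sub (h.1 t ht)) (Eventually.of_forall hM)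

lemma ContinuousInL1.continuousOn_norm {E : Type*} [NormedAddCommGroup E] {T : ℝ}
    {f : ℝ → Torus d → E} (h : ContinuousInL1 T f) :
    ContinuousOn (fun t => ∫ x, ‖f t x‖) (Icc 0 T) := by
  intro t ht
  change Tendsto _ _ _
  rw [tendsto_iff_norm_sub_tendsto_zero]
  refine squeeze_zero' (Eventually.of_forall fun _ => norm_nonneg _) ?_ (h.2 t ht)
  filter_upwards [self_mem_nhdsWithin] with s hs
  rw [← integral_sub (h.1 s hs).norm (h.1 t ht).norm]
  exact (norm_integral_le_integral_norm _).trans (integral_mono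
    ((h.1 s hs).norm.sub (h.1 t ht).norm).norm ((h.1 s hs).sub (h.1 t ht)).norm
    fun x => abs_norm_sub_norm_le _ _)

lemma ContinuousInL1.integrable_slab {E : Type*} [NormedAddCommGroup E] {T : ℝ}
    {f : ℝ → Torus d → E} (h : ContinuousInL1 T f)
    (hm : AEStronglyMeasurable (Function.uncurry f) (slab d T)) :
    Integrable (Function.uncurry f) (slab d T) := by
  refine (integrable_prod_iff hm).2 ⟨?_, ?_⟩
  · filter_upwards [ae_restrict_mem measurableSet_Ioo] with t ht
    exact h.1 t (Ioo_subset_Icc_self ht)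
  · exact (h.continuousOn_norm.integrableOn_Icc).mono_set Ioo_subset_Icc_self

lemma ContinuousInL1.apply {T : ℝ} {f : ℝ → Torus d → Vec d} (h : ContinuousInL1 T f)
    (i : Fin d) : ContinuousInL1 T (fun t x => f t x i) := by
  have hi : ∀ {t}, t ∈ Icc 0 T → Integrable fun x => f t x i := fun ht =>
    (EuclideanSpace.proj (𝕜 := ℝ) i).integrable_comp (h.1 _ ht)
  refine ⟨fun t ht => hi ht, fun t ht => ?_⟩
  refine squeeze_zero' (Eventually.of_forall fun _ => integral_nonneg fun _ => norm_nonneg _) ?_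
    (h.2 t ht)
  filter_upwards [self_mem_nhdsWithin] with s hs
  refine integral_mono ((hi hs).sub (hi ht)).norm ((h.1 s hs).sub (h.1 t ht)).norm fun x => ?_
  exact PiLp.norm_apply_le (f s x - f t x) i

/-- `max φ M` is continuous and equals `M` almost everywhere, hence everywhere on `[0,T]`, endpoints
included. -/
lemma forall_le_of_ae_le {T : ℝ} (hT : 0 < T) {φ : ℝ → ℝ} {M : ℝ}
    (hφ : ContinuousOn φ (Icc 0 T)) (h : ∀ᵐ t ∂(volume.restrict (Ioo 0 T)), φ t ≤ M) :
    ∀ t ∈ Icc 0 T, φ t ≤ M := by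
  have h1 : (fun t => max (φ t) M) =ᵐ[volume.restrict (Icc 0 T)] fun _ => M := by
    rw [← restrict_Ioo_eq_restrict_Icc]
    filter_upwards [h] with t ht using max_eq_right ht
  have := Measure.eqOn_Icc_of_ae_eq volume hT.ne h1
    (hφ.sup continuousOn_const) continuousOn_const
  exact fun t ht => max_eq_right_iff.1 (this ht)

/-- The excess of `|f|` over `M` is bounded pointwise by `|mollify n f - f|`, whose integral tends
to zero. -/
lemma ae_abs_le_of_forall_mollify {f : Torus d → ℝ} {M : ℝ} (hf : Integrable f)
    (h : ∀ n x, |mollify n f x| ≤ M) : ∀ᵐ x, |f x| ≤ M := by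
  have hi : Integrable fun x => max (|f x| - M) 0 := (hf.abs.sub (integrable_const M)).pos_part
  have h1 : ∀ n, ∫ x, max (|f x| - M) 0 ≤ ∫ x, |mollify n f x - f x| := fun n => by
    refine integral_mono hi ((integrable_mollify hf n).sub hf).abs fun x => ?_
    refine max_le ?_ (abs_nonneg _)
    have h2 := h n x
    have h3 := abs_sub_abs_le_abs_sub (f x) (mollify n f x)
    rw [abs_sub_comm] at h3
    linarith
  have h2 : ∫ x, max (|f x| - M) 0 ≤ 0 :=
    ge_of_tendsto' (tendsto_integral_abs_mollify_sub hf) h1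
  have h3 := (integral_eq_zero_iff_of_nonneg (fun x => le_max_right _ _) hi).1
    (le_antisymm h2 (integral_nonneg fun x => le_max_right _ _))
  filter_upwards [h3] with x hx
  have := le_max_left (|f x| - M) 0
  have hx' : max (|f x| - M) 0 = 0 := hx
  linarith

/-- A bound at almost every time holds at every time if there is weak continuity. -/
lemma ae_abs_le_of_weakly_continuous {T : ℝ} (hT : 0 < T) {f : ℝ → Torus d → ℝ} {M : ℝ}
    (hi : ∀ t ∈ Icc 0 T, Integrable (f t))
    (hc : ∀ p : Torus d → ℝ, IsC1 p → ContinuousOn (fun t => ∫ x, f t x * p x) (Icc 0 T))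
    (h : ∀ᵐ t ∂(volume.restrict (Ioo 0 T)), ∀ᵐ x, |f t x| ≤ M) :
    ∀ t ∈ Icc 0 T, ∀ᵐ x, |f t x| ≤ M := by
  intro t ht
  refine ae_abs_le_of_forall_mollify (hi t ht) fun n x => ?_
  have hc' : ContinuousOn (fun t => |mollify n (f t) x|) (Icc 0 T) := by
    have := hc _ (isC1_eta_sub n x)
    unfold mollify
    simp_rw [mul_comm (eta n _)]
    exact this.abs
  refine forall_le_of_ae_le hT hc' ?_ t ht
  filter_upwards [h, ae_restrict_mem measurableSet_Ioo] with s hs hs'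
  exact abs_mollify_le (hi s (Ioo_subset_Icc_self hs')) hs n x

lemma continuousOn_slice {T : ℝ} {f : ℝ → Torus d → ℝ}
    (h : ContinuousOn (Function.uncurry f) (Icc 0 T ×ˢ univ)) {t : ℝ} (ht : t ∈ Icc 0 T) :
    Continuous (f t) := by
  have h1 : ContinuousOn (fun x : Torus d => (t, x)) univ :=
    (continuous_const.prodMk continuous_id).continuousOn
  have := h.comp h1 (fun x _ => ⟨ht, mem_univ _⟩)
  exact continuousOn_univ.1 this

lemma continuousOn_integral_of_continuousOn {T : ℝ} {f : ℝ → Torus d → ℝ}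
    (h : ContinuousOn (Function.uncurry f) (Icc 0 T ×ˢ univ)) {p : Torus d → ℝ}
    (hp : Continuous p) : ContinuousOn (fun t => ∫ x, f t x * p x) (Icc 0 T) := by
  refine continuousOn_integral_of_compact_support (f := fun t x => f t x * p x) (k := univ)
    isCompact_univ (h.mul (hp.comp continuous_snd).continuousOn) ?_
  intro t x _ hx
  exact absurd (mem_univ x) hx

lemma slab_ae_mem (d : ℕ) (T : ℝ) : ∀ᵐ z ∂(slab d T), z.1 ∈ Ioo 0 T := by
  have : ∀ᵐ z ∂(slab d T), z ∈ Ioo 0 T ×ˢ (univ : Set (Torus d)) := by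
    unfold slab
    rw [← Measure.restrict_univ (μ := (volume : Measure (Torus d))), Measure.prod_restrict]
    exact ae_restrict_mem (measurableSet_Ioo.prod MeasurableSet.univ)
  exact this.mono fun z hz => hz.1

lemma HasWeakPartial.td_of_continuousOn {T : ℝ} (hT : 0 < T) {f g : ℝ → Torus d → ℝ}
    (h : HasWeakPartial T none f g) (hg : SlabBdd T g)
    (hf : ContinuousOn (Function.uncurry f) (Icc 0 T ×ˢ univ)) : TD T f g := by
  obtain ⟨M, hM⟩ := (isCompact_Icc.prod (isCompact_univ (X := Torus d))).exists_bound_of_continuousOn hf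
  have h00 : ((0 : ℝ), (0 : Torus d)) ∈ Icc 0 T ×ˢ (univ : Set (Torus d)) :=
    ⟨⟨le_rfl, hT.le⟩, mem_univ _⟩
  have hM0 : 0 ≤ M := (norm_nonneg _).trans (hM _ h00)
  refine ⟨⟨h.integrable.aestronglyMeasurable, M, hM0, ?_⟩, ⟨M, hM0, fun t ht =>
    ⟨(continuousOn_slice hf ht).aestronglyMeasurable, Eventually.of_forall fun x =>
      hM (t, x) ⟨ht, mem_univ _⟩⟩⟩, hg, fun p hp t ht => h.eq_primitive hT
      (fun p hp => continuousOn_integral_of_continuousOn hf hp.continuous) hp ht⟩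
  filter_upwards [slab_ae_mem d T] with z hz
  exact hM z ⟨Ioo_subset_Icc_self hz, mem_univ _⟩

end

section

/-! ### The derivatives of a strong solution -/

/-- The fields of a strong solution `(r, u)`: `q = ∇r`, `Q = ∇q`, `P = ∇Q`, `U = ∇u`, `V = ∇U`, and
the time derivatives `rt`, `qt`, `ut`. -/
structure StrongFields (T δ R L : ℝ) (r : ℝ → Torus d → ℝ) (q u : Fin d → ℝ → Torus d → ℝ)
    (rt : ℝ → Torus d → ℝ) (qt ut : Fin d → ℝ → Torus d → ℝ)
    (Q U : Fin d → Fin d → ℝ → Torus d → ℝ) (P V : Fin d → Fin d → Fin d → ℝ → Torus d → ℝ) :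
    Prop where
  mem : ∀ t ∈ Icc 0 T, ∀ x, r t x ∈ Icc δ R
  r_t : TD T r rt
  q_t : ∀ i, TD T (q i) (qt i)
  u_t : ∀ i, TD T (u i) (ut i)
  r_x : ∀ i, XD T i r (q i)
  q_x : ∀ i j, XD T j (q i) (Q i j)
  Q_x : ∀ i j k, XD T k (Q i j) (P i j k)
  u_x : ∀ i j, XD T j (u i) (U i j)
  U_x : ∀ i j k, XD T k (U i j) (V i j k)
  grad : ∀ t ∈ Icc 0 T, ∀ i, WkD i (r t) (q i t)
  q_le : ∀ t ∈ Icc 0 T, ∀ i, ∀ᵐ x, |q i t x| ≤ L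
  U_le : ∀ i j, ∀ᵐ z ∂(slab d T), |U i j z.1 z.2| ≤ L
  V_le : ∀ i j k, ∀ᵐ z ∂(slab d T), |V i j k z.1 z.2| ≤ L

lemma IsWeakGrad.wkD {f : Torus d → ℝ} {g : Torus d → Vec d} (h : IsWeakGrad f g) (i : Fin d) :
    WkD i f (fun x => g x i) :=
  ⟨h.integrable, (EuclideanSpace.proj (𝕜 := ℝ) i).integrable_comp h.integrable_grad,
    fun φ hφ => h.parts φ hφ i⟩

lemma slabBdd_of_le {T L : ℝ} {f : ℝ → Torus d → ℝ}
    (hm : AEStronglyMeasurable (Function.uncurry f) (slab d T))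
    (h : ∀ᵐ z ∂(slab d T), |f z.1 z.2| ≤ L) : SlabBdd T f :=
  ⟨hm, |L|, abs_nonneg _, h.mono fun _ hz => hz.trans (le_abs_self L)⟩

lemma aestronglyMeasurable_apply {T : ℝ} {f : ℝ → Torus d → Vec d}
    (hm : AEStronglyMeasurable (Function.uncurry f) (slab d T)) (i : Fin d) :
    AEStronglyMeasurable (Function.uncurry fun t x => f t x i) (slab d T) :=
  (EuclideanSpace.proj (𝕜 := ℝ) i).continuous.comp_aestronglyMeasurable hm

lemma ae_eq_of_wkD {T : ℝ} {i : Fin d} {f f' g g' : ℝ → Torus d → ℝ}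
    (h : ∀ᵐ t ∂(volume.restrict (Ioo 0 T)), WkD i (f t) (g t))
    (h' : ∀ᵐ t ∂(volume.restrict (Ioo 0 T)), WkD i (f' t) (g' t))
    (hff' : Function.uncurry f =ᵐ[slab d T] Function.uncurry f')
    (hg : AEStronglyMeasurable (Function.uncurry g) (slab d T))
    (hg' : AEStronglyMeasurable (Function.uncurry g') (slab d T)) :
    Function.uncurry g =ᵐ[slab d T] Function.uncurry g' := by
  refine slab_ae_eq hg hg' ?_
  filter_upwards [h, h', slab_ae (P := fun t x => f t x = f' t x) hff'] with t h1 h2 h3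
  exact h1.unique (h2.congr (h3.mono fun x hx => hx.symm) (ae_eq_refl _))

/-- The regularity assumptions provide a separate chain of weak derivatives for each list of
directions. Uniqueness of weak derivatives identifies the intermediate ones, so that a single
coherent family of derivatives can be chosen. -/
theorem IsStrongSolution.exists_fields {h κ : ℝ → ℝ} {T δ R L : ℝ} (hT : 0 < T)
    {ρ : ℝ → Torus d → ℝ} {q : ℝ → Torus d → Vec d} {D : ℝ → Torus d → ℝ}
    {u : ℝ → Torus d → Vec d} (hs : IsStrongSolution h κ T ρ q D u)
    (hmem : ∀ t ∈ Icc 0 T, ∀ x, ρ t x ∈ Icc δ R)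
    (hq : ∀ᵐ z ∂(slab d T), ‖q z.1 z.2‖ ≤ L)
    (hU : ∀ i j, WeakDerivBound T L [some j] (fun t x => u t x i))
    (hV : ∀ i j k, WeakDerivBound T L [some j, some k] (fun t x => u t x i)) :
    ∃ rt qt ut Q U P V, StrongFields T δ R L ρ (fun i t x => q t x i) (fun i t x => u t x i)
      rt qt ut Q U P V := by
  have hw := hs.conservative.weak
  have hgrad : ∀ t ∈ Icc 0 T, ∀ i, WkD i (ρ t) (fun x => q t x i) := fun t ht i =>
    (hw.grad t ht).wkD i
  have hgrad_ae : ∀ i, ∀ᵐ t ∂(volume.restrict (Ioo 0 T)), WkD i (ρ t) (fun x => q t x i) :=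
    fun i => (ae_restrict_mem measurableSet_Ioo).mono fun t ht =>
      hgrad t (Ioo_subset_Icc_self ht) i
  have hqm := fun i => aestronglyMeasurable_apply hw.measurable_q i
  have hqi_le : ∀ i, ∀ᵐ z ∂(slab d T), |q z.1 z.2 i| ≤ L := fun i =>
    hq.mono fun z hz => (PiLp.norm_apply_le (q z.1 z.2) i).trans hz
  have bq : ∀ i, SlabBdd T (fun t x => q t x i) := fun i => slabBdd_of_le (hqm i) (hqi_le i)
  -- time derivatives
  obtain ⟨_, rt, hrt, hrtm, hrtb⟩ := hs.ρ_t
  have tdr : TD T ρ rt := hrt.td_of_continuousOn hT (slabBdd_of_le hrtm hrtb) hs.continuousOn_ρ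
  have hutex : ∀ i, ∃ g, TD T (fun t x => u t x i) g := fun i => by
    obtain ⟨_, g, hg, hgm, hgb⟩ := hs.u_t i
    exact ⟨g, hg.td_of_continuousOn hT (slabBdd_of_le hgm hgb)
      ((EuclideanSpace.proj (𝕜 := ℝ) i).continuous.comp_continuousOn hs.continuousOn_u)⟩
  choose ut hut using hutex
  -- The gradient inherits weak continuity in time from the continuous density by moving the
  -- derivative to the test function. This gives its bound at every time, and its time derivative in
  -- integrated form.
  have hqc : ∀ i, ∀ p : Torus d → ℝ, IsC1 p →
      ContinuousOn (fun t => ∫ x, q t x i * p x) (Icc 0 T) := fun i p hp => by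
    refine (continuousOn_integral_of_continuousOn hs.continuousOn_ρ
      (hp.continuous_spaceDeriv i)).neg.congr fun t ht => ?_
    have := (hgrad t ht i).parts p hp
    simp only [Pi.neg_apply]
    linarith
  have hq_le : ∀ t ∈ Icc 0 T, ∀ i, ∀ᵐ x, |q t x i| ≤ L := fun t ht i =>
    ae_abs_le_of_weakly_continuous hT (f := fun t x => q t x i)
      (fun t ht => (hgrad t ht i).int_g) (hqc i)
      (slab_ae (P := fun t x => |q t x i| ≤ L) (hqi_le i)) t ht
  have eq1 : ∀ {i g}, HasWeakPartial T (some i) ρ g →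
      Function.uncurry g =ᵐ[slab d T] Function.uncurry fun t x => q t x i := fun {i g} hg =>
    ae_eq_of_wkD (hg.ae_wkD hT) (hgrad_ae i) (ae_eq_refl _)
      hg.integrable_deriv.aestronglyMeasurable (hqm i)
  have hqtex : ∀ i, ∃ g, TD T (fun t x => q t x i) g := fun i => by
    obtain ⟨_, g, hg, g2, hg2, hgm, hgb⟩ := hs.ρ_xt i
    have hg3 := hg2.congr_left (eq1 hg)
    refine ⟨g2, bq i, ⟨|L|, abs_nonneg _, fun t ht => ⟨(hgrad t ht i).int_g.aestronglyMeasurable,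
      (hq_le t ht i).mono fun x hx => hx.trans (le_abs_self L)⟩⟩, slabBdd_of_le hgm hgb,
      fun p hp t ht => hg3.eq_primitive hT (hqc i) hp ht⟩
  choose qt hqt using hqtex
  -- space derivatives of the density
  have xdr : ∀ i, XD T i ρ (fun t x => q t x i) := fun i => ⟨tdr.bdd_f, bq i, hgrad_ae i⟩
  have hQex : ∀ i j, ∃ g, XD T j (fun t x => q t x i) g := fun i j => by
    obtain ⟨_, g, hg, g2, hg2, hgm, hgb⟩ := hs.ρ_xx i j
    exact ⟨g2, bq i, slabBdd_of_le hgm hgb, (hg2.congr_left (eq1 hg)).ae_wkD hT⟩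
  choose Q hQ using hQex
  have hPex : ∀ i j k, ∃ g, XD T k (Q i j) g := fun i j k => by
    obtain ⟨_, g, hg, g2, hg2, g3, hg3, hgm, hgb⟩ := hs.ρ_xxx i j k
    have e := ae_eq_of_wkD ((hg2.congr_left (eq1 hg)).ae_wkD hT) (hQ i j).wkD (ae_eq_refl _)
      hg2.integrable_deriv.aestronglyMeasurable (hQ i j).bdd_g.1
    exact ⟨g3, (hQ i j).bdd_g, slabBdd_of_le hgm hgb, (hg3.congr_left e).ae_wkD hT⟩
  choose P hP using hPex
  -- space derivatives of the velocity
  have hUex : ∀ i j, ∃ g, XD T j (fun t x => u t x i) g ∧ ∀ᵐ z ∂(slab d T), |g z.1 z.2| ≤ L :=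
    fun i j => by
      obtain ⟨g, hg, hgm, hgb⟩ := hU i j
      exact ⟨g, ⟨(hut i).bdd_f, slabBdd_of_le hgm hgb, hg.ae_wkD hT⟩, hgb⟩
  choose U hUx hUb using hUex
  have hVex : ∀ i j k, ∃ g, XD T k (U i j) g ∧ ∀ᵐ z ∂(slab d T), |g z.1 z.2| ≤ L :=
    fun i j k => by
      obtain ⟨g, hg, g2, hg2, hgm, hgb⟩ := hV i j k
      have e := ae_eq_of_wkD (hg.ae_wkD hT) (hUx i j).wkD (ae_eq_refl _)
        hg.integrable_deriv.aestronglyMeasurable (hUx i j).bdd_g.1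
      exact ⟨g2, ⟨(hUx i j).bdd_g, slabBdd_of_le hgm hgb, (hg2.congr_left e).ae_wkD hT⟩, hgb⟩
  choose V hVx hVb using hVex
  exact ⟨rt, qt, ut, Q, U, P, V, hmem, tdr, hqt, hut, xdr, hQ, hP, hUx, hVx, hgrad, hq_le, hUb, hVb⟩

/-! ### The equations of a weak solution -/

/-- If `∑ ∂_j f_j = g` weakly and the `f_j` are weakly differentiable, then this holds almost
everywhere. -/
lemma ae_eq_sum_of_flux {T : ℝ} (hT : 0 < T) {ι : Type*} [Fintype ι] {dir : ι → Fin d}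
    {f f' : ι → ℝ → Torus d → ℝ} {g : ℝ → Torus d → ℝ} (hf : ∀ j, XD T (dir j) (f j) (f' j))
    (hg : Integrable (Function.uncurry g) (slab d T))
    (h : ∀ p : Torus d → ℝ, IsSmooth p → ∀ t ∈ Icc 0 T,
      ∫ s in (0 : ℝ)..t, ∫ x, fluxIntegrand dir f g p s x = 0) :
    ∀ᵐ z ∂(slab d T), g z.1 z.2 = ∑ j, f' j z.1 z.2 := by
  have hs := SlabBdd.sum Finset.univ fun j => (hf j).bdd_g
  refine slab_ae_eq (f := g) (g := fun t x => ∑ j, f' j t x) hg.aestronglyMeasurable hs.1 ?_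
  filter_upwards [ae_flux_eq_zero hT (fun j => (hf j).bdd_f.integrable) hg h, slab_integrable hg,
    hs.ae_essBdd, ae_all_iff.2 fun j => (hf j).wkD] with t h1 h2 h3 h4
  refine ae_eq_of_forall_kerR h2 h3.integrable fun n a => ?_
  have hk := (isSmooth_kerR (d := d) n a).isC1
  have e := h1 hk.continuous.essBdd (fun j => (hk.continuous_spaceDeriv (dir j)).essBdd)
    (fun j => hk.wkD (dir j))
  have i1 : ∀ j, Integrable fun x => f j t x * spaceDeriv (dir j) (kerR n a) x := fun j =>
    (h4 j).int_f.mul_continuous (hk.continuous_spaceDeriv _)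
  rw [integral_add (integrable_finsetSum _ fun j _ => i1 j) (h2.mul_continuous hk.continuous),
    integral_finsetSum _ fun j _ => i1 j] at e
  simp_rw [fun j => (h4 j).parts _ hk] at e
  simp_rw [Finset.mul_sum, mul_comm (kerR n a _)]
  rw [integral_finsetSum _ fun j _ => (h4 j).int_g.mul_continuous hk.continuous]
  rw [Finset.sum_neg_distrib] at e
  linarith

variable {h κ : ℝ → ℝ} {T : ℝ} {ρ : ℝ → Torus d → ℝ} {q m : ℝ → Torus d → Vec d}
  {D : ℝ → Torus d → ℝ}

/-- The conservation of mass. -/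
lemma IsWeakSolution.flux_mass (hT : 0 < T) (hw : IsWeakSolution h κ T ρ q D m) :
    FluxEq T id ρ (fun j t x => m t x j) (fun _ _ => 0) := by
  have im : ∀ j, Integrable (Function.uncurry fun t x => m t x j) (slab d T) := fun j =>
    (hw.continuous_m.apply j).integrable_slab (aestronglyMeasurable_apply hw.measurable_m j)
  have iρ := hw.continuous_ρ.integrable_slab hw.measurable_ρ
  have i0 : Integrable (Function.uncurry fun (_ : ℝ) (_ : Torus d) => (0 : ℝ)) (slab d T) :=
    integrable_zero _ _ _
  refine ⟨hw.continuous_ρ.1, iρ, im, i0, fun p hp => ?_⟩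
  have iF := slab_integrableOn (slab_fluxIntegrand (dir := id) im i0 hp)
  refine sub_eq_primitive_of_weak hT (hw.continuous_ρ.continuousOn_integral hp.continuous) iF
    fun χ hχ => ?_
  have ht := isInteriorTest_mul hχ hp
  have e := hw.mass _ ht.1
  obtain ⟨a, ha, hχa⟩ := hχ.2.1
  have iρp := slab_mul_continuous iρ hp.continuous
  have e1 : ∀ᵐ t ∂(volume.restrict (Ioo 0 T)), ∫ x, (ρ t x * partialDeriv none
      (fun t x => χ t * p x) t x + ∑ i, m t x i * spaceDeriv i (fun x => χ t * p x) x) =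
      (∫ x, ρ t x * p x) * deriv χ t +
        (∫ x, fluxIntegrand id (fun j t x => m t x j) (fun _ _ => 0) p t x) * χ t := by
    filter_upwards [slab_integrable iρp, slab_integrable (slab_fluxIntegrand (dir := id) im i0 hp)]
      with t h1 h2
    rw [← integral_mul_const, ← integral_mul_const,
      ← integral_add (h1.mul_const _) (h2.mul_const _)]
    congr 1; ext x
    simp only [partialDeriv_none_mul, spaceDeriv_const_mul, fluxIntegrand, id, zero_mul, add_zero,
      Finset.sum_mul]
    congr 1
    · ring
    · exact Finset.sum_congr rfl fun j _ => by ring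
  rw [integral_congr_ae e1, integral_add] at e
  -- The cutoff vanishes at time `0`, so the initial datum drops out of the weak formulation.
  · simp only [hχa 0 ha.le, zero_mul, mul_zero, integral_zero] at e
    linarith
  · have hd : Continuous (deriv χ) := hχ.1.continuous_deriv le_rfl
    obtain ⟨M, hM⟩ := isCompact_Icc.exists_bound_of_continuousOn (hd.continuousOn (s := Icc 0 T))
    exact (slab_integrableOn iρp).mul_bdd (c := M) hd.aestronglyMeasurable
      ((ae_restrict_mem measurableSet_Ioo).mono fun t ht => hM t (Ioo_subset_Icc_self ht))
  · exact hχ.mul_integrableOn iF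

/-- The total momentum flux `m ⊗ m / ρ - S`. -/
def momentumFlux (h κ : ℝ → ℝ) (ρ : ℝ → Torus d → ℝ) (q m : ℝ → Torus d → Vec d)
    (D : ℝ → Torus d → ℝ) (i j : Fin d) (t : ℝ) (x : Torus d) : ℝ :=
  m t x i * m t x j / ρ t x - kortewegStress h κ (ρ t x) (q t x) (D t x) i j

lemma IsWeakSolution.integrable_momentumFlux (hw : IsWeakSolution h κ T ρ q D m) (i j : Fin d) :
    Integrable (Function.uncurry (momentumFlux h κ ρ q m D i j)) (slab d T) := by
  refine (hw.integrable_convection i j).sub (Integrable.sub ?_ (hw.integrable_tensor i j))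
  by_cases hij : i = j
  · simp only [hij, if_true]
    exact hw.integrable_scalar.neg.add hw.integrable_div
  · simp only [hij, if_false]
    exact integrable_zero _ _ _

/-- The conservation of momentum. -/
lemma IsWeakSolution.flux_momentum (hT : 0 < T) (hw : IsWeakSolution h κ T ρ q D m) (i : Fin d) :
    FluxEq T id (fun t x => m t x i) (momentumFlux h κ ρ q m D i) (fun _ _ => 0) := by
  have im : Integrable (Function.uncurry fun t x => m t x i) (slab d T) :=
    (hw.continuous_m.apply i).integrable_slab (aestronglyMeasurable_apply hw.measurable_m i)
  have i0 : Integrable (Function.uncurry fun (_ : ℝ) (_ : Torus d) => (0 : ℝ)) (slab d T) :=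
    integrable_zero _ _ _
  have iS := hw.integrable_momentumFlux i
  refine ⟨(hw.continuous_m.apply i).1, im, iS, i0, fun p hp => ?_⟩
  have iF := slab_integrableOn (slab_fluxIntegrand (dir := id) iS i0 hp)
  refine sub_eq_primitive_of_weak hT ((hw.continuous_m.apply i).continuousOn_integral hp.continuous)
    iF fun χ hχ => ?_
  have ht := (isInteriorTest_mul hχ hp).1
  have e := hw.momentum (fun k t x => if k = i then χ t * p x else 0) fun k => by
    by_cases hk : k = i
    · simpa [hk] using ht
    · simpa [hk] using isTest_zero hT
  obtain ⟨a, ha, hχa⟩ := hχ.2.1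
  have imp := slab_mul_continuous im hp.continuous
  have e1 : ∀ᵐ t ∂(volume.restrict (Ioo 0 T)), ∫ x, ((∑ k, m t x k * partialDeriv none
      (fun t x => if k = i then χ t * p x else 0) t x) +
      (∑ k, ∑ j, m t x k * m t x j / ρ t x *
        spaceDeriv j (fun x => if k = i then χ t * p x else 0) x) -
      ∑ k, ∑ j, kortewegStress h κ (ρ t x) (q t x) (D t x) k j *
        spaceDeriv j (fun x => if k = i then χ t * p x else 0) x) =
      (∫ x, m t x i * p x) * deriv χ t +
        (∫ x, fluxIntegrand id (momentumFlux h κ ρ q m D i) (fun _ _ => 0) p t x) * χ t := by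
    filter_upwards [slab_integrable imp, slab_integrable (slab_fluxIntegrand (dir := id) iS i0 hp)]
      with t h1 h2
    rw [← integral_mul_const, ← integral_mul_const,
      ← integral_add (h1.mul_const _) (h2.mul_const _)]
    congr 1; ext x
    have s1 : ∀ k, partialDeriv none (fun t x => if k = i then χ t * p x else 0) t x =
        if k = i then deriv χ t * p x else 0 := fun k => by
      by_cases hk : k = i
      · simp only [hk, if_true, partialDeriv_none_mul]
      · simp [hk, partialDeriv]
    have s2 : ∀ k j, spaceDeriv j (fun x => if k = i then χ t * p x else 0) x =
        if k = i then χ t * spaceDeriv j p x else 0 := fun k j => by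
      by_cases hk : k = i
      · simp only [hk, if_true, spaceDeriv_const_mul]
      · simp [hk, spaceDeriv]
    simp only [s1, s2, mul_ite, mul_zero, Finset.sum_ite_irrel, Finset.sum_const_zero,
      Finset.sum_ite_eq', Finset.mem_univ, if_true, fluxIntegrand, momentumFlux, id, zero_mul,
      add_zero, Finset.sum_mul]
    rw [add_sub_assoc, ← Finset.sum_sub_distrib]
    congr 1
    · ring
    · exact Finset.sum_congr rfl fun j _ => by ring
  rw [integral_congr_ae e1, integral_add] at e
  · have e0 : ∫ x, ∑ k, m 0 x k * (if k = i then χ 0 * p x else 0) = 0 := by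
      simp [hχa 0 ha.le]
    rw [e0] at e
    linarith
  · have hd : Continuous (deriv χ) := hχ.1.continuous_deriv le_rfl
    obtain ⟨M, hM⟩ := isCompact_Icc.exists_bound_of_continuousOn (hd.continuousOn (s := Icc 0 T))
    exact (slab_integrableOn imp).mul_bdd (c := M) hd.aestronglyMeasurable
      ((ae_restrict_mem measurableSet_Ioo).mono fun t ht => hM t (Ioo_subset_Icc_self ht))
  · exact hχ.mul_integrableOn iF

lemma IsWeakSolution.integrable_vector_apply (hw : IsWeakSolution h κ T ρ q D m) (j : Fin d) :
    Integrable (Function.uncurry fun t x => stressVector κ (ρ t x) (q t x) j) (slab d T) :=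
  (EuclideanSpace.proj (𝕜 := ℝ) j).integrable_comp hw.integrable_vector

/-- The definition of the weak divergence `D`, integrated in time. -/
lemma IsWeakSolution.primitive_div (hT : 0 < T) (hw : IsWeakSolution h κ T ρ q D m)
    {p : Torus d → ℝ} (hp : IsSmooth p) : ∀ t ∈ Icc 0 T, ∫ s in (0 : ℝ)..t,
      ∫ x, fluxIntegrand id (fun j t x => stressVector κ (ρ t x) (q t x) j) D p s x = 0 := by
  have iV := hw.integrable_vector_apply
  have iF := slab_fluxIntegrand (dir := id) iV hw.integrable_div hp.isC1
  refine primitive_eq_zero_of_weak hT (slab_integrableOn iF) fun χ hχ => ?_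
  have e := hw.div_vector _ (isInteriorTest_mul hχ hp.isC1).1
  have i1 := slab_mul_continuous hw.integrable_div hp.isC1.continuous
  have i2 : Integrable (Function.uncurry fun t x => ∑ j, stressVector κ (ρ t x) (q t x) j *
      spaceDeriv j p x) (slab d T) :=
    integrable_finsetSum _ fun j _ => slab_mul_continuous (iV j) (hp.isC1.continuous_spaceDeriv j)
  simp_rw [spaceDeriv_const_mul, mul_left_comm _ (χ _), ← Finset.mul_sum, integral_const_mul] at e
  have e1 : ∀ᵐ t ∂(volume.restrict (Ioo 0 T)),
      (∫ x, fluxIntegrand id (fun j t x => stressVector κ (ρ t x) (q t x) j) D p t x) * χ t =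
      (∫ x, ∑ j, stressVector κ (ρ t x) (q t x) j * spaceDeriv j p x) * χ t +
        (∫ x, D t x * p x) * χ t := by
    filter_upwards [slab_integrable i1, slab_integrable i2] with t h1 h2
    rw [← add_mul, ← integral_add h2 h1]
    rfl
  rw [integral_congr_ae e1, integral_add (hχ.mul_integrableOn (slab_integrableOn i2))
    (hχ.mul_integrableOn (slab_integrableOn i1))]
  simp_rw [mul_comm (χ _)] at e
  rw [e]
  ring

end

section

/-! ### Chain rules for the coefficient functions -/

lemma hasDerivAt_of_contDiffOn {f : ℝ → ℝ} (hf : ContDiffOn ℝ ∞ f (Ioi 0)) {s : ℝ} (hs : 0 < s) :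
    HasDerivAt f (deriv f s) s :=
  ((hf.contDiffAt (Ioi_mem_nhds hs)).differentiableAt (by simp)).hasDerivAt

lemma contDiffOn_deriv {f : ℝ → ℝ} (hf : ContDiffOn ℝ ∞ f (Ioi 0)) :
    ContDiffOn ℝ ∞ (deriv f) (Ioi 0) :=
  ((contDiffOn_infty_iff_deriv_of_isOpen isOpen_Ioi).1 hf).2

lemma continuousOn_Icc_of_contDiffOn {f : ℝ → ℝ} (hf : ContDiffOn ℝ ∞ f (Ioi 0)) {δ R : ℝ}
    (hδ : 0 < δ) : ContinuousOn f (Icc δ R) :=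
  hf.continuousOn.mono fun _ hs => hδ.trans_le hs.1

lemma XD.of_eq {T : ℝ} {i : Fin d} {f g f' g' : ℝ → Torus d → ℝ} (h : XD T i f g)
    (hf : ∀ t x, f t x = f' t x) (hg : ∀ t x, g t x = g' t x) : XD T i f' g' := by
  have e1 : f = f' := funext fun t => funext fun x => hf t x
  have e2 : g = g' := funext fun t => funext fun x => hg t x
  rwa [← e1, ← e2]

lemma XD.congr_left {T : ℝ} {i : Fin d} {f f' g : ℝ → Torus d → ℝ} (h : XD T i f g)
    (hf : Function.uncurry f =ᵐ[slab d T] Function.uncurry f') : XD T i f' g :=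
  ⟨h.bdd_f.congr hf, h.bdd_g, by
    filter_upwards [h.wkD, slab_ae (P := fun t x => f t x = f' t x) hf] with t h1 h2
      using h1.congr h2 (ae_eq_refl _)⟩

lemma TD.of_eq {T : ℝ} {f g f' g' : ℝ → Torus d → ℝ} (h : TD T f g)
    (hf : ∀ t x, f t x = f' t x) (hg : ∀ t x, g t x = g' t x) : TD T f' g' := by
  have e1 : f = f' := funext fun t => funext fun x => hf t x
  have e2 : g = g' := funext fun t => funext fun x => hg t x
  rwa [← e1, ← e2]

/-- If the evolving quantity also has a genuine time derivative, the equation becomes a stationary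
one, integrated in time. In this form `ae_eq_sum_of_flux` turns it into an equation almost
everywhere. -/
lemma FluxEq.sub_td {T : ℝ} {ι : Type*} [Fintype ι] {dir : ι → Fin d} {a a' : ℝ → Torus d → ℝ}
    {f : ι → ℝ → Torus d → ℝ} {g : ℝ → Torus d → ℝ} (h : FluxEq T dir a f g) (h' : TD T a a')
    {p : Torus d → ℝ} (hp : IsC1 p) {t : ℝ} (ht : t ∈ Icc 0 T) :
    ∫ s in (0 : ℝ)..t, ∫ x, fluxIntegrand dir f (fun t x => g t x - a' t x) p s x = 0 := by
  have i1 := slab_fluxIntegrand (dir := dir) h.int_f h.int_g hp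
  have i2 := slab_mul_continuous h'.bdd_g.integrable hp.continuous
  have e : ∀ᵐ s ∂(volume.restrict (Ioo 0 T)),
      ∫ x, fluxIntegrand dir f (fun t x => g t x - a' t x) p s x =
      (∫ x, fluxIntegrand dir f g p s x) - ∫ x, a' s x * p x := by
    filter_upwards [slab_integrable i1, slab_integrable i2] with s h1 h2
    rw [← integral_sub h1 h2]
    congr 1; ext x
    simp only [fluxIntegrand]
    ring
  rw [intervalIntegral_congr_Ioo e ht, intervalIntegral.integral_sub
    (intervalIntegrable_of_Ioo (slab_integrableOn i1) ht)
    (intervalIntegrable_of_Ioo (slab_integrableOn i2) ht), ← h.eq p hp t ht, ← h'.eq p hp t ht,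
    sub_self]

namespace StrongFields

variable {h κ : ℝ → ℝ} {T δ R L : ℝ} {r : ℝ → Torus d → ℝ} {q u : Fin d → ℝ → Torus d → ℝ}
  {rt : ℝ → Torus d → ℝ} {qt ut : Fin d → ℝ → Torus d → ℝ}
  {Q U : Fin d → Fin d → ℝ → Torus d → ℝ} {P V : Fin d → Fin d → Fin d → ℝ → Torus d → ℝ}

lemma mem_slab (S : StrongFields T δ R L r q u rt qt ut Q U P V) :
    ∀ᵐ z ∂(slab d T), r z.1 z.2 ∈ Icc δ R :=
  (slab_ae_mem d T).mono fun _ hz => S.mem _ (Ioo_subset_Icc_self hz) _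

lemma le (S : StrongFields T δ R L r q u rt qt ut Q U P V) (hT : 0 < T) : δ ≤ R :=
  have := S.mem 0 ⟨le_rfl, hT.le⟩ 0
  this.1.trans this.2

lemma comp_x (S : StrongFields T δ R L r q u rt qt ut Q U P V) (hT : 0 < T) (hδ : 0 < δ)
    {G : ℝ → ℝ} (hG : ContDiffOn ℝ ∞ G (Ioi 0)) (i : Fin d) :
    XD T i (fun t x => G (r t x)) (fun t x => deriv G (r t x) * q i t x) :=
  (S.r_x i).comp S.mem_slab (S.le hT)
    (fun _ hs => hasDerivAt_of_contDiffOn hG (hδ.trans_le hs.1))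
    (continuousOn_Icc_of_contDiffOn (contDiffOn_deriv hG) hδ)

lemma comp_t (S : StrongFields T δ R L r q u rt qt ut Q U P V) (hT : 0 < T) (hδ : 0 < δ)
    {G : ℝ → ℝ} (hG : ContDiffOn ℝ ∞ G (Ioi 0)) :
    TD T (fun t x => G (r t x)) (fun t x => deriv G (r t x) * rt t x) :=
  S.r_t.comp (S.le hT) (fun t ht => Eventually.of_forall fun x => S.mem t ht x) S.mem_slab
    (fun _ hs => hasDerivAt_of_contDiffOn hG (hδ.trans_le hs.1))
    (continuousOn_Icc_of_contDiffOn (contDiffOn_deriv hG) hδ)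

lemma sq_x (S : StrongFields T δ R L r q u rt qt ut Q U P V) (i : Fin d) :
    XD T i (fun t x => ∑ k, q k t x ^ 2) (fun t x => 2 * ∑ k, q k t x * Q k i t x) := by
  refine (XD.sum Finset.univ fun k => (S.q_x k i).mul (S.q_x k i)).of_eq (fun t x => ?_)
    fun t x => ?_
  · exact Finset.sum_congr rfl fun k _ => by ring
  · rw [Finset.mul_sum]; exact Finset.sum_congr rfl fun k _ => by ring

lemma lap_x (S : StrongFields T δ R L r q u rt qt ut Q U P V) (i : Fin d) :
    XD T i (fun t x => ∑ k, Q k k t x) (fun t x => ∑ k, P k k i t x) :=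
  XD.sum Finset.univ fun k => S.Q_x k k i

/-- The divergence of `ρ κ(ρ) ∇ρ`. -/
lemma div_vector_x (S : StrongFields T δ R L r q u rt qt ut Q U P V) (hT : 0 < T) (hδ : 0 < δ)
    (hκ : ContDiffOn ℝ ∞ κ (Ioi 0)) (i : Fin d) :
    XD T i (fun t x => (κ (r t x) + r t x * deriv κ (r t x)) * ∑ k, q k t x ^ 2 +
        r t x * κ (r t x) * ∑ k, Q k k t x)
      (fun t x => (2 * deriv κ (r t x) + r t x * deriv (deriv κ) (r t x)) * q i t x *
          ∑ k, q k t x ^ 2 +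
        2 * (κ (r t x) + r t x * deriv κ (r t x)) * ∑ k, q k t x * Q k i t x +
        (κ (r t x) + r t x * deriv κ (r t x)) * q i t x * ∑ k, Q k k t x +
        r t x * κ (r t x) * ∑ k, P k k i t x) := by
  have x0 := S.comp_x hT hδ hκ i
  have x1 := S.comp_x hT hδ (contDiffOn_deriv hκ) i
  refine (((x0.add ((S.r_x i).mul x1)).mul (S.sq_x i)).add
    (((S.r_x i).mul x0).mul (S.lap_x i))).of_eq (fun t x => rfl) fun t x => ?_
  ring

/-- The scalar part of the stress. -/
lemma scalar_x (S : StrongFields T δ R L r q u rt qt ut Q U P V) (hT : 0 < T) (hδ : 0 < δ)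
    (hh : ContDiffOn ℝ ∞ h (Ioi 0)) (hκ : ContDiffOn ℝ ∞ κ (Ioi 0)) (i : Fin d) :
    XD T i (fun t x => (r t x * deriv h (r t x) - h (r t x)) +
        1 / 2 * (r t x * deriv κ (r t x) + κ (r t x)) * ∑ k, q k t x ^ 2)
      (fun t x => r t x * deriv (deriv h) (r t x) * q i t x +
        1 / 2 * (2 * deriv κ (r t x) + r t x * deriv (deriv κ) (r t x)) * q i t x *
          ∑ k, q k t x ^ 2 +
        (r t x * deriv κ (r t x) + κ (r t x)) * ∑ k, q k t x * Q k i t x) := by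
  have x0 := S.comp_x hT hδ hκ i
  have x1 := S.comp_x hT hδ (contDiffOn_deriv hκ) i
  have y0 := S.comp_x hT hδ hh i
  have y1 := S.comp_x hT hδ (contDiffOn_deriv hh) i
  refine ((((S.r_x i).mul y1).add (y0.const_mul (-1))).add
    (((((S.r_x i).mul x1).add x0).const_mul (1 / 2)).mul (S.sq_x i))).of_eq (fun t x => ?_)
    fun t x => ?_
  · ring
  · ring

/-- The vector `κ(ρ) ∇ρ`. -/
lemma G_x (S : StrongFields T δ R L r q u rt qt ut Q U P V) (hT : 0 < T) (hδ : 0 < δ)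
    (hκ : ContDiffOn ℝ ∞ κ (Ioi 0)) (i j : Fin d) :
    XD T j (fun t x => κ (r t x) * q i t x)
      (fun t x => deriv κ (r t x) * q j t x * q i t x + κ (r t x) * Q i j t x) :=
  (S.comp_x hT hδ hκ j).mul (S.q_x i j)

lemma G_xx (S : StrongFields T δ R L r q u rt qt ut Q U P V) (hT : 0 < T) (hδ : 0 < δ)
    (hκ : ContDiffOn ℝ ∞ κ (Ioi 0)) (i j k : Fin d) :
    XD T k (fun t x => deriv κ (r t x) * q j t x * q i t x + κ (r t x) * Q i j t x)
      (fun t x => deriv (deriv κ) (r t x) * q k t x * q j t x * q i t x +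
        deriv κ (r t x) * (Q j k t x * q i t x + q j t x * Q i k t x + q k t x * Q i j t x) +
        κ (r t x) * P i j k t x) := by
  have x0 := S.comp_x hT hδ hκ k
  have x1 := S.comp_x hT hδ (contDiffOn_deriv hκ) k
  refine (((x1.mul (S.q_x j k)).mul (S.q_x i k)).add (x0.mul (S.Q_x i j k))).of_eq
    (fun t x => rfl) fun t x => ?_
  ring

/-- The multiplier `h'(ρ) + ½ κ'(ρ) |∇ρ|² - ½ |u|²`. -/
lemma beta_x (S : StrongFields T δ R L r q u rt qt ut Q U P V) (hT : 0 < T) (hδ : 0 < δ)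
    (hh : ContDiffOn ℝ ∞ h (Ioi 0)) (hκ : ContDiffOn ℝ ∞ κ (Ioi 0)) (j : Fin d) :
    XD T j (fun t x => deriv h (r t x) + 1 / 2 * deriv κ (r t x) * (∑ k, q k t x ^ 2) -
        1 / 2 * ∑ k, u k t x ^ 2)
      (fun t x => deriv (deriv h) (r t x) * q j t x +
        1 / 2 * deriv (deriv κ) (r t x) * q j t x * (∑ k, q k t x ^ 2) +
        deriv κ (r t x) * (∑ k, q k t x * Q k j t x) - ∑ k, u k t x * U k j t x) := by
  have x1 := S.comp_x hT hδ (contDiffOn_deriv hκ) j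
  have y1 := S.comp_x hT hδ (contDiffOn_deriv hh) j
  have xu : XD T j (fun t x => ∑ k, u k t x ^ 2) (fun t x => 2 * ∑ k, u k t x * U k j t x) := by
    refine (XD.sum Finset.univ fun k => (S.u_x k j).mul (S.u_x k j)).of_eq (fun t x => ?_)
      fun t x => ?_
    · exact Finset.sum_congr rfl fun k _ => by ring
    · rw [Finset.mul_sum]; exact Finset.sum_congr rfl fun k _ => by ring
  refine ((y1.add ((x1.const_mul (1 / 2)).mul (S.sq_x j))).add (xu.const_mul (-(1 / 2)))).of_eq
    (fun t x => ?_) fun t x => ?_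
  · ring
  · ring

lemma beta_t (S : StrongFields T δ R L r q u rt qt ut Q U P V) (hT : 0 < T) (hδ : 0 < δ)
    (hh : ContDiffOn ℝ ∞ h (Ioi 0)) (hκ : ContDiffOn ℝ ∞ κ (Ioi 0)) :
    TD T (fun t x => deriv h (r t x) + 1 / 2 * deriv κ (r t x) * (∑ k, q k t x ^ 2) -
        1 / 2 * ∑ k, u k t x ^ 2)
      (fun t x => deriv (deriv h) (r t x) * rt t x +
        1 / 2 * deriv (deriv κ) (r t x) * rt t x * (∑ k, q k t x ^ 2) +
        deriv κ (r t x) * (∑ k, q k t x * qt k t x) - ∑ k, u k t x * ut k t x) := by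
  have x1 := S.comp_t hT hδ (contDiffOn_deriv hκ)
  have y1 := S.comp_t hT hδ (contDiffOn_deriv hh)
  have sq : ∀ {v vt : Fin d → ℝ → Torus d → ℝ}, (∀ k, TD T (v k) (vt k)) →
      TD T (fun t x => ∑ k, v k t x ^ 2) (fun t x => 2 * ∑ k, v k t x * vt k t x) := by
    intro v vt hv
    refine (TD.sum Finset.univ fun k => (hv k).mul (hv k)).of_eq (fun t x => ?_) fun t x => ?_
    · exact Finset.sum_congr rfl fun k _ => by ring
    · rw [Finset.mul_sum]; exact Finset.sum_congr rfl fun k _ => by ring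
  refine ((y1.add ((x1.const_mul (1 / 2)).mul (sq S.q_t))).add
    ((sq S.u_t).const_mul (-(1 / 2)))).of_eq (fun t x => ?_) fun t x => ?_
  · ring
  · ring

lemma G_t (S : StrongFields T δ R L r q u rt qt ut Q U P V) (hT : 0 < T) (hδ : 0 < δ)
    (hκ : ContDiffOn ℝ ∞ κ (Ioi 0)) (i : Fin d) :
    TD T (fun t x => κ (r t x) * q i t x)
      (fun t x => deriv κ (r t x) * rt t x * q i t x + κ (r t x) * qt i t x) :=
  (S.comp_t hT hδ hκ).mul (S.q_t i)

/-! ### The equations of a strong solution -/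

/-- For the strong solution the flux `ru` has bounded weak derivatives, so the conservation law can
be read pointwise with the product rule. -/
lemma mass_eq (S : StrongFields T δ R L r q u rt qt ut Q U P V) (hT : 0 < T)
    (hm : FluxEq T id r (fun j t x => r t x * u j t x) (fun _ _ => 0)) :
    ∀ᵐ z ∂(slab d T), rt z.1 z.2 =
      -∑ j, (q j z.1 z.2 * u j z.1 z.2 + r z.1 z.2 * U j j z.1 z.2) := by
  have := ae_eq_sum_of_flux hT (dir := id) (f := fun j t x => r t x * u j t x)
    (g := fun t x => 0 - rt t x) (fun j => (S.r_x j).mul (S.u_x j j))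
    ((integrable_zero _ _ _).sub S.r_t.bdd_g.integrable)
    (fun p hp t ht => hm.sub_td S.r_t hp.isC1 ht)
  filter_upwards [this] with z hz
  linarith

/-- `qt` is the spatial gradient of `rt`: comparing the evolutions of `r` and of its gradient shows
it weakly, and the pointwise mass equation shows that `rt` has a bounded gradient, given by the
product rule. -/
lemma grad_mass_eq (S : StrongFields T δ R L r q u rt qt ut Q U P V) (hT : 0 < T)
    (hm : FluxEq T id r (fun j t x => r t x * u j t x) (fun _ _ => 0)) (k : Fin d) :
    ∀ᵐ z ∂(slab d T), qt k z.1 z.2 =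
      -∑ j, (Q j k z.1 z.2 * u j z.1 z.2 + q j z.1 z.2 * U j k z.1 z.2 +
        q k z.1 z.2 * U j j z.1 z.2 + r z.1 z.2 * V j j k z.1 z.2) := by
  have x1 : XD T k (fun t x => -∑ j, (q j t x * u j t x + r t x * U j j t x))
      (fun t x => -∑ j, (Q j k t x * u j t x + q j t x * U j k t x +
        q k t x * U j j t x + r t x * V j j k t x)) := by
    refine ((XD.sum Finset.univ fun j => ((S.q_x j k).mul (S.u_x j k)).add
      ((S.r_x k).mul (S.U_x j j k))).const_mul (-1)).of_eq (fun t x => by ring) fun t x => ?_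
    rw [neg_one_mul]
    congr 1
    exact Finset.sum_congr rfl fun j _ => by ring
  have x2 : XD T k rt (fun t x => -∑ j, (Q j k t x * u j t x + q j t x * U j k t x +
        q k t x * U j j t x + r t x * V j j k t x)) :=
    x1.congr_left ((S.mass_eq hT hm).mono fun z hz => hz.symm)
  have := ae_eq_sum_of_flux hT (ι := Unit) (dir := fun _ => k) (f := fun _ => rt) (g := qt k)
    (fun _ => x2) (S.q_t k).bdd_g.integrable (fun p hp t ht => ?_)
  · simpa using this
  · have e1 := S.r_t.eq _ (hp.spaceDeriv k).isC1 t ht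
    have e2 := (S.q_t k).eq _ hp.isC1 t ht
    have h0T : (0 : ℝ) ∈ Icc 0 T := ⟨le_rfl, hT.le⟩
    rw [(S.grad t ht k).parts _ hp.isC1, (S.grad 0 h0T k).parts _ hp.isC1] at e1
    have i1 := slab_mul_continuous S.r_t.bdd_g.integrable (hp.spaceDeriv k).isC1.continuous
    have i2 := slab_mul_continuous (S.q_t k).bdd_g.integrable hp.isC1.continuous
    have e : ∀ᵐ s ∂(volume.restrict (Ioo 0 T)),
        ∫ x, fluxIntegrand (fun _ : Unit => k) (fun _ => rt) (qt k) p s x =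
        (∫ x, rt s x * spaceDeriv k p x) + ∫ x, qt k s x * p x := by
      filter_upwards [slab_integrable i1, slab_integrable i2] with s h1 h2
      rw [← integral_add h1 h2]
      simp [fluxIntegrand]
    rw [intervalIntegral_congr_Ioo e ht, intervalIntegral.integral_add
      (intervalIntegrable_of_Ioo (slab_integrableOn i1) ht)
      (intervalIntegrable_of_Ioo (slab_integrableOn i2) ht), ← e1, ← e2]
    ring

lemma hessian_symm (S : StrongFields T δ R L r q u rt qt ut Q U P V) (i j : Fin d) :
    ∀ᵐ z ∂(slab d T), Q i j z.1 z.2 = Q j i z.1 z.2 := by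
  refine slab_ae_eq (f := Q i j) (g := Q j i) (S.q_x i j).bdd_g.1 (S.q_x j i).bdd_g.1 ?_
  filter_upwards [(S.r_x i).wkD, (S.q_x i j).wkD, (S.r_x j).wkD, (S.q_x j i).wkD]
    with t h1 h2 h3 h4 using h1.comm h2 h3 h4

end StrongFields

/-- The algebra behind the velocity form of the momentum equation. -/
lemma velocity_algebra {r rt h2 k0 k1 k2 uti : ℝ} {q u Pi : Fin d → ℝ} {Q U : Fin d → Fin d → ℝ}
    {i : Fin d} (hr : 0 < r) (hQ : ∀ j, Q i j = Q j i)
    (hrt : rt = -∑ j, (q j * u j + r * U j j))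
    (hm : 0 - (rt * u i + r * uti) = ∑ j, ((q j * (u i * u j) + r * (U i j * u j + u i * U j j)) -
      ((if i = j then -(r * h2 * q j + 1 / 2 * (2 * k1 + r * k2) * q j * ∑ k, q k ^ 2 +
          (r * k1 + k0) * ∑ k, q k * Q k j) + ((2 * k1 + r * k2) * q j * ∑ k, q k ^ 2 +
          2 * (k0 + r * k1) * ∑ k, q k * Q k j + (k0 + r * k1) * q j * ∑ k, Q k k +
          r * k0 * Pi j) else 0) -
        ((k1 * q j * q i + k0 * Q i j) * q j + k0 * q i * Q j j)))) :
    uti = -(∑ j, u j * U i j) - (h2 * q i + 1 / 2 * k2 * q i * (∑ k, q k ^ 2) +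
      k1 * ∑ k, q k * Q k i) + (k2 * q i * (∑ k, q k ^ 2) + 2 * k1 * (∑ k, q k * Q k i) +
      k1 * q i * (∑ k, Q k k) + k0 * Pi i) := by
  have e1 : ∑ j, q j * (u i * u j) = u i * ∑ j, q j * u j := by
    rw [Finset.mul_sum]; exact Finset.sum_congr rfl fun j _ => by ring
  have e2 : ∑ j, r * (U i j * u j + u i * U j j) =
      r * (∑ j, u j * U i j) + r * u i * ∑ j, U j j := by
    rw [Finset.mul_sum, Finset.mul_sum, ← Finset.sum_add_distrib]
    exact Finset.sum_congr rfl fun j _ => by ring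
  have e3 : ∑ j, ((k1 * q j * q i + k0 * Q i j) * q j + k0 * q i * Q j j) =
      k1 * q i * (∑ k, q k ^ 2) + k0 * (∑ k, q k * Q k i) + k0 * q i * ∑ k, Q k k := by
    rw [Finset.mul_sum, Finset.mul_sum, Finset.mul_sum, ← Finset.sum_add_distrib,
      ← Finset.sum_add_distrib]
    exact Finset.sum_congr rfl fun j _ => by rw [hQ j]; ring
  have e4 : ∑ j, (q j * u j + r * U j j) = (∑ j, q j * u j) + r * ∑ j, U j j := by
    rw [Finset.sum_add_distrib, Finset.mul_sum]
  rw [Finset.sum_sub_distrib, Finset.sum_sub_distrib, Finset.sum_add_distrib, e1, e2, e3,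
    Finset.sum_ite_eq, if_pos (Finset.mem_univ i)] at hm
  rw [e4] at hrt
  rw [hrt] at hm
  -- Once the mass equation has removed `rt`, the terms containing `u i` and the divergence of `ru`
  -- cancel, and every remaining term carries a factor `r`.
  refine mul_left_cancel₀ hr.ne' ?_
  linarith

end

/-! ### The equations of the strong solution for the divergence and the velocity -/

section

lemma sum_sq (v : Vec d) : ‖v‖ ^ 2 = ∑ k, v k ^ 2 := by
  rw [EuclideanSpace.norm_sq_eq]
  simp

namespace StrongFields

variable {h κ : ℝ → ℝ} {T δ R L : ℝ} {r : ℝ → Torus d → ℝ} {q u : ℝ → Torus d → Vec d}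
  {D : ℝ → Torus d → ℝ}
  {rt : ℝ → Torus d → ℝ} {qt ut : Fin d → ℝ → Torus d → ℝ}
  {Q U : Fin d → Fin d → ℝ → Torus d → ℝ} {P V : Fin d → Fin d → Fin d → ℝ → Torus d → ℝ}

lemma div_eq (S : StrongFields T δ R L r (fun i t x => q t x i) (fun i t x => u t x i)
    rt qt ut Q U P V) (hT : 0 < T) (hδ : 0 < δ) (hκ : ContDiffOn ℝ ∞ κ (Ioi 0))
    {m : ℝ → Torus d → Vec d} (hw : IsWeakSolution h κ T r q D m) :
    ∀ᵐ z ∂(slab d T), D z.1 z.2 =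
      (κ (r z.1 z.2) + r z.1 z.2 * deriv κ (r z.1 z.2)) * ∑ k, q z.1 z.2 k ^ 2 +
        r z.1 z.2 * κ (r z.1 z.2) * ∑ k, Q k k z.1 z.2 := by
  have x0 := fun j => S.comp_x hT hδ hκ j
  have := ae_eq_sum_of_flux hT (dir := id)
    (f := fun j t x => stressVector κ (r t x) (q t x) j) (g := D)
    (fun j => (((S.r_x j).mul (x0 j)).mul (S.q_x j j)).of_eq
      (fun t x => by simp [stressVector]) (fun t x => rfl))
    hw.integrable_div (fun p hp t ht => hw.primitive_div hT hp t ht)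
  filter_upwards [this] with z hz
  rw [hz, Finset.mul_sum, Finset.mul_sum, ← Finset.sum_add_distrib]
  exact Finset.sum_congr rfl fun k _ => by ring

lemma momentumFlux_x (S : StrongFields T δ R L r (fun i t x => q t x i) (fun i t x => u t x i)
    rt qt ut Q U P V) (hT : 0 < T) (hδ : 0 < δ) (hh : ContDiffOn ℝ ∞ h (Ioi 0))
    (hκ : ContDiffOn ℝ ∞ κ (Ioi 0)) (hw : IsWeakSolution h κ T r q D (momentum r u))
    (i j : Fin d) :
    XD T j (momentumFlux h κ r q (momentum r u) D i j) (fun t x =>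
      (q t x j * (u t x i * u t x j) + r t x * (U i j t x * u t x j + u t x i * U j j t x)) -
      ((if i = j then -(r t x * deriv (deriv h) (r t x) * q t x j +
          1 / 2 * (2 * deriv κ (r t x) + r t x * deriv (deriv κ) (r t x)) * q t x j *
            ∑ k, q t x k ^ 2 +
          (r t x * deriv κ (r t x) + κ (r t x)) * ∑ k, q t x k * Q k j t x) +
          ((2 * deriv κ (r t x) + r t x * deriv (deriv κ) (r t x)) * q t x j * ∑ k, q t x k ^ 2 +
          2 * (κ (r t x) + r t x * deriv κ (r t x)) * ∑ k, q t x k * Q k j t x +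
          (κ (r t x) + r t x * deriv κ (r t x)) * q t x j * ∑ k, Q k k t x +
          r t x * κ (r t x) * ∑ k, P k k j t x) else 0) -
        ((deriv κ (r t x) * q t x j * q t x i + κ (r t x) * Q i j t x) * q t x j +
          κ (r t x) * q t x i * Q j j t x))) := by
  have xc := (S.r_x j).mul ((S.u_x i j).mul (S.u_x j j))
  have xt := (S.G_x hT hδ hκ i j).mul (S.q_x j j)
  have xs : XD T j (fun t x => if i = j then
      -((r t x * deriv h (r t x) - h (r t x)) +
        1 / 2 * (r t x * deriv κ (r t x) + κ (r t x)) * ∑ k, q t x k ^ 2) +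
      ((κ (r t x) + r t x * deriv κ (r t x)) * (∑ k, q t x k ^ 2) +
        r t x * κ (r t x) * ∑ k, Q k k t x) else 0) (fun t x => if i = j then -(r t x * deriv (deriv h) (r t x) * q t x j +
          1 / 2 * (2 * deriv κ (r t x) + r t x * deriv (deriv κ) (r t x)) * q t x j *
            ∑ k, q t x k ^ 2 +
          (r t x * deriv κ (r t x) + κ (r t x)) * ∑ k, q t x k * Q k j t x) +
          ((2 * deriv κ (r t x) + r t x * deriv (deriv κ) (r t x)) * q t x j * ∑ k, q t x k ^ 2 +
          2 * (κ (r t x) + r t x * deriv κ (r t x)) * ∑ k, q t x k * Q k j t x +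
          (κ (r t x) + r t x * deriv κ (r t x)) * q t x j * ∑ k, Q k k t x +
          r t x * κ (r t x) * ∑ k, P k k j t x) else 0) := by
    by_cases hij : i = j
    · simp only [hij, if_true]
      exact ((S.scalar_x hT hδ hh hκ j).const_mul (-1)).add (S.div_vector_x hT hδ hκ j) |>.of_eq
        (fun t x => by ring) fun t x => by ring
    · simp only [hij, if_false]
      exact XD.const T j 0
  refine ((xc.add ((xs.add (xt.const_mul (-1))).const_mul (-1))).of_eq (fun t x => rfl)
    (fun t x => ?_)).congr_left ?_
  · ring
  -- The derivative was computed for an explicit representative of the flux. It agrees almost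
  -- everywhere with the flux itself because `D` is then the classical divergence and `r` does not
  -- vanish.
  · filter_upwards [S.div_eq hT hδ hκ hw, S.mem_slab] with z hz hr
    have hr0 : r z.1 z.2 ≠ 0 := (hδ.trans_le hr.1).ne'
    simp only [Function.uncurry, momentumFlux, momentum, kortewegStress, stressScalar,
      stressTensor, PiLp.smul_apply, smul_eq_mul, hz, sum_sq]
    have : r z.1 z.2 * u z.1 z.2 i * (r z.1 z.2 * u z.1 z.2 j) / r z.1 z.2 =
        r z.1 z.2 * (u z.1 z.2 i * u z.1 z.2 j) := by
      field_simp
    rw [this]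
    ring

lemma flux_mass' (hT : 0 < T) (hw : IsWeakSolution h κ T r q D (momentum r u)) :
    FluxEq T id r (fun j t x => r t x * u t x j) (fun _ _ => 0) := hw.flux_mass hT

/-- The velocity form of the momentum equation. -/
lemma velocity_eq (S : StrongFields T δ R L r (fun i t x => q t x i) (fun i t x => u t x i)
    rt qt ut Q U P V) (hT : 0 < T) (hδ : 0 < δ) (hh : ContDiffOn ℝ ∞ h (Ioi 0))
    (hκ : ContDiffOn ℝ ∞ κ (Ioi 0)) (hw : IsWeakSolution h κ T r q D (momentum r u))
    (i : Fin d) :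
    ∀ᵐ z ∂(slab d T), ut i z.1 z.2 = -(∑ j, u z.1 z.2 j * U i j z.1 z.2) -
      (deriv (deriv h) (r z.1 z.2) * q z.1 z.2 i +
        1 / 2 * deriv (deriv κ) (r z.1 z.2) * q z.1 z.2 i * (∑ k, q z.1 z.2 k ^ 2) +
        deriv κ (r z.1 z.2) * ∑ k, q z.1 z.2 k * Q k i z.1 z.2) +
      (deriv (deriv κ) (r z.1 z.2) * q z.1 z.2 i * (∑ k, q z.1 z.2 k ^ 2) +
        2 * deriv κ (r z.1 z.2) * (∑ k, q z.1 z.2 k * Q k i z.1 z.2) +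
        deriv κ (r z.1 z.2) * q z.1 z.2 i * (∑ k, Q k k z.1 z.2) +
        κ (r z.1 z.2) * ∑ k, P k k i z.1 z.2) := by
  have tm : TD T (fun t x => momentum r u t x i)
      (fun t x => rt t x * u t x i + r t x * ut i t x) :=
    (S.r_t.mul (S.u_t i)).of_eq (fun t x => by simp [momentum]) fun t x => rfl
  have := ae_eq_sum_of_flux hT (dir := id)
    (f := momentumFlux h κ r q (momentum r u) D i)
    (g := fun t x => 0 - (rt t x * u t x i + r t x * ut i t x))
    (fun j => S.momentumFlux_x hT hδ hh hκ hw i j)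
    ((integrable_zero _ _ _).sub tm.bdd_g.integrable)
    (fun p hp t ht => (hw.flux_momentum hT i).sub_td tm hp.isC1 ht)
  filter_upwards [this, S.mem_slab, S.mass_eq hT (flux_mass' hT hw),
    ae_all_iff.2 fun j => S.hessian_symm i j] with z hz hr hrt hQ
  exact velocity_algebra (q := fun k => q z.1 z.2 k) (u := fun k => u z.1 z.2 k)
    (Q := fun k j => Q k j z.1 z.2) (U := fun k j => U k j z.1 z.2)
    (Pi := fun j => ∑ k, P k k j z.1 z.2) (hδ.trans_le hr.1) hQ hrt hz

end StrongFields

end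

section

/-! ### The pairing of a weak solution with multipliers -/

/-- Multipliers `u`, `b`, `G` for momentum, density and density gradient, with their derivatives:
`U = ∇u`, `W = ∇ div u`, `X i = ∂_i G_i`, `Y i = ∇ X i`. -/
structure Multiplier (T : ℝ) (u ut : Fin d → ℝ → Torus d → ℝ) (U : Fin d → Fin d → ℝ → Torus d → ℝ)
    (W : Fin d → ℝ → Torus d → ℝ) (b bt : ℝ → Torus d → ℝ) (bx : Fin d → ℝ → Torus d → ℝ)
    (G Gt X : Fin d → ℝ → Torus d → ℝ) (Y : Fin d → Fin d → ℝ → Torus d → ℝ) : Prop where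
  u_t : ∀ i, TD T (u i) (ut i)
  u_x : ∀ i j, XD T j (u i) (U i j)
  div_x : ∀ k, XD T k (fun t x => ∑ i, U i i t x) (W k)
  b_t : TD T b bt
  b_x : ∀ j, XD T j b (bx j)
  G_t : ∀ i, TD T (G i) (Gt i)
  G_x : ∀ i, XD T i (G i) (X i)
  X_x : ∀ i j, XD T j (X i) (Y i j)

/-- The pairing `m · u + ρ b + q · G`. -/
def coupling (ρ : ℝ → Torus d → ℝ) (q m : ℝ → Torus d → Vec d) (u : Fin d → ℝ → Torus d → ℝ)
    (b : ℝ → Torus d → ℝ) (G : Fin d → ℝ → Torus d → ℝ) (t : ℝ) (x : Torus d) : ℝ :=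
  (∑ i, m t x i * u i t x) + ρ t x * b t x + ∑ i, q t x i * G i t x

/-- The density of the rate of change of `∫ coupling`. -/
def couplingRate (κ h : ℝ → ℝ) (ρ : ℝ → Torus d → ℝ) (q m : ℝ → Torus d → Vec d)
    (ut : Fin d → ℝ → Torus d → ℝ) (U : Fin d → Fin d → ℝ → Torus d → ℝ)
    (W : Fin d → ℝ → Torus d → ℝ) (bt : ℝ → Torus d → ℝ) (bx Gt : Fin d → ℝ → Torus d → ℝ)
    (Y : Fin d → Fin d → ℝ → Torus d → ℝ) (t : ℝ) (x : Torus d) : ℝ :=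
  (∑ i, ∑ j, (m t x i * m t x j / ρ t x + stressTensor κ (ρ t x) (q t x) i j) * U i j t x) +
    stressScalar h κ (ρ t x) (q t x) * (∑ i, U i i t x) +
    (∑ k, stressVector κ (ρ t x) (q t x) k * W k t x) +
    (∑ i, m t x i * (ut i t x + bx i t x - ∑ k, Y k i t x)) + ρ t x * bt t x +
    ∑ i, q t x i * Gt i t x

section Coupling

variable {h κ : ℝ → ℝ} {T : ℝ} {ρ : ℝ → Torus d → ℝ} {q m : ℝ → Torus d → Vec d}
  {D : ℝ → Torus d → ℝ} {u ut : Fin d → ℝ → Torus d → ℝ} {U : Fin d → Fin d → ℝ → Torus d → ℝ}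
  {W : Fin d → ℝ → Torus d → ℝ} {b bt : ℝ → Torus d → ℝ} {bx : Fin d → ℝ → Torus d → ℝ}
  {G Gt X : Fin d → ℝ → Torus d → ℝ} {Y : Fin d → Fin d → ℝ → Torus d → ℝ}

lemma IsWeakSolution.integrable_momentum (hw : IsWeakSolution h κ T ρ q D m) (i : Fin d) :
    Integrable (Function.uncurry fun t x => m t x i) (slab d T) :=
  (hw.continuous_m.apply i).integrable_slab (aestronglyMeasurable_apply hw.measurable_m i)

lemma Multiplier.integrable_coupling (M : Multiplier T u ut U W b bt bx G Gt X Y)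
    (hw : IsWeakSolution h κ T ρ q D m) {t : ℝ} (ht : t ∈ Icc 0 T) :
    (∀ i, Integrable fun x => m t x i * u i t x) ∧ (Integrable fun x => ρ t x * b t x) ∧
      ∀ i, Integrable fun x => q t x i * G i t x :=
  ⟨fun i => ((M.u_t i).essBdd ht).integrable_mul ((hw.continuous_m.apply i).1 t ht),
    (M.b_t.essBdd ht).integrable_mul (hw.continuous_ρ.1 t ht),
    fun i => ((M.G_t i).essBdd ht).integrable_mul ((hw.grad t ht).wkD i).int_g⟩

lemma Multiplier.integral_coupling (M : Multiplier T u ut U W b bt bx G Gt X Y)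
    (hw : IsWeakSolution h κ T ρ q D m) {t : ℝ} (ht : t ∈ Icc 0 T) :
    Integrable (coupling ρ q m u b G t) ∧ ∫ x, coupling ρ q m u b G t x =
      (∑ i, ∫ x, m t x i * u i t x) + (∫ x, ρ t x * b t x) + ∑ i, ∫ x, q t x i * G i t x := by
  obtain ⟨h1, h2, h3⟩ := M.integrable_coupling hw ht
  have s1 := integrable_finsetSum Finset.univ fun i _ => h1 i
  have s3 := integrable_finsetSum Finset.univ fun i _ => h3 i
  have s2 : Integrable fun x => (∑ i, m t x i * u i t x) + ρ t x * b t x := s1.add h2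
  refine ⟨s2.add s3, ?_⟩
  unfold coupling
  rw [integral_add s2 s3, integral_add s1 h2, integral_finsetSum _ fun i _ => h1 i,
    integral_finsetSum _ fun i _ => h3 i]

lemma Multiplier.integrable_couplingRate (M : Multiplier T u ut U W b bt bx G Gt X Y)
    (hw : IsWeakSolution h κ T ρ q D m)
    (iq : ∀ i, Integrable (Function.uncurry fun t x => q t x i) (slab d T)) :
    Integrable (Function.uncurry (couplingRate κ h ρ q m ut U W bt bx Gt Y)) (slab d T) := by
  have iρ := hw.continuous_ρ.integrable_slab hw.measurable_ρ
  have bY : ∀ i, SlabBdd T (fun t x => ut i t x + bx i t x - ∑ k, Y k i t x) := fun i => by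
    have := ((M.u_t i).bdd_g.add (M.b_x i).bdd_g).add
      ((SlabBdd.sum Finset.univ fun k => (M.X_x k i).bdd_g).const_mul (-1))
    simpa only [neg_one_mul, ← sub_eq_add_neg] using this
  refine (((((integrable_finsetSum _ fun i _ => integrable_finsetSum _ fun j _ => ?_).add
    ?_).add (integrable_finsetSum _ fun k _ => ?_)).add
    (integrable_finsetSum _ fun i _ => ?_)).add ?_).add (integrable_finsetSum _ fun i _ => ?_)
  · exact (M.u_x i j).bdd_g.mul_integrable (g := fun t x => m t x i * m t x j / ρ t x +
      stressTensor κ (ρ t x) (q t x) i j) ((hw.integrable_convection i j).add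
      (hw.integrable_tensor i j))
  · exact (SlabBdd.sum Finset.univ fun i => (M.u_x i i).bdd_g).mul_integrable
      (g := fun t x => stressScalar h κ (ρ t x) (q t x)) hw.integrable_scalar
  · exact (M.div_x k).bdd_g.mul_integrable (hw.integrable_vector_apply k)
  · exact (bY i).mul_integrable (hw.integrable_momentum i)
  · exact M.b_t.bdd_g.mul_integrable iρ
  · exact (M.G_t i).bdd_g.mul_integrable (iq i)

/-- The evolution of the pairing of a weak solution with multipliers. -/
theorem Multiplier.evolution (M : Multiplier T u ut U W b bt bx G Gt X Y) (hT : 0 < T)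
    (hw : IsWeakSolution h κ T ρ q D m)
    (iq : ∀ i, Integrable (Function.uncurry fun t x => q t x i) (slab d T)) {t : ℝ}
    (ht : t ∈ Icc 0 T) :
    (∫ x, coupling ρ q m u b G t x) - ∫ x, coupling ρ q m u b G 0 x =
      ∫ s in (0 : ℝ)..t, ∫ x, couplingRate κ h ρ q m ut U W bt bx Gt Y s x := by
  have h0T : (0 : ℝ) ∈ Icc 0 T := ⟨le_rfl, hT.le⟩
  have iρ := hw.continuous_ρ.integrable_slab hw.measurable_ρ
  set A : Fin d → ℝ → Torus d → ℝ := fun i s x =>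
    (∑ j, momentumFlux h κ ρ q m D i j s x * U i j s x) + m s x i * ut i s x with hA
  set B : ℝ → Torus d → ℝ := fun s x => (∑ j, m s x j * bx j s x) + ρ s x * bt s x with hB
  set C : Fin d → ℝ → Torus d → ℝ := fun i s x =>
    (∑ j, -m s x j * Y i j s x) + q s x i * Gt i s x with hC
  have iA : ∀ i, Integrable (Function.uncurry (A i)) (slab d T) := fun i =>
    (integrable_finsetSum _ fun j _ =>
      (M.u_x i j).bdd_g.mul_integrable (hw.integrable_momentumFlux i j)).add
      ((M.u_t i).bdd_g.mul_integrable (hw.integrable_momentum i))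
  have iB : Integrable (Function.uncurry B) (slab d T) :=
    (integrable_finsetSum _ fun j _ =>
      (M.b_x j).bdd_g.mul_integrable (hw.integrable_momentum j)).add
      (M.b_t.bdd_g.mul_integrable iρ)
  have iC : ∀ i, Integrable (Function.uncurry (C i)) (slab d T) := fun i =>
    (integrable_finsetSum _ fun j _ => (M.X_x i j).bdd_g.mul_integrable
      (g := fun t x => -m t x j) (hw.integrable_momentum j).neg).add
      ((M.G_t i).bdd_g.mul_integrable (iq i))
  have eA : ∀ i, (∫ x, m t x i * u i t x) - ∫ x, m 0 x i * u i 0 x =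
      ∫ s in (0 : ℝ)..t, ∫ x, A i s x := fun i => by
    have := (hw.flux_momentum hT i).pairing (M.u_t i) (M.u_x i) ht
    simpa only [zero_mul, add_zero] using this
  have eB : (∫ x, ρ t x * b t x) - ∫ x, ρ 0 x * b 0 x = ∫ s in (0 : ℝ)..t, ∫ x, B s x := by
    have := (hw.flux_mass hT).pairing M.b_t M.b_x ht
    simpa only [zero_mul, add_zero] using this
  have eC : ∀ i, (∫ x, q t x i * G i t x) - ∫ x, q 0 x i * G i 0 x =
      ∫ s in (0 : ℝ)..t, ∫ x, C i s x := fun i =>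
    (hw.flux_mass hT).pairing_grad (fun t ht => (hw.grad t ht).wkD i) (iq i) (M.G_t i) (M.G_x i)
      (M.X_x i) ht
  have II : ∀ {f : ℝ → Torus d → ℝ}, Integrable (Function.uncurry f) (slab d T) →
      IntervalIntegrable (fun s => ∫ x, f s x) volume 0 t := fun hf =>
    intervalIntegrable_of_Ioo (slab_integrableOn hf) ht
  have SI : ∀ {f : Fin d → ℝ → Torus d → ℝ}, (∀ i, Integrable (Function.uncurry (f i)) (slab d T)) →
      IntervalIntegrable (fun s => ∑ i, ∫ x, f i s x) volume 0 t := fun hf =>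
    intervalIntegrable_of_Ioo (integrable_finsetSum _ fun i _ => slab_integrableOn (hf i)) ht
  have e1 : (∫ x, coupling ρ q m u b G t x) - ∫ x, coupling ρ q m u b G 0 x =
      ∫ s in (0 : ℝ)..t, ((∑ i, ∫ x, A i s x) + (∫ x, B s x) + ∑ i, ∫ x, C i s x) := by
    rw [intervalIntegral.integral_add, intervalIntegral.integral_add,
      intervalIntegral.integral_finsetSum fun i _ => II (iA i),
      intervalIntegral.integral_finsetSum fun i _ => II (iC i), (M.integral_coupling hw ht).2,
      (M.integral_coupling hw h0T).2, ← eB, Finset.sum_congr rfl fun i _ => (eA i).symm,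
      Finset.sum_congr rfl fun i _ => (eC i).symm, Finset.sum_sub_distrib, Finset.sum_sub_distrib]
    · ring
    · exact SI iA
    · exact II iB
    · exact (SI iA).add (II iB)
    · exact SI iC
  rw [e1]
  refine intervalIntegral_congr_Ioo ?_ ht
  have bdiv : SlabBdd T (fun t x => ∑ i, U i i t x) :=
    SlabBdd.sum Finset.univ fun i => (M.u_x i i).bdd_g
  filter_upwards [ae_flux_eq_zero hT (dir := id) hw.integrable_vector_apply hw.integrable_div
      (fun p hp t ht => hw.primitive_div hT hp t ht), ae_all_iff.2 fun i => slab_integrable (iA i),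
    slab_integrable iB, ae_all_iff.2 fun i => slab_integrable (iC i), bdiv.ae_essBdd,
    ae_all_iff.2 fun k => (M.div_x k).bdd_g.ae_essBdd, ae_all_iff.2 fun k => (M.div_x k).wkD,
    ae_all_iff.2 fun k => slab_integrable (hw.integrable_vector_apply k),
    slab_integrable hw.integrable_div] with s k1 k2 k3 k4 k5 k6 k7 k8 k9
  -- The definition of the weak divergence, extended to the multiplier `div u`. This vanishing
  -- integral is added in order to trade `D div u` for the vector part of the stress against `W =
  -- ∇div u`.
  have z := k1 k5 k6 k7
  have iz : Integrable fun x => (∑ j, stressVector κ (ρ s x) (q s x) j * W j s x) +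
      D s x * ∑ i, U i i s x :=
    (integrable_finsetSum _ fun j _ => (k6 j).integrable_mul (k8 j)).add (k5.integrable_mul k9)
  have sA := integrable_finsetSum Finset.univ fun i _ => k2 i
  have sC := integrable_finsetSum Finset.univ fun i _ => k4 i
  have sB : Integrable fun x => (∑ i, A i s x) + B s x := sA.add k3
  have sD : Integrable fun x => (∑ i, A i s x) + B s x + ∑ i, C i s x := sB.add sC
  rw [← integral_finsetSum _ fun i _ => k2 i, ← integral_finsetSum _ fun i _ => k4 i,
    ← integral_add sA k3, ← integral_add sB sC, ← add_zero (∫ x, ((∑ i, A i s x) + B s x +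
    ∑ i, C i s x)), ← z, ← integral_add sD iz]
  refine integral_congr_ae (Eventually.of_forall fun x => ?_)
  simp only [hA, hB, hC, couplingRate, momentumFlux, kortewegStress]
  have a1 : ∀ i, ∑ j, (m s x i * m s x j / ρ s x -
      ((if i = j then -stressScalar h κ (ρ s x) (q s x) + D s x else 0) -
        stressTensor κ (ρ s x) (q s x) i j)) * U i j s x =
      (∑ j, (m s x i * m s x j / ρ s x + stressTensor κ (ρ s x) (q s x) i j) * U i j s x) +
        (stressScalar h κ (ρ s x) (q s x) - D s x) * U i i s x := fun i => by
    have : ∀ j, (m s x i * m s x j / ρ s x -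
      ((if i = j then -stressScalar h κ (ρ s x) (q s x) + D s x else 0) -
        stressTensor κ (ρ s x) (q s x) i j)) * U i j s x =
      (m s x i * m s x j / ρ s x + stressTensor κ (ρ s x) (q s x) i j) * U i j s x +
        if i = j then (stressScalar h κ (ρ s x) (q s x) - D s x) * U i j s x else 0 := fun j => by
      split_ifs <;> ring
    simp only [this, Finset.sum_add_distrib, Finset.sum_ite_eq, Finset.mem_univ, if_true]
  simp only [a1, Finset.sum_add_distrib, ← Finset.mul_sum]
  have a2 : ∑ i, ∑ j, -m s x j * Y i j s x = -∑ i, m s x i * ∑ k, Y k i s x := by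
    rw [Finset.sum_comm]
    simp only [neg_mul, Finset.sum_neg_distrib, Finset.mul_sum]
  have a3 : ∑ i, m s x i * (ut i s x + bx i s x - ∑ k, Y k i s x) =
      (∑ i, m s x i * ut i s x) + (∑ i, m s x i * bx i s x) -
        ∑ i, m s x i * ∑ k, Y k i s x := by
    simp only [mul_sub, mul_add, Finset.sum_sub_distrib, Finset.sum_add_distrib]
  rw [a2, a3]
  ring

end Coupling

end

section

/-! ### The algebra of the relative energy identity -/

section Algebra

variable {ρ r h2 k0 k1 k2 rt : ℝ} {m q y u ut yt W : Fin d → ℝ} {Q U : Fin d → Fin d → ℝ}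
  {p : Fin d → ℝ}

/-- The coefficient `-(u·∇)u - ½∇|u|²` of `m - ru` completes the square in `m/ρ - u`. The leftover,
linear in `ρ - r`, is cancelled later by the time derivative of `-½|u|²` in the density multiplier.
-/
lemma convection_algebra (hρ : ρ ≠ 0) :
    (∑ i, ∑ j, m i * m j / ρ * U i j) - (∑ i, ∑ j, r * u i * (r * u j) / r * U i j) +
      ∑ i, (m i - r * u i) * (-(∑ j, u j * U i j) - ∑ k, u k * U k i) =
    ρ * (∑ i, ∑ j, (m i / ρ - u i) * (m j / ρ - u j) * U i j) -
      (ρ - r) * ∑ i, ∑ j, u i * u j * U i j := by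
  have e1 : ∑ i, (m i - r * u i) * (-(∑ j, u j * U i j) - ∑ k, u k * U k i) =
      (∑ i, ∑ j, -((m i - r * u i) * u j * U i j)) + ∑ i, ∑ j, -((m j - r * u j) * u i * U i j) := by
    rw [Finset.sum_comm (f := fun i j => -((m j - r * u j) * u i * U i j)),
      ← Finset.sum_add_distrib]
    refine Finset.sum_congr rfl fun i _ => ?_
    simp only [← Finset.sum_neg_distrib, ← Finset.sum_add_distrib, Finset.mul_sum,
      ← Finset.sum_sub_distrib]
    exact Finset.sum_congr rfl fun j _ => by ring
  rw [e1]
  simp only [← Finset.sum_add_distrib, Finset.mul_sum, ← Finset.sum_sub_distrib]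
  refine Finset.sum_congr rfl fun i _ => Finset.sum_congr rfl fun j _ => ?_
  field_simp
  ring

/-- The left side is the total coefficient of `ρ - r`: linearized stress, rate of the density
multiplier, and the contribution of the divergence term. It vanishes by the mass equation and its
gradient. -/
lemma density_algebra (hQ : ∀ i j, Q i j = Q j i) (hrt : rt = -∑ j, (y j * u j + r * U j j))
    (hyt : ∀ k, yt k = -((∑ j, (Q j k * u j + y j * U j k + y k * U j j)) + r * W k)) :
    (r * h2 + 1 / 2 * (2 * k1 + r * k2) * ∑ k, y k ^ 2) * (∑ i, U i i) +
      (k0 + r * k1) * (∑ k, y k * W k) + k1 * (∑ i, ∑ j, y i * y j * U i j) +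
      (h2 * rt + 1 / 2 * k2 * rt * (∑ k, y k ^ 2) + k1 * ∑ k, y k * yt k) +
      (∑ k, u k * (h2 * y k + 1 / 2 * k2 * y k * (∑ l, y l ^ 2) + k1 * ∑ l, y l * Q l k)) -
      ∑ k, W k * (k0 * y k) = 0 := by
  have e1 : ∑ j, (y j * u j + r * U j j) = (∑ j, y j * u j) + r * ∑ j, U j j := by
    rw [Finset.sum_add_distrib, Finset.mul_sum]
  have e2 : ∑ k, y k * yt k = -((∑ k, ∑ j, y k * (Q j k * u j)) + (∑ i, ∑ j, y i * y j * U i j) +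
      (∑ k, y k ^ 2) * (∑ j, U j j) + r * ∑ k, y k * W k) := by
    rw [Finset.sum_comm (f := fun i j => y i * y j * U i j), Finset.sum_mul, Finset.mul_sum]
    simp only [← Finset.sum_add_distrib, ← Finset.sum_neg_distrib]
    refine Finset.sum_congr rfl fun k _ => ?_
    rw [hyt, Finset.mul_sum, ← Finset.sum_add_distrib]
    have : ∑ j, (Q j k * u j + y j * U j k + y k * U j j) =
        (∑ j, Q j k * u j) + (∑ j, y j * U j k) + y k * ∑ j, U j j := by
      simp only [Finset.sum_add_distrib, Finset.mul_sum]
    rw [this]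
    simp only [Finset.mul_sum, Finset.sum_add_distrib]
    have e : ∑ j, y j * y k * U j k = y k * ∑ j, y j * U j k := by
      rw [Finset.mul_sum]
      exact Finset.sum_congr rfl fun j _ => by ring
    rw [e, ← Finset.mul_sum, ← Finset.mul_sum, ← Finset.mul_sum]
    ring
  have e3 : ∑ k, u k * (h2 * y k + 1 / 2 * k2 * y k * (∑ l, y l ^ 2) + k1 * ∑ l, y l * Q l k) =
      h2 * (∑ k, y k * u k) + 1 / 2 * k2 * (∑ l, y l ^ 2) * (∑ k, y k * u k) +
        k1 * ∑ k, ∑ j, y k * (Q j k * u j) := by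
    rw [Finset.sum_comm (f := fun k j => y k * (Q j k * u j))]
    simp only [Finset.mul_sum, ← Finset.sum_add_distrib, Finset.sum_mul]
    refine Finset.sum_congr rfl fun k _ => ?_
    simp only [Finset.mul_sum, mul_add]
    have : ∀ l, u k * (k1 * (y l * Q l k)) = k1 * (y l * (Q k l * u k)) := fun l => by
      rw [hQ l k]; ring
    simp only [this]
    congr 1
    congr 1
    · ring
    · exact Finset.sum_congr rfl fun l _ => by ring
  have e4 : ∑ k, W k * (k0 * y k) = k0 * ∑ k, y k * W k := by
    rw [Finset.mul_sum]; exact Finset.sum_congr rfl fun k _ => by ring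
  rw [e2, e3, e4, hrt, e1]
  ring

/-- The same cancellation for the coefficient of `q i - y i`; again only the mass equation, its
gradient and the symmetry of the Hessian are used. -/
lemma gradient_algebra {i : Fin d} (hQ : ∀ i j, Q i j = Q j i)
    (hrt : rt = -∑ j, (y j * u j + r * U j j))
    (hyt : yt i = -((∑ j, (Q j i * u j + y j * U j i + y i * U j j)) + r * W i)) :
    (r * k1 + k0) * y i * (∑ j, U j j) + r * k0 * W i + k0 * (∑ j, (y j * U i j + y j * U j i)) +
      (k1 * rt * y i + k0 * yt i) +
      ∑ k, (u k * (k1 * y k * y i + k0 * Q i k) - U i k * (k0 * y k)) = 0 := by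
  have e1 : ∑ j, (y j * u j + r * U j j) = (∑ j, y j * u j) + r * ∑ j, U j j := by
    rw [Finset.sum_add_distrib, Finset.mul_sum]
  have e2 : ∑ j, (Q j i * u j + y j * U j i + y i * U j j) =
      (∑ j, Q j i * u j) + (∑ j, y j * U j i) + y i * ∑ j, U j j := by
    simp only [Finset.sum_add_distrib, Finset.mul_sum]
  have e3 : ∑ k, (u k * (k1 * y k * y i + k0 * Q i k) - U i k * (k0 * y k)) =
      k1 * y i * (∑ k, y k * u k) + k0 * (∑ k, Q k i * u k) - k0 * ∑ j, y j * U i j := by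
    simp only [Finset.mul_sum, ← Finset.sum_add_distrib, ← Finset.sum_sub_distrib]
    exact Finset.sum_congr rfl fun k _ => by rw [hQ i k]; ring
  rw [e3, hyt, hrt, e1, e2, Finset.sum_add_distrib]
  ring

lemma sum_linear_eq_zero {g A B C : Fin d → ℝ} {c1 c2 c3 v : ℝ}
    (h : ∀ i, c1 * y i * v + c2 * W i + c3 * A i + B i + C i = 0) :
    c1 * (∑ i, y i * g i) * v + c2 * (∑ i, g i * W i) + c3 * (∑ i, g i * A i) +
      (∑ i, g i * B i) + ∑ i, g i * C i = 0 := by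
  simp only [Finset.mul_sum, Finset.sum_mul, ← Finset.sum_add_distrib]
  refine Finset.sum_eq_zero fun i _ => ?_
  linear_combination g i * h i

end Algebra

/-! ### The relative remainder -/

/-- The linearization remainder of the scalar part of the stress at `(r, y)`. -/
def relScalar (h κ : ℝ → ℝ) (ρ r : ℝ) (q y : Vec d) : ℝ :=
  stressScalar h κ ρ q - stressScalar h κ r y -
    ((r * deriv (deriv h) r + 1 / 2 * (2 * deriv κ r + r * deriv (deriv κ) r) * ∑ k, y k ^ 2) *
      (ρ - r) + (r * deriv κ r + κ r) * ∑ k, y k * (q k - y k))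

/-- The linearization remainder of the vector part of the stress at `(r, y)`. -/
def relVector (κ : ℝ → ℝ) (ρ r : ℝ) (q y : Vec d) (k : Fin d) : ℝ :=
  stressVector κ ρ q k - stressVector κ r y k -
    ((κ r + r * deriv κ r) * (ρ - r) * y k + r * κ r * (q k - y k))

/-- The linearization remainder of the tensor part of the stress at `(r, y)`. -/
def relTensor (κ : ℝ → ℝ) (ρ r : ℝ) (q y : Vec d) (i j : Fin d) : ℝ :=
  stressTensor κ ρ q i j - stressTensor κ r y i j -
    (deriv κ r * (ρ - r) * y i * y j + κ r * ((q i - y i) * y j + y i * (q j - y j)))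

/-- The density of the rate of change of the relative energy, up to sign. -/
def relRate (h κ : ℝ → ℝ) (ρ r : ℝ) (q y m u : Vec d) (U : Fin d → Fin d → ℝ) (W : Fin d → ℝ) :
    ℝ :=
  ρ * (∑ i, ∑ j, (m i / ρ - u i) * (m j / ρ - u j) * U i j) +
    relScalar h κ ρ r q y * (∑ i, U i i) + (∑ k, relVector κ ρ r q y k * W k) +
    ∑ i, ∑ j, relTensor κ ρ r q y i j * U i j

section Multipliers

variable (h κ : ℝ → ℝ) (r : ℝ → Torus d → ℝ) (y u : ℝ → Torus d → Vec d)

/-- The multiplier `h'(r) + ½ κ'(r) |∇r|² - ½ |u|²`. -/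
def densityMult (t : ℝ) (x : Torus d) : ℝ :=
  deriv h (r t x) + 1 / 2 * deriv κ (r t x) * (∑ k, y t x k ^ 2) - 1 / 2 * ∑ k, u t x k ^ 2

/-- The space derivatives of `densityMult`. -/
def densityMultX (Q U : Fin d → Fin d → ℝ → Torus d → ℝ) (j : Fin d) (t : ℝ) (x : Torus d) : ℝ :=
  deriv (deriv h) (r t x) * y t x j +
    1 / 2 * deriv (deriv κ) (r t x) * y t x j * (∑ k, y t x k ^ 2) +
    deriv κ (r t x) * (∑ k, y t x k * Q k j t x) - ∑ k, u t x k * U k j t x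

/-- The time derivative of `densityMult`. -/
def densityMultT (rt : ℝ → Torus d → ℝ) (yt ut : Fin d → ℝ → Torus d → ℝ) (t : ℝ) (x : Torus d) :
    ℝ :=
  deriv (deriv h) (r t x) * rt t x +
    1 / 2 * deriv (deriv κ) (r t x) * rt t x * (∑ k, y t x k ^ 2) +
    deriv κ (r t x) * (∑ k, y t x k * yt k t x) - ∑ k, u t x k * ut k t x

/-- The multiplier `κ(r) ∇r`. -/
def gradMult (i : Fin d) (t : ℝ) (x : Torus d) : ℝ := κ (r t x) * y t x i

/-- The space derivatives of `gradMult`. -/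
def gradMultX (Q : Fin d → Fin d → ℝ → Torus d → ℝ) (i j : Fin d) (t : ℝ) (x : Torus d) : ℝ :=
  deriv κ (r t x) * y t x j * y t x i + κ (r t x) * Q i j t x

/-- The second space derivatives of `gradMult`. -/
def gradMultXX (Q : Fin d → Fin d → ℝ → Torus d → ℝ) (P : Fin d → Fin d → Fin d → ℝ → Torus d → ℝ)
    (i j k : Fin d) (t : ℝ) (x : Torus d) : ℝ :=
  deriv (deriv κ) (r t x) * y t x k * y t x j * y t x i +
    deriv κ (r t x) * (Q j k t x * y t x i + y t x j * Q i k t x + y t x k * Q i j t x) +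
    κ (r t x) * P i j k t x

/-- The time derivative of `gradMult`. -/
def gradMultT (rt : ℝ → Torus d → ℝ) (yt : Fin d → ℝ → Torus d → ℝ) (i : Fin d) (t : ℝ)
    (x : Torus d) : ℝ :=
  deriv κ (r t x) * rt t x * y t x i + κ (r t x) * yt i t x

/-- The gradient of the divergence of the velocity. -/
def gradDiv (V : Fin d → Fin d → Fin d → ℝ → Torus d → ℝ) (k : Fin d) (t : ℝ) (x : Torus d) : ℝ :=
  ∑ j, V j j k t x

end Multipliers

namespace StrongFields

variable {h κ : ℝ → ℝ} {T δ R L : ℝ} {r : ℝ → Torus d → ℝ} {y u : ℝ → Torus d → Vec d}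
  {rt : ℝ → Torus d → ℝ} {yt ut : Fin d → ℝ → Torus d → ℝ}
  {Q U : Fin d → Fin d → ℝ → Torus d → ℝ} {P V : Fin d → Fin d → Fin d → ℝ → Torus d → ℝ}
  {ρ : ℝ → Torus d → ℝ} {q m : ℝ → Torus d → Vec d} {D D' : ℝ → Torus d → ℝ}

lemma multiplier (S : StrongFields T δ R L r (fun i t x => y t x i) (fun i t x => u t x i)
    rt yt ut Q U P V) (hT : 0 < T) (hδ : 0 < δ) (hh : ContDiffOn ℝ ∞ h (Ioi 0))
    (hκ : ContDiffOn ℝ ∞ κ (Ioi 0)) :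
    Multiplier T (fun i t x => u t x i) ut U (gradDiv V) (densityMult h κ r y u)
      (densityMultT h κ r y u rt yt ut) (densityMultX h κ r y u Q U) (gradMult κ r y)
      (gradMultT κ r y rt yt) (fun i => gradMultX κ r y Q i i) (fun i => gradMultXX κ r y Q P i i) where
  u_t := S.u_t
  u_x := S.u_x
  div_x k := XD.sum Finset.univ fun i => S.U_x i i k
  b_t := S.beta_t hT hδ hh hκ
  b_x := S.beta_x hT hδ hh hκ
  G_t := S.G_t hT hδ hκ
  G_x i := S.G_x hT hδ hκ i i
  X_x i j := S.G_xx hT hδ hκ i i j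

/-- The integrand that arises from integration by parts in the relative energy identity. -/
def nullForm (κ : ℝ → ℝ) (ρ : ℝ → Torus d → ℝ) (q : ℝ → Torus d → Vec d) (r : ℝ → Torus d → ℝ)
    (y u : ℝ → Torus d → Vec d) (Q U : Fin d → Fin d → ℝ → Torus d → ℝ)
    (P V : Fin d → Fin d → Fin d → ℝ → Torus d → ℝ) (t : ℝ) (x : Torus d) : ℝ :=
  (ρ t x - r t x) * ((∑ k, u t x k * ∑ j, gradMultXX κ r y Q P j j k t x) -
    ∑ j, gradDiv V j t x * gradMult κ r y j t x) +
  ∑ j, (q t x j - y t x j) * ∑ k, (u t x k * gradMultX κ r y Q j k t x -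
    U j k t x * gradMult κ r y k t x)

/-- The rates of the weak and of the strong solution are taken with the same multipliers, and the
linear parts of their difference cancel by the strong equations. The terms with second derivatives
of `κ(r)∇r` multiplying `ρ - r` do not cancel pointwise; `nullForm` compensates for them. -/
lemma rate_algebra (S : StrongFields T δ R L r (fun i t x => y t x i) (fun i t x => u t x i)
    rt yt ut Q U P V) (hT : 0 < T) (hδ : 0 < δ) (hh : ContDiffOn ℝ ∞ h (Ioi 0))
    (hκ : ContDiffOn ℝ ∞ κ (Ioi 0)) (hw : IsWeakSolution h κ T r y D' (momentum r u))
    (hρ : ∀ᵐ z ∂(slab d T), 0 < ρ z.1 z.2) :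
    ∀ᵐ z ∂(slab d T),
      couplingRate κ h ρ q m ut U (gradDiv V) (densityMultT h κ r y u rt yt ut)
        (densityMultX h κ r y u Q U) (gradMultT κ r y rt yt)
        (fun i => gradMultXX κ r y Q P i i) z.1 z.2 -
      couplingRate κ h r y (momentum r u) ut U (gradDiv V) (densityMultT h κ r y u rt yt ut)
        (densityMultX h κ r y u Q U) (gradMultT κ r y rt yt)
        (fun i => gradMultXX κ r y Q P i i) z.1 z.2 +
      nullForm κ ρ q r y u Q U P V z.1 z.2 =
      relRate h κ (ρ z.1 z.2) (r z.1 z.2) (q z.1 z.2) (y z.1 z.2) (m z.1 z.2) (u z.1 z.2)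
        (fun i j => U i j z.1 z.2) (fun k => gradDiv V k z.1 z.2) := by
  filter_upwards [hρ, S.mem_slab, S.mass_eq hT (flux_mass' hT hw),
    ae_all_iff.2 fun k => S.grad_mass_eq hT (flux_mass' hT hw) k,
    ae_all_iff.2 fun i => S.velocity_eq hT hδ hh hκ hw i,
    ae_all_iff.2 fun i => ae_all_iff.2 fun j => S.hessian_symm i j] with ⟨t, x⟩ hρ hr hrt hyt hut hQ
  dsimp only at hρ hr hrt hyt hut hQ ⊢
  have hyt' : ∀ k, yt k t x = -((∑ j, (Q j k t x * u t x j + y t x j * U j k t x +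
      y t x k * U j j t x)) + r t x * gradDiv V k t x) := fun k => by
    rw [hyt k, gradDiv, Finset.mul_sum, ← Finset.sum_add_distrib]
  have c := convection_algebra (ρ := ρ t x) (r := r t x) (m := fun i => m t x i) (u := fun i => u t x i)
    (U := fun i j => U i j t x) hρ.ne'
  have f := density_algebra (y := fun i => y t x i) (u := fun i => u t x i)
    (Q := fun i j => Q i j t x) (U := fun i j => U i j t x) (yt := fun k => yt k t x)
    (W := fun k => gradDiv V k t x) (h2 := deriv (deriv h) (r t x)) (k0 := κ (r t x))
    (k1 := deriv κ (r t x)) (k2 := deriv (deriv κ) (r t x)) hQ hrt hyt'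
  have g := fun i => gradient_algebra (i := i) (y := fun i => y t x i) (u := fun i => u t x i)
    (Q := fun i j => Q i j t x) (U := fun i j => U i j t x) (yt := fun k => yt k t x)
    (W := fun k => gradDiv V k t x) (k0 := κ (r t x))
    (k1 := deriv κ (r t x)) hQ hrt (hyt' i)
  have sY : ∀ i, ∑ k, gradMultXX κ r y Q P k k i t x =
      deriv (deriv κ) (r t x) * y t x i * (∑ k, y t x k ^ 2) +
        2 * deriv κ (r t x) * (∑ k, y t x k * Q k i t x) +
        deriv κ (r t x) * y t x i * (∑ k, Q k k t x) + κ (r t x) * ∑ k, P k k i t x := fun i => by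
    simp only [gradMultXX, Finset.mul_sum, ← Finset.sum_add_distrib]
    exact Finset.sum_congr rfl fun k _ => by ring
  -- By the velocity equation, the rates of the three multipliers combine so that pressure and
  -- capillarity disappear from the coefficient of `m`. Only the convective terms of
  -- `convection_algebra` survive.
  have sa : ∀ i, ut i t x + densityMultX h κ r y u Q U i t x - ∑ k, gradMultXX κ r y Q P k k i t x =
      -(∑ j, u t x j * U i j t x) - ∑ k, u t x k * U k i t x := fun i => by
    rw [sY, hut i, densityMultX]
    ring
  -- The last sum, `u·∇div(κ(r)∇r)`, contains third derivatives of `r`. It enters multiplied by `ρ -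
  -- r` and is cancelled by the first part of `nullForm`.
  have su : ∑ k, u t x k * ut k t x = -(∑ i, ∑ j, u t x i * u t x j * U i j t x) -
      (∑ k, u t x k * (deriv (deriv h) (r t x) * y t x k + 1 / 2 * deriv (deriv κ) (r t x) *
        y t x k * (∑ l, y t x l ^ 2) + deriv κ (r t x) * ∑ l, y t x l * Q l k t x)) +
      ∑ k, u t x k * ∑ j, gradMultXX κ r y Q P j j k t x := by
    simp only [← Finset.sum_neg_distrib, ← Finset.sum_add_distrib, ← Finset.sum_sub_distrib]
    refine Finset.sum_congr rfl fun k _ => ?_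
    rw [sY, hut k]
    have : ∑ j, -(u t x k * u t x j * U k j t x) = -(u t x k * ∑ j, u t x j * U k j t x) := by
      rw [Finset.mul_sum, ← Finset.sum_neg_distrib]
      exact Finset.sum_congr rfl fun j _ => by ring
    rw [this]
    ring
  have gs := sum_linear_eq_zero (g := fun i => q t x i - y t x i) g
  have split : ∀ A B : Fin d → Fin d → ℝ, ∑ i, ∑ j, (A i j + B i j) * U i j t x =
      (∑ i, ∑ j, A i j * U i j t x) + ∑ i, ∑ j, B i j * U i j t x := fun A B => by
    simp only [add_mul, Finset.sum_add_distrib]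
  have tens : ∑ i, ∑ j, relTensor κ (ρ t x) (r t x) (q t x) (y t x) i j * U i j t x =
      (∑ i, ∑ j, stressTensor κ (ρ t x) (q t x) i j * U i j t x) -
      (∑ i, ∑ j, stressTensor κ (r t x) (y t x) i j * U i j t x) -
      (deriv κ (r t x) * (ρ t x - r t x) * (∑ i, ∑ j, y t x i * y t x j * U i j t x) +
        κ (r t x) * ∑ i, (q t x i - y t x i) *
          ∑ j, (y t x j * U i j t x + y t x j * U j i t x)) := by
    have e : ∑ i, (q t x i - y t x i) * ∑ j, (y t x j * U i j t x + y t x j * U j i t x) =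
        (∑ i, ∑ j, (q t x i - y t x i) * y t x j * U i j t x) +
          ∑ i, ∑ j, (q t x j - y t x j) * y t x i * U i j t x := by
      rw [Finset.sum_comm (f := fun i j => (q t x j - y t x j) * y t x i * U i j t x)]
      simp only [Finset.mul_sum, ← Finset.sum_add_distrib]
      exact Finset.sum_congr rfl fun i _ => Finset.sum_congr rfl fun j _ => by ring
    rw [e]
    simp only [Finset.mul_sum, ← Finset.sum_add_distrib, ← Finset.sum_sub_distrib, relTensor]
    exact Finset.sum_congr rfl fun i _ => Finset.sum_congr rfl fun j _ => by ring
  have vect : ∑ k, relVector κ (ρ t x) (r t x) (q t x) (y t x) k * gradDiv V k t x =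
      (∑ k, stressVector κ (ρ t x) (q t x) k * gradDiv V k t x) -
      (∑ k, stressVector κ (r t x) (y t x) k * gradDiv V k t x) -
      ((κ (r t x) + r t x * deriv κ (r t x)) * (ρ t x - r t x) *
        (∑ k, y t x k * gradDiv V k t x) +
        r t x * κ (r t x) * ∑ k, (q t x k - y t x k) * gradDiv V k t x) := by
    simp only [Finset.mul_sum, ← Finset.sum_add_distrib, ← Finset.sum_sub_distrib, relVector]
    exact Finset.sum_congr rfl fun k _ => by ring
  have mom : ∑ i, (m t x i - r t x * u t x i) *
      (-(∑ j, u t x j * U i j t x) - ∑ k, u t x k * U k i t x) =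
      (∑ i, m t x i * (-(∑ j, u t x j * U i j t x) - ∑ k, u t x k * U k i t x)) -
      ∑ i, r t x * u t x i * (-(∑ j, u t x j * U i j t x) - ∑ k, u t x k * U k i t x) := by
    rw [← Finset.sum_sub_distrib]
    exact Finset.sum_congr rfl fun i _ => by ring
  have grad : ∑ i, (q t x i - y t x i) * gradMultT κ r y rt yt i t x =
      (∑ i, q t x i * gradMultT κ r y rt yt i t x) -
        ∑ i, y t x i * gradMultT κ r y rt yt i t x := by
    rw [← Finset.sum_sub_distrib]
    exact Finset.sum_congr rfl fun i _ => by ring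
  simp only [couplingRate, nullForm, relRate, sa, split, tens, vect, momentum, PiLp.smul_apply,
    smul_eq_mul, relScalar, densityMultT, su]
  rw [mom] at c
  have grad' := grad
  simp only [gradMultT] at grad'
  rw [grad'] at gs
  simp only [gradMultT, gradMultX, gradMult] at gs f ⊢
  linear_combination c + (ρ t x - r t x) * f + gs

end StrongFields

end

section

/-! ### The relative energy identity -/

lemma integral_sub_add {α : Type*} [MeasurableSpace α] {μ : Measure α} {a b c : α → ℝ}
    (ha : Integrable a μ) (hb : Integrable b μ) (hc : Integrable c μ) :
    ∫ x, (a x - b x + c x) ∂μ = ((∫ x, a x ∂μ) - ∫ x, b x ∂μ) + ∫ x, c x ∂μ := by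
  have hab : Integrable (fun x => a x - b x) μ := ha.sub hb
  rw [integral_add hab hc, integral_sub ha hb]

namespace StrongFields

variable {h κ : ℝ → ℝ} {T δ R L : ℝ} {r : ℝ → Torus d → ℝ} {y u : ℝ → Torus d → Vec d}
  {rt : ℝ → Torus d → ℝ} {yt ut : Fin d → ℝ → Torus d → ℝ}
  {Q U : Fin d → Fin d → ℝ → Torus d → ℝ} {P V : Fin d → Fin d → Fin d → ℝ → Torus d → ℝ}
  {ρ : ℝ → Torus d → ℝ} {q m : ℝ → Torus d → Vec d} {D D' : ℝ → Torus d → ℝ}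

/-- With `G = κ(r)∇r`, the integrand is the divergence of `(ρ - r)(u·∇G - G·∇u)`. Products of first
derivatives cancel in the divergence of the bracket, which is `u·∇div G - G·∇div u` because weak
derivatives commute. -/
lemma integral_nullForm (S : StrongFields T δ R L r (fun i t x => y t x i) (fun i t x => u t x i)
    rt yt ut Q U P V) (hT : 0 < T) (hδ : 0 < δ) (hκ : ContDiffOn ℝ ∞ κ (Ioi 0))
    (hw : IsWeakSolution h κ T ρ q D m) :
    ∀ᵐ t ∂(volume.restrict (Ioo 0 T)), ∫ x, nullForm κ ρ q r y u Q U P V t x = 0 := by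
  have a1 : ∀ j k, XD T j (fun t x => u t x k * gradMultX κ r y Q j k t x)
      (fun t x => U k j t x * gradMultX κ r y Q j k t x +
        u t x k * gradMultXX κ r y Q P j k j t x) := fun j k =>
    (S.u_x k j).mul (S.G_xx hT hδ hκ j k j)
  have a2 : ∀ j k, XD T k (fun t x => U k j t x * gradMult κ r y j t x)
      (fun t x => V k j k t x * gradMult κ r y j t x +
        U k j t x * gradMultX κ r y Q j k t x) := fun j k =>
    (S.U_x k j k).mul (S.G_x hT hδ hκ j k)
  have a3 : ∀ j k, XD T k (gradMult κ r y j) (gradMultX κ r y Q j k) := fun j k =>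
    S.G_x hT hδ hκ j k
  have a4 : ∀ j k l, XD T l (gradMultX κ r y Q j k) (gradMultXX κ r y Q P j k l) := fun j k l =>
    S.G_xx hT hδ hκ j k l
  have all2 : ∀ {P : Fin d → Fin d → ℝ → Prop},
      (∀ j k, ∀ᵐ t ∂(volume.restrict (Ioo 0 T)), P j k t) →
      ∀ᵐ t ∂(volume.restrict (Ioo 0 T)), ∀ j k, P j k t := fun hP =>
    ae_all_iff.2 fun j => ae_all_iff.2 fun k => hP j k
  filter_upwards [ae_restrict_mem measurableSet_Ioo, all2 fun j k => (a1 j k).wkD,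
    all2 fun j k => (a1 j k).bdd_f.ae_essBdd, all2 fun j k => (a1 j k).bdd_g.ae_essBdd,
    all2 fun j k => (a2 j k).wkD, all2 fun j k => (a2 j k).bdd_f.ae_essBdd,
    all2 fun j k => (a2 j k).bdd_g.ae_essBdd, all2 fun j k => (a3 j k).wkD,
    all2 fun j k => (a4 j k j).wkD, all2 fun j k => (a4 j j k).wkD,
    all2 fun k j => (S.u_x k j).wkD, all2 fun k j => (S.U_x k j k).wkD,
    all2 fun k j => (S.U_x k k j).wkD]
    with t ht b1 b2 b3 c1 c2 c3 w1 w2 w3 v1 v2 v3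
  have ht' := Ioo_subset_Icc_self ht
  have hf : ∀ j, WkD j (fun x => ρ t x + -1 * r t x) (fun x => q t x j + -1 * y t x j) := fun j =>
    ((hw.grad t ht').wkD j).add ((S.grad t ht' j).const_mul (-1))
  have e1 := fun j k => (hf j).integral_mul (b2 j k) (b3 j k) (b1 j k)
  have e2 := fun j k => (hf k).integral_mul (c2 j k) (c3 j k) (c1 j k)
  have i1 := fun j k => (b3 j k).integrable_mul (hf j).int_f
  have i2 := fun j k => (c3 j k).integrable_mul (hf k).int_f
  have i3 := fun j k => (b2 j k).integrable_mul (hf j).int_g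
  have i4 := fun j k => (c2 j k).integrable_mul (hf k).int_g
  -- For fixed `j`, `k`, this is `∂_j((ρ-r) u_k ∂_k G_j) - ∂_k((ρ-r) ∂_j u_k G_j)` written out. Each
  -- of the two derivatives has zero integral, by integration by parts for the weak gradient of `ρ -
  -- r`.
  set N : Fin d → Fin d → Torus d → ℝ := fun j k x =>
    (ρ t x + -1 * r t x) * (U k j t x * gradMultX κ r y Q j k t x +
      u t x k * gradMultXX κ r y Q P j k j t x) -
    (ρ t x + -1 * r t x) * (V k j k t x * gradMult κ r y j t x +
      U k j t x * gradMultX κ r y Q j k t x) +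
    ((q t x j + -1 * y t x j) * (u t x k * gradMultX κ r y Q j k t x) -
      (q t x k + -1 * y t x k) * (U k j t x * gradMult κ r y j t x)) with hN
  have iN : ∀ j k, Integrable (N j k) := fun j k =>
    ((i1 j k).sub (i2 j k)).add ((i3 j k).sub (i4 j k))
  have zN : ∀ j k, ∫ x, N j k x = 0 := fun j k => by
    have i34 : Integrable fun x =>
        (q t x j + -1 * y t x j) * (u t x k * gradMultX κ r y Q j k t x) -
          (q t x k + -1 * y t x k) * (U k j t x * gradMult κ r y j t x) := (i3 j k).sub (i4 j k)
    rw [hN]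
    simp only
    rw [integral_sub_add (i1 j k) (i2 j k) i34, integral_sub (i3 j k) (i4 j k), e1, e2]
    ring
  have hcomm : ∀ᵐ x, ∀ j k, gradMultXX κ r y Q P j k j t x = gradMultXX κ r y Q P j j k t x ∧
      V k j k t x = V k k j t x := by
    refine ae_all_iff.2 fun j => ae_all_iff.2 fun k => ?_
    exact ((w1 j k).comm (w2 j k) (w1 j j) (w3 j k)).and ((v1 k j).comm (v2 k j) (v1 k k) (v3 k j))
  have : ∫ x, nullForm κ ρ q r y u Q U P V t x = ∫ x, ∑ j, ∑ k, N j k x := by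
    refine integral_congr_ae ?_
    filter_upwards [hcomm] with x hx
    have s : ∀ j k, N j k x = (ρ t x - r t x) * (u t x k * gradMultXX κ r y Q P j j k t x -
        V k k j t x * gradMult κ r y j t x) +
        ((q t x j - y t x j) * (u t x k * gradMultX κ r y Q j k t x) -
          (q t x k - y t x k) * (U k j t x * gradMult κ r y j t x)) := fun j k => by
      rw [hN]
      simp only
      rw [(hx j k).1, (hx j k).2]
      ring
    simp only [s, Finset.sum_add_distrib, Finset.sum_sub_distrib, nullForm, ← Finset.mul_sum]
    rw [Finset.sum_comm (f := fun j k => (q t x k - y t x k) * (U k j t x * gradMult κ r y j t x)),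
      Finset.sum_comm (f := fun j k => u t x k * gradMultXX κ r y Q P j j k t x)]
    simp only [gradDiv, Finset.sum_mul, mul_sub, Finset.mul_sum, Finset.sum_sub_distrib]
  rw [this, integral_finsetSum _ fun j _ => integrable_finsetSum _ fun k _ => iN j k]
  refine Finset.sum_eq_zero fun j _ => ?_
  rw [integral_finsetSum _ fun k _ => iN j k]
  exact Finset.sum_eq_zero fun k _ => zN j k

lemma integrable_nullForm (S : StrongFields T δ R L r (fun i t x => y t x i) (fun i t x => u t x i)
    rt yt ut Q U P V) (hT : 0 < T) (hδ : 0 < δ) (hκ : ContDiffOn ℝ ∞ κ (Ioi 0))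
    (hw : IsWeakSolution h κ T ρ q D m)
    (iq : ∀ i, Integrable (Function.uncurry fun t x => q t x i) (slab d T)) :
    Integrable (Function.uncurry (nullForm κ ρ q r y u Q U P V)) (slab d T) := by
  have iρ := hw.continuous_ρ.integrable_slab hw.measurable_ρ
  have bG : ∀ j, SlabBdd T (gradMult κ r y j) := fun j => (S.G_x hT hδ hκ j j).bdd_f
  have bX : ∀ j k, SlabBdd T (gradMultX κ r y Q j k) := fun j k => (S.G_x hT hδ hκ j k).bdd_g
  have bY : ∀ j k l, SlabBdd T (gradMultXX κ r y Q P j k l) := fun j k l =>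
    (S.G_xx hT hδ hκ j k l).bdd_g
  have b1 : SlabBdd T (fun t x => (∑ k, u t x k * ∑ j, gradMultXX κ r y Q P j j k t x) +
      -1 * ∑ j, gradDiv V j t x * gradMult κ r y j t x) :=
    (SlabBdd.sum _ fun k => (S.u_t k).bdd_f.mul (SlabBdd.sum _ fun j => bY j j k)).add
      ((SlabBdd.sum _ fun j =>
        (SlabBdd.sum Finset.univ fun l => (S.U_x l l j).bdd_g).mul (bG j)).const_mul (-1))
  have b2 : ∀ j, SlabBdd T (fun t x => ∑ k, (u t x k * gradMultX κ r y Q j k t x +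
      -1 * (U j k t x * gradMult κ r y k t x))) := fun j =>
    SlabBdd.sum _ fun k => ((S.u_t k).bdd_f.mul (bX j k)).add
      (((S.U_x j k k).bdd_f.mul (bG k)).const_mul (-1))
  simp only [neg_one_mul, ← sub_eq_add_neg] at b1 b2
  exact (b1.mul_integrable (g := fun t x => ρ t x - r t x) (iρ.sub S.r_t.bdd_f.integrable)).add
    (integrable_finsetSum _ fun j _ => (b2 j).mul_integrable (g := fun t x => q t x j - y t x j)
      ((iq j).sub (S.q_t j).bdd_f.integrable))

/-- The evolution of the difference of the pairings of a weak solution and of the strong solution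
with the multipliers. -/
theorem relative_evolution (S : StrongFields T δ R L r (fun i t x => y t x i)
    (fun i t x => u t x i) rt yt ut Q U P V) (hT : 0 < T) (hδ : 0 < δ)
    (hh : ContDiffOn ℝ ∞ h (Ioi 0)) (hκ : ContDiffOn ℝ ∞ κ (Ioi 0))
    (hw : IsWeakSolution h κ T r y D' (momentum r u)) (hw' : IsWeakSolution h κ T ρ q D m)
    (hρ : ∀ᵐ z ∂(slab d T), 0 < ρ z.1 z.2)
    (iq : ∀ i, Integrable (Function.uncurry fun t x => q t x i) (slab d T)) :
    Integrable (Function.uncurry fun t x => relRate h κ (ρ t x) (r t x) (q t x) (y t x) (m t x)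
      (u t x) (fun i j => U i j t x) (fun k => gradDiv V k t x)) (slab d T) ∧
    ∀ t ∈ Icc 0 T,
      ((∫ x, coupling ρ q m (fun i t x => u t x i) (densityMult h κ r y u) (gradMult κ r y) t x) -
        ∫ x, coupling r y (momentum r u) (fun i t x => u t x i) (densityMult h κ r y u)
          (gradMult κ r y) t x) -
      ((∫ x, coupling ρ q m (fun i t x => u t x i) (densityMult h κ r y u) (gradMult κ r y) 0 x) -
        ∫ x, coupling r y (momentum r u) (fun i t x => u t x i) (densityMult h κ r y u)
          (gradMult κ r y) 0 x) =
      ∫ s in (0 : ℝ)..t, ∫ x, relRate h κ (ρ s x) (r s x) (q s x) (y s x) (m s x) (u s x)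
        (fun i j => U i j s x) (fun k => gradDiv V k s x) := by
  have M := S.multiplier hT hδ hh hκ
  have iy : ∀ i, Integrable (Function.uncurry fun t x => y t x i) (slab d T) := fun i =>
    (S.q_t i).bdd_f.integrable
  have j1 := M.integrable_couplingRate hw' iq
  have j2 := M.integrable_couplingRate hw iy
  have j3 := S.integrable_nullForm hT hδ hκ hw' iq
  have alg := S.rate_algebra (q := q) (m := m) hT hδ hh hκ hw hρ
  refine ⟨((j1.sub j2).add j3).congr alg, fun t ht => ?_⟩
  have e1 := M.evolution hT hw' iq ht
  have e2 := M.evolution hT hw iy ht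
  rw [sub_sub_sub_comm, e1, e2, ← intervalIntegral.integral_sub
    (intervalIntegrable_of_Ioo (slab_integrableOn j1) ht)
    (intervalIntegrable_of_Ioo (slab_integrableOn j2) ht)]
  refine intervalIntegral_congr_Ioo ?_ ht
  filter_upwards [S.integral_nullForm hT hδ hκ hw', slab_integrable j1, slab_integrable j2,
    slab_integrable j3, Measure.ae_ae_of_ae_prod alg] with s z k1 k2 k3 ha
  rw [← add_zero (_ - _), ← z, ← integral_sub_add k1 k2 k3]
  exact integral_congr_ae ha

end StrongFields

end

section

/-! ### Pointwise bounds -/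

lemma exists_taylor_bound {G : ℝ → ℝ} (hG : ContDiffOn ℝ ∞ G (Ioi 0)) {a b : ℝ} (ha : 0 < a) :
    ∃ K, 0 ≤ K ∧ ∀ s ∈ Icc a b, ∀ r ∈ Icc a b, |G s| ≤ K ∧ |G s - G r| ≤ K * |s - r| ∧
      |G s - G r - deriv G r * (s - r)| ≤ K * |s - r| ^ 2 := by
  have hG1 := contDiffOn_deriv hG
  have hG2 := contDiffOn_deriv hG1
  obtain ⟨K0, h0⟩ := isCompact_Icc.exists_bound_of_continuousOn
    (continuousOn_Icc_of_contDiffOn hG (R := b) ha)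
  obtain ⟨K1, h1⟩ := isCompact_Icc.exists_bound_of_continuousOn
    (continuousOn_Icc_of_contDiffOn hG1 (R := b) ha)
  obtain ⟨K2, h2⟩ := isCompact_Icc.exists_bound_of_continuousOn
    (continuousOn_Icc_of_contDiffOn hG2 (R := b) ha)
  refine ⟨|K0| + |K1| + |K2|, by positivity, fun s hs r hr => ?_⟩
  have hK0 := le_abs_self K0
  have hK1 := le_abs_self K1
  have hK2 := le_abs_self K2
  have n0 := abs_nonneg K0
  have n1 := abs_nonneg K1
  have n2 := abs_nonneg K2
  have lip1 : ∀ s ∈ Icc a b, ∀ r ∈ Icc a b, |deriv G s - deriv G r| ≤ K2 * |s - r| :=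
    fun s hs r hr => (convex_Icc a b).norm_image_sub_le_of_norm_hasDerivWithin_le
      (fun x hx => (hasDerivAt_of_contDiffOn hG1 (ha.trans_le hx.1)).hasDerivWithinAt) h2 hr hs
  refine ⟨(h0 s hs).trans (by linarith), ?_, ?_⟩
  · have := (convex_Icc a b).norm_image_sub_le_of_norm_hasDerivWithin_le
      (fun x hx => (hasDerivAt_of_contDiffOn hG (ha.trans_le hx.1)).hasDerivWithinAt) h1 hr hs
    exact this.trans (mul_le_mul_of_nonneg_right (by linarith) (abs_nonneg _))
  · have hsub : uIcc r s ⊆ Icc a b := (convex_Icc a b).ordConnected.uIcc_subset hr hs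
    -- The mean value inequality is applied to `G` minus its linear part at `r`. Working on the
    -- segment between `r` and `s` bounds the derivative by the Lipschitz constant of `G'` times `|s
    -- - r|`, hence the square.
    have := (convex_uIcc r s).norm_image_sub_le_of_norm_hasDerivWithin_le
      (f := fun x => G x - deriv G r * x) (f' := fun x => deriv G x - deriv G r * 1)
      (C := |K2| * |s - r|)
      (fun x hx => ((hasDerivAt_of_contDiffOn hG (ha.trans_le (hsub hx).1)).sub
        ((hasDerivAt_id x).const_mul _)).hasDerivWithinAt)
      (fun x hx => by
        rw [mul_one]
        refine (lip1 x (hsub hx) r hr).trans ?_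
        exact mul_le_mul hK2 (abs_sub_left_of_mem_uIcc hx) (abs_nonneg _) n2)
      left_mem_uIcc right_mem_uIcc
    rw [Real.norm_eq_abs, Real.norm_eq_abs] at this
    calc |G s - G r - deriv G r * (s - r)| = |G s - deriv G r * s - (G r - deriv G r * r)| := by
          congr 1; ring
      _ ≤ |K2| * |s - r| * |s - r| := this
      _ ≤ _ := by
        rw [mul_assoc, ← sq]
        exact mul_le_mul_of_nonneg_right (by linarith) (by positivity)

/-- Two monotonicity steps: `φ1 - cτ` is nondecreasing, hence so is `φ - φ1(0)τ - cτ²/2`. -/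
lemma taylor_lower_bound {φ φ1 φ2 : ℝ → ℝ} {c : ℝ} (h1 : ∀ τ ∈ Icc (0 : ℝ) 1, HasDerivAt φ (φ1 τ) τ)
    (h2 : ∀ τ ∈ Icc (0 : ℝ) 1, HasDerivAt φ1 (φ2 τ) τ) (h : ∀ τ ∈ Icc (0 : ℝ) 1, c ≤ φ2 τ) :
    c / 2 ≤ φ 1 - φ 0 - φ1 0 := by
  have mono : ∀ {f f' : ℝ → ℝ}, (∀ τ ∈ Icc (0 : ℝ) 1, HasDerivAt f (f' τ) τ) →
      (∀ τ ∈ Icc (0 : ℝ) 1, 0 ≤ f' τ) → MonotoneOn f (Icc 0 1) := fun {f f'} hf hf' => by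
    refine monotoneOn_of_deriv_nonneg (convex_Icc 0 1)
      (fun τ hτ => (hf τ hτ).continuousAt.continuousWithinAt) (fun τ hτ => ?_) fun τ hτ => ?_
    · exact (hf τ (interior_subset hτ)).differentiableAt.differentiableWithinAt
    · rw [(hf τ (interior_subset hτ)).deriv]
      exact hf' τ (interior_subset hτ)
  have m1 : MonotoneOn (fun τ => φ1 τ - c * τ) (Icc 0 1) :=
    mono (f' := fun τ => φ2 τ - c * 1) (fun τ hτ => (h2 τ hτ).sub ((hasDerivAt_id τ).const_mul c))
      fun τ hτ => by linarith [h τ hτ]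
  have m2 : MonotoneOn (fun τ => φ τ - (φ1 0 * τ + c / 2 * τ ^ 2)) (Icc 0 1) := by
    refine mono (f' := fun τ => φ1 τ - (φ1 0 * 1 + c / 2 * (2 * τ))) (fun τ hτ => ?_)
      fun τ hτ => ?_
    · refine (h1 τ hτ).sub (((hasDerivAt_id τ).const_mul _).add ?_)
      simpa using ((hasDerivAt_pow 2 τ).const_mul (c / 2))
    · have := m1 (left_mem_Icc.2 zero_le_one) hτ hτ.1
      simp only at this
      linarith
  have := m2 (left_mem_Icc.2 zero_le_one) (right_mem_Icc.2 zero_le_one) zero_le_one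
  simp only at this
  linarith

/-- The linearization remainder of `F` at `(r, y)`. -/
def relF (h κ : ℝ → ℝ) (ρ r : ℝ) (q y : Vec d) : ℝ :=
  energyF h κ ρ q - energyF h κ r y -
    ((deriv h r + 1 / 2 * deriv κ r * ∑ k, y k ^ 2) * (ρ - r) + κ r * ∑ k, y k * (q k - y k))

/-- Taylor's formula along the segment from `(r, y)` to `(ρ, q)`, which stays in the convex domain
of positive densities. The second derivative is bounded below by completing a square, and the second
hypothesis on `κ` states exactly that the resulting loss `2κ'²/κ''` leaves a multiple of the
gradient term. -/
lemma relF_lower {h κ : ℝ → ℝ} (hh : ContDiffOn ℝ ∞ h (Ioi 0)) (hκ : ContDiffOn ℝ ∞ κ (Ioi 0))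
    (hκ2 : ∀ r > 0, 0 < deriv (deriv κ) r) {α β : ℝ} (hα : ∀ r > 0, α ≤ deriv (deriv h) r)
    (hβ : ∀ r > 0, β ≤ κ r - 2 * (deriv κ r) ^ 2 / deriv (deriv κ) r) {ρ r : ℝ} (hρ : 0 < ρ)
    (hr : 0 < r) (q y : Vec d) :
    (α * (ρ - r) ^ 2 + β * ∑ k, (q k - y k) ^ 2) / 2 ≤ relF h κ ρ r q y := by
  set f := ρ - r with hf
  set G := ∑ k, (q k - y k) ^ 2 with hG
  set M := ∑ k, y k * (q k - y k) with hM
  set N := ∑ k, y k ^ 2 with hN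
  have pos : ∀ τ ∈ Icc (0 : ℝ) 1, 0 < r + τ * f := fun τ hτ => by
    have : r + τ * f = (1 - τ) * r + τ * ρ := by rw [hf]; ring
    rw [this]
    rcases hτ.1.eq_or_lt with h0 | h0
    · simp [← h0, hr]
    · have := mul_pos h0 hρ
      have := mul_nonneg (sub_nonneg.2 hτ.2) hr.le
      linarith
  have lin : ∀ τ, HasDerivAt (fun τ => r + τ * f) f τ := fun τ => by
    simpa using ((hasDerivAt_id τ).mul_const f).const_add r
  have ch : ∀ {g : ℝ → ℝ}, ContDiffOn ℝ ∞ g (Ioi 0) → ∀ τ ∈ Icc (0 : ℝ) 1,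
      HasDerivAt (fun τ => g (r + τ * f)) (deriv g (r + τ * f) * f) τ := fun hg τ hτ =>
    (hasDerivAt_of_contDiffOn hg (pos τ hτ)).comp τ (lin τ)
  have dA : ∀ τ : ℝ, HasDerivAt (fun τ => N + 2 * τ * M + τ ^ 2 * G) (2 * (M + τ * G)) τ :=
    fun τ => by
      have e1 : HasDerivAt (fun τ : ℝ => 2 * τ * M) (2 * 1 * M) τ :=
        ((hasDerivAt_id τ).const_mul 2).mul_const M
      have e2 : HasDerivAt (fun τ : ℝ => τ ^ 2 * G) (2 * τ * G) τ := by
        simpa using (hasDerivAt_pow 2 τ).mul_const G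
      exact ((e1.const_add N).add e2).congr_deriv (by ring)
  have dB : ∀ τ : ℝ, HasDerivAt (fun τ => M + τ * G) G τ := fun τ => by
    simpa using ((hasDerivAt_id τ).mul_const G).const_add M
  have key := taylor_lower_bound (c := α * f ^ 2 + β * G)
    (φ := fun τ => h (r + τ * f) + 1 / 2 * κ (r + τ * f) * (N + 2 * τ * M + τ ^ 2 * G))
    (φ1 := fun τ => deriv h (r + τ * f) * f +
      (1 / 2 * (deriv κ (r + τ * f) * f) * (N + 2 * τ * M + τ ^ 2 * G) +
        1 / 2 * κ (r + τ * f) * (2 * (M + τ * G))))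
    (φ2 := fun τ => deriv (deriv h) (r + τ * f) * f * f +
      ((1 / 2 * (deriv (deriv κ) (r + τ * f) * f * f) * (N + 2 * τ * M + τ ^ 2 * G) +
        1 / 2 * (deriv κ (r + τ * f) * f) * (2 * (M + τ * G))) +
      (1 / 2 * (deriv κ (r + τ * f) * f) * (2 * (M + τ * G)) +
        1 / 2 * κ (r + τ * f) * (2 * G))))
    (fun τ hτ => (ch hh τ hτ).add (((ch hκ τ hτ).const_mul (1 / 2)).mul (dA τ)))
    (fun τ hτ => ((ch (contDiffOn_deriv hh) τ hτ).mul_const f).add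
      (((((ch (contDiffOn_deriv hκ) τ hτ).mul_const f).const_mul (1 / 2)).mul (dA τ)).add
        (((ch hκ τ hτ).const_mul (1 / 2)).mul ((dB τ).const_mul 2))))
    (fun τ hτ => ?_)
  · refine key.trans (le_of_eq ?_)
    have eq : ∑ k, q k ^ 2 = N + 2 * M + G := by
      rw [hN, hM, hG, Finset.mul_sum, ← Finset.sum_add_distrib, ← Finset.sum_add_distrib]
      exact Finset.sum_congr rfl fun k _ => by ring
    have er : r + f = ρ := by rw [hf]; ring
    simp only [relF, energyF, sum_sq, eq, one_mul, zero_mul, add_zero, er, ← hN, ← hM]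
    rw [hf]
    ring
  · have hs := pos τ hτ
    set s := r + τ * f with hsd
    have k2 := hκ2 s hs
    -- Divided by `2κ''`, this square accounts for the term in `κ''`, the mixed term, and `2κ'²/κ''`
    -- times `G`.
    have sq : ∑ k, (deriv (deriv κ) s * f * (y k + τ * (q k - y k)) +
        2 * deriv κ s * (q k - y k)) ^ 2 = (deriv (deriv κ) s * f) ^ 2 *
        (N + 2 * τ * M + τ ^ 2 * G) + 4 * deriv (deriv κ) s * deriv κ s * f * (M + τ * G) +
        4 * deriv κ s ^ 2 * G := by
      rw [hN, hM, hG]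
      simp only [Finset.mul_sum, ← Finset.sum_add_distrib]
      exact Finset.sum_congr rfl fun k _ => by ring
    have sq0 : 0 ≤ ∑ k, (deriv (deriv κ) s * f * (y k + τ * (q k - y k)) +
        2 * deriv κ s * (q k - y k)) ^ 2 := Finset.sum_nonneg fun k _ => sq_nonneg _
    rw [sq] at sq0
    have G0 : 0 ≤ G := Finset.sum_nonneg fun k _ => sq_nonneg _
    have a1 := mul_le_mul_of_nonneg_right (hα s hs) (sq_nonneg f)
    have a2 := mul_le_mul_of_nonneg_right (hβ s hs) G0
    have a3 := div_nonneg sq0 (mul_pos two_pos k2).le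
    have a4 : ((deriv (deriv κ) s * f) ^ 2 * (N + 2 * τ * M + τ ^ 2 * G) +
        4 * deriv (deriv κ) s * deriv κ s * f * (M + τ * G) + 4 * deriv κ s ^ 2 * G) /
        (2 * deriv (deriv κ) s) = 1 / 2 * (deriv (deriv κ) s * f * f) *
          (N + 2 * τ * M + τ ^ 2 * G) + 2 * (deriv κ s * f) * (M + τ * G) +
          2 * deriv κ s ^ 2 / deriv (deriv κ) s * G := by
      field_simp
      ring
    rw [a4] at a3
    linarith

lemma abs_sum_mul_le_sq {f K : ℝ} {y g : Fin d → ℝ} (hy : ∀ i, |y i| ≤ K) :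
    |f| * |∑ i, y i * g i| ≤ d * K * (f ^ 2 + ∑ i, g i ^ 2) := by
  have : |f| * |∑ i, y i * g i| ≤ ∑ i, |f| * (K * |g i|) := by
    rw [← Finset.mul_sum]
    refine mul_le_mul_of_nonneg_left ((Finset.abs_sum_le_sum_abs _ _).trans
      (Finset.sum_le_sum fun i _ => ?_)) (abs_nonneg _)
    rw [abs_mul]
    exact mul_le_mul_of_nonneg_right (hy i) (abs_nonneg _)
  refine this.trans ?_
  have e : ∀ i ∈ Finset.univ, |f| * (K * |g i|) ≤ K * (f ^ 2 + ∑ i, g i ^ 2) := fun i hi => by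
    have hK := (abs_nonneg _).trans (hy i)
    have h1 := Finset.single_le_sum (f := fun i => g i ^ 2) (fun j _ => sq_nonneg _) hi
    have h2 : |f| * |g i| ≤ f ^ 2 + ∑ i, g i ^ 2 := by
      nlinarith [sq_nonneg (|f| - |g i|), sq_abs f, sq_abs (g i), sq_nonneg f, sq_nonneg (g i)]
    calc |f| * (K * |g i|) = K * (|f| * |g i|) := by ring
      _ ≤ _ := mul_le_mul_of_nonneg_left h2 hK
  refine (Finset.sum_le_card_nsmul _ _ _ e).trans (le_of_eq ?_)
  simp [mul_assoc]

/-- The linearization remainder of `½ A(ρ) |q|²` is quadratic. -/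
lemma exists_quadratic_bound {A : ℝ → ℝ} (hA : ContDiffOn ℝ ∞ A (Ioi 0)) {a b : ℝ} (ha : 0 < a)
    (d : ℕ) {L : ℝ} (hL : 0 ≤ L) :
    ∃ K, 0 ≤ K ∧ ∀ ρ ∈ Icc a b, ∀ r ∈ Icc a b, ∀ q y : Fin d → ℝ, (∀ i, |y i| ≤ L) →
      |1 / 2 * A ρ * (∑ k, q k ^ 2) - 1 / 2 * A r * (∑ k, y k ^ 2) -
        (1 / 2 * deriv A r * (∑ k, y k ^ 2) * (ρ - r) + A r * ∑ k, y k * (q k - y k))| ≤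
        K * ((ρ - r) ^ 2 + ∑ k, (q k - y k) ^ 2) := by
  obtain ⟨K, hK, hKb⟩ := exists_taylor_bound hA (b := b) ha
  refine ⟨K * (d * L ^ 2) + K * (d * L) + K, by positivity, fun ρ hρ r hr q y hy => ?_⟩
  obtain ⟨b0, b1, b2⟩ := hKb ρ hρ r hr
  set G := ∑ k, (q k - y k) ^ 2 with hG
  have G0 : 0 ≤ G := Finset.sum_nonneg fun k _ => sq_nonneg _
  have N0 : 0 ≤ ∑ k, y k ^ 2 := Finset.sum_nonneg fun k _ => sq_nonneg _
  have N1 : ∑ k, y k ^ 2 ≤ d * L ^ 2 := by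
    refine (Finset.sum_le_card_nsmul _ _ (L ^ 2) fun k _ => ?_).trans (le_of_eq (by simp))
    rw [← sq_abs]
    exact pow_le_pow_left₀ (abs_nonneg _) (hy k) 2
  have c := abs_sum_mul_le_sq (f := ρ - r) (g := fun k => q k - y k) hy
  rw [← hG] at c
  have eq : ∑ k, q k ^ 2 = (∑ k, y k ^ 2) + 2 * (∑ k, y k * (q k - y k)) + G := by
    rw [hG, Finset.mul_sum, ← Finset.sum_add_distrib, ← Finset.sum_add_distrib]
    exact Finset.sum_congr rfl fun k _ => by ring
  -- Only the dependence on the density is expanded by Taylor's formula; that on `q` is exactly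
  -- quadratic. The coefficients involve `y` and densities in a compact interval, so no bound on `q`
  -- is needed.
  have e : 1 / 2 * A ρ * (∑ k, q k ^ 2) - 1 / 2 * A r * (∑ k, y k ^ 2) -
      (1 / 2 * deriv A r * (∑ k, y k ^ 2) * (ρ - r) + A r * ∑ k, y k * (q k - y k)) =
      1 / 2 * (A ρ - A r - deriv A r * (ρ - r)) * (∑ k, y k ^ 2) +
        (A ρ - A r) * (∑ k, y k * (q k - y k)) + 1 / 2 * A ρ * G := by
    rw [eq]; ring
  rw [e]
  rw [sq_abs] at b2
  have t1 : |1 / 2 * (A ρ - A r - deriv A r * (ρ - r)) * (∑ k, y k ^ 2)| ≤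
      K * (ρ - r) ^ 2 * (d * L ^ 2) := by
    rw [abs_mul, abs_mul, abs_of_nonneg N0]
    have : |(1 : ℝ) / 2| = 1 / 2 := abs_of_pos (by norm_num)
    rw [this]
    refine mul_le_mul ?_ N1 N0 (by positivity)
    have := abs_nonneg (A ρ - A r - deriv A r * (ρ - r))
    linarith
  have t2 : |(A ρ - A r) * (∑ k, y k * (q k - y k))| ≤
      K * (d * L * ((ρ - r) ^ 2 + G)) := by
    rw [abs_mul]
    refine (mul_le_mul_of_nonneg_right b1 (abs_nonneg _)).trans ?_
    rw [mul_assoc]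
    exact mul_le_mul_of_nonneg_left c hK
  have t3 : |1 / 2 * A ρ * G| ≤ K * G := by
    rw [abs_mul, abs_of_nonneg G0]
    refine mul_le_mul_of_nonneg_right ?_ G0
    rw [abs_mul, abs_of_pos (by norm_num : (0 : ℝ) < 1 / 2)]
    have := abs_nonneg (A ρ)
    linarith
  refine (abs_add_le _ _).trans ((add_le_add ((abs_add_le _ _).trans (add_le_add t1 t2)) t3).trans ?_)
  have : 0 ≤ K * (d * L ^ 2) * G := by positivity
  have : 0 ≤ K * (ρ - r) ^ 2 := by positivity
  linarith

end

/-! ### The relative energy density and its pointwise bounds -/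

section

/-- The integrand of `Φ` at a point. -/
def relDensity (ρ r : ℝ) (q y m u : Vec d) : ℝ :=
  1 / 2 * ρ * ‖ρ⁻¹ • m - u‖ ^ 2 + |ρ - r| ^ 2 + ‖q - y‖ ^ 2

/-- The relative energy density. -/
def relEnergy (h κ : ℝ → ℝ) (ρ r : ℝ) (q y m u : Vec d) : ℝ :=
  1 / 2 * ρ * ‖ρ⁻¹ • m - u‖ ^ 2 + relF h κ ρ r q y

lemma sum_sq_velocity (ρ : ℝ) (m u : Vec d) :
    ‖ρ⁻¹ • m - u‖ ^ 2 = ∑ i, (m i / ρ - u i) ^ 2 := by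
  rw [sum_sq]
  exact Finset.sum_congr rfl fun i _ => by
    simp only [PiLp.sub_apply, PiLp.smul_apply, smul_eq_mul, div_eq_inv_mul]

lemma sum_sq_sub (q y : Vec d) : ‖q - y‖ ^ 2 = ∑ i, (q i - y i) ^ 2 := by
  rw [sum_sq]
  exact Finset.sum_congr rfl fun i _ => by simp only [PiLp.sub_apply]

/-- The relative energy is the total energy minus its first-order Taylor polynomial at `(r, ru, y)`.
The derivatives of the energy there are precisely the multipliers, so the subtracted terms are
differences of couplings. -/
lemma relEnergy_eq (h κ : ℝ → ℝ) {ρ r : ℝ} (hρ : ρ ≠ 0) (hr : r ≠ 0) (q y m u : Vec d) :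
    relEnergy h κ ρ r q y m u = totalEnergy h κ ρ q m - totalEnergy h κ r y (r • u) -
      (((∑ i, m i * u i) + ρ * (deriv h r + 1 / 2 * deriv κ r * (∑ k, y k ^ 2) -
        1 / 2 * ∑ k, u k ^ 2) + ∑ i, q i * (κ r * y i)) -
      ((∑ i, (r • u) i * u i) + r * (deriv h r + 1 / 2 * deriv κ r * (∑ k, y k ^ 2) -
        1 / 2 * ∑ k, u k ^ 2) + ∑ i, y i * (κ r * y i))) := by
  have e1 : 1 / 2 * ρ * ∑ i, (m i / ρ - u i) ^ 2 =
      1 / 2 * ((∑ i, m i ^ 2) / ρ) - (∑ i, m i * u i) + 1 / 2 * ρ * ∑ i, u i ^ 2 := by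
    simp only [Finset.mul_sum, Finset.sum_div, ← Finset.sum_add_distrib, ← Finset.sum_sub_distrib]
    exact Finset.sum_congr rfl fun i _ => by field_simp; ring
  have e2 : ∑ i, (r • u) i * u i = r * ∑ i, u i ^ 2 := by
    rw [Finset.mul_sum]
    exact Finset.sum_congr rfl fun i _ => by simp only [PiLp.smul_apply, smul_eq_mul]; ring
  have e3 : ‖r • u‖ ^ 2 / r = r * ∑ i, u i ^ 2 := by
    rw [norm_smul, mul_pow, sum_sq, Real.norm_eq_abs, sq_abs]
    field_simp
  have e4 : κ r * ∑ k, y k * (q k - y k) =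
      (∑ i, q i * (κ r * y i)) - ∑ i, y i * (κ r * y i) := by
    rw [Finset.mul_sum, ← Finset.sum_sub_distrib]
    exact Finset.sum_congr rfl fun i _ => by ring
  rw [relEnergy, relF, sum_sq_velocity, e1, e4, totalEnergy, totalEnergy, e3, e2, sum_sq m]
  ring

lemma exists_relF_upper {h κ : ℝ → ℝ} (hh : ContDiffOn ℝ ∞ h (Ioi 0))
    (hκ : ContDiffOn ℝ ∞ κ (Ioi 0)) {a b : ℝ} (ha : 0 < a) (d : ℕ) {L : ℝ} (hL : 0 ≤ L) :
    ∃ K, 0 ≤ K ∧ ∀ ρ ∈ Icc a b, ∀ r ∈ Icc a b, ∀ q y : Vec d, (∀ i, |y i| ≤ L) →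
      |relF h κ ρ r q y| ≤ K * ((ρ - r) ^ 2 + ∑ k, (q k - y k) ^ 2) := by
  obtain ⟨K1, hK1, b1⟩ := exists_taylor_bound hh (b := b) ha
  obtain ⟨K2, hK2, b2⟩ := exists_quadratic_bound hκ (b := b) ha d hL
  refine ⟨K1 + K2, by positivity, fun ρ hρ r hr q y hy => ?_⟩
  have t1 := (b1 ρ hρ r hr).2.2
  rw [sq_abs] at t1
  have t2 := b2 ρ hρ r hr q y hy
  have e : relF h κ ρ r q y = (h ρ - h r - deriv h r * (ρ - r)) +
      (1 / 2 * κ ρ * (∑ k, q k ^ 2) - 1 / 2 * κ r * (∑ k, y k ^ 2) -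
        (1 / 2 * deriv κ r * (∑ k, y k ^ 2) * (ρ - r) + κ r * ∑ k, y k * (q k - y k))) := by
    rw [relF, energyF, energyF, sum_sq, sum_sq]
    ring
  rw [e]
  refine (abs_add_le _ _).trans ((add_le_add t1 t2).trans ?_)
  have : 0 ≤ K1 * ∑ k, (q k - y k) ^ 2 :=
    mul_nonneg hK1 (Finset.sum_nonneg fun k _ => sq_nonneg _)
  linarith

/-- The scalar part splits into the pressure, whose derivative is `r h''`, and a term `½ A(ρ)|q|²`
with `A = ρκ' + κ`. A Taylor bound and the quadratic bound apply respectively. -/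
lemma exists_relScalar_bound {h κ : ℝ → ℝ} (hh : ContDiffOn ℝ ∞ h (Ioi 0))
    (hκ : ContDiffOn ℝ ∞ κ (Ioi 0)) {a b : ℝ} (ha : 0 < a) (d : ℕ) {L : ℝ} (hL : 0 ≤ L) :
    ∃ K, 0 ≤ K ∧ ∀ ρ ∈ Icc a b, ∀ r ∈ Icc a b, ∀ q y : Vec d, (∀ i, |y i| ≤ L) →
      |relScalar h κ ρ r q y| ≤ K * ((ρ - r) ^ 2 + ∑ k, (q k - y k) ^ 2) := by
  have cid : ContDiffOn ℝ ∞ (fun s : ℝ => s) (Ioi 0) := contDiffOn_id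
  obtain ⟨K1, hK1, b1⟩ := exists_taylor_bound (b := b)
    ((cid.mul (contDiffOn_deriv hh)).sub hh) ha
  obtain ⟨K2, hK2, b2⟩ := exists_quadratic_bound (b := b)
    ((cid.mul (contDiffOn_deriv hκ)).add hκ) ha d hL
  refine ⟨K1 + K2, by positivity, fun ρ hρ r hr q y hy => ?_⟩
  have hr0 : 0 < r := ha.trans_le hr.1
  have t1 := (b1 ρ hρ r hr).2.2
  rw [sq_abs] at t1
  have t2 := b2 ρ hρ r hr q y hy
  have d1 : deriv ((fun s => s * deriv h s) - h) r = r * deriv (deriv h) r := by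
    have := ((hasDerivAt_id r).mul (hasDerivAt_of_contDiffOn (contDiffOn_deriv hh) hr0)).sub
      (hasDerivAt_of_contDiffOn hh hr0)
    exact this.deriv.trans (by simp)
  have d2 : deriv ((fun s => s * deriv κ s) + κ) r = 2 * deriv κ r + r * deriv (deriv κ) r := by
    have := ((hasDerivAt_id r).mul (hasDerivAt_of_contDiffOn (contDiffOn_deriv hκ) hr0)).add
      (hasDerivAt_of_contDiffOn hκ hr0)
    exact this.deriv.trans (by simp; ring)
  have e : relScalar h κ ρ r q y = ((ρ * deriv h ρ - h ρ) - (r * deriv h r - h r) -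
      r * deriv (deriv h) r * (ρ - r)) +
      (1 / 2 * (ρ * deriv κ ρ + κ ρ) * (∑ k, q k ^ 2) -
        1 / 2 * (r * deriv κ r + κ r) * (∑ k, y k ^ 2) -
        (1 / 2 * (2 * deriv κ r + r * deriv (deriv κ) r) * (∑ k, y k ^ 2) * (ρ - r) +
          (r * deriv κ r + κ r) * ∑ k, y k * (q k - y k))) := by
    rw [relScalar, stressScalar, stressScalar, sum_sq, sum_sq]
    ring
  erw [d1] at t1
  erw [d2] at t2
  rw [e]
  refine (abs_add_le _ _).trans ((add_le_add t1 t2).trans ?_)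
  have : 0 ≤ K1 * ∑ k, (q k - y k) ^ 2 :=
    mul_nonneg hK1 (Finset.sum_nonneg fun k _ => sq_nonneg _)
  linarith

lemma abs_mul_abs_le {f : ℝ} {g : Fin d → ℝ} (i : Fin d) :
    |f| * |g i| ≤ f ^ 2 + ∑ i, g i ^ 2 := by
  have h1 := Finset.single_le_sum (f := fun i => g i ^ 2) (fun j _ => sq_nonneg _)
    (Finset.mem_univ i)
  nlinarith [sq_nonneg (|f| - |g i|), sq_abs f, sq_abs (g i), sq_nonneg f, sq_nonneg (g i)]

lemma abs_mul_abs_le_sum {g : Fin d → ℝ} (i j : Fin d) : |g i| * |g j| ≤ ∑ i, g i ^ 2 := by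
  have h1 := Finset.single_le_sum (f := fun i => g i ^ 2) (fun j _ => sq_nonneg _)
    (Finset.mem_univ i)
  have h2 := Finset.single_le_sum (f := fun i => g i ^ 2) (fun j _ => sq_nonneg _)
    (Finset.mem_univ j)
  nlinarith [sq_nonneg (|g i| - |g j|), sq_abs (g i), sq_abs (g j)]

lemma exists_relVector_bound {κ : ℝ → ℝ} (hκ : ContDiffOn ℝ ∞ κ (Ioi 0)) {a b : ℝ} (ha : 0 < a)
    (d : ℕ) {L : ℝ} (hL : 0 ≤ L) :
    ∃ K, 0 ≤ K ∧ ∀ ρ ∈ Icc a b, ∀ r ∈ Icc a b, ∀ q y : Vec d, (∀ i, |y i| ≤ L) → ∀ k,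
      |relVector κ ρ r q y k| ≤ K * ((ρ - r) ^ 2 + ∑ k, (q k - y k) ^ 2) := by
  have cid : ContDiffOn ℝ ∞ (fun s : ℝ => s) (Ioi 0) := contDiffOn_id
  obtain ⟨K, hK, hb⟩ := exists_taylor_bound (b := b) (cid.mul hκ) ha
  refine ⟨K * L + K, by positivity, fun ρ hρ r hr q y hy k => ?_⟩
  have hr0 : 0 < r := ha.trans_le hr.1
  obtain ⟨-, t1, t2⟩ := hb ρ hρ r hr
  rw [sq_abs] at t2
  have d1 : deriv (fun s => s * κ s) r = κ r + r * deriv κ r := by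
    have := (hasDerivAt_id r).mul (hasDerivAt_of_contDiffOn hκ hr0)
    exact this.deriv.trans (by simp)
  erw [d1] at t2
  -- The remainder splits into a second-order Taylor error times the bounded `y` and a first-order
  -- difference times `q - y`; both are quadratic.
  have e : relVector κ ρ r q y k = (ρ * κ ρ - r * κ r - (κ r + r * deriv κ r) * (ρ - r)) * y k +
      (ρ * κ ρ - r * κ r) * (q k - y k) := by
    simp only [relVector, stressVector, PiLp.smul_apply, smul_eq_mul]
    ring
  rw [e]
  refine (abs_add_le _ _).trans ?_
  rw [abs_mul, abs_mul]
  have c := abs_mul_abs_le (f := ρ - r) (g := fun k => q k - y k) k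
  have s1 := mul_le_mul t2 (hy k) (abs_nonneg _) (by positivity)
  have s2 := (mul_le_mul_of_nonneg_right t1 (abs_nonneg (q k - y k))).trans
    ((mul_assoc _ _ _).le.trans (mul_le_mul_of_nonneg_left c hK))
  refine (add_le_add s1 s2).trans ?_
  have : 0 ≤ K * L * ∑ k, (q k - y k) ^ 2 :=
    mul_nonneg (by positivity) (Finset.sum_nonneg fun k _ => sq_nonneg _)
  linarith

lemma exists_relTensor_bound {κ : ℝ → ℝ} (hκ : ContDiffOn ℝ ∞ κ (Ioi 0)) {a b : ℝ} (ha : 0 < a)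
    (d : ℕ) {L : ℝ} (hL : 0 ≤ L) :
    ∃ K, 0 ≤ K ∧ ∀ ρ ∈ Icc a b, ∀ r ∈ Icc a b, ∀ q y : Vec d, (∀ i, |y i| ≤ L) → ∀ i j,
      |relTensor κ ρ r q y i j| ≤ K * ((ρ - r) ^ 2 + ∑ k, (q k - y k) ^ 2) := by
  obtain ⟨K, hK, hb⟩ := exists_taylor_bound (b := b) hκ ha
  refine ⟨K * L ^ 2 + 2 * (K * L) + K, by positivity, fun ρ hρ r hr q y hy i j => ?_⟩
  obtain ⟨t0, t1, t2⟩ := hb ρ hρ r hr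
  rw [sq_abs] at t2
  -- The products of `y` with a Taylor remainder, of `y` with a density difference and a gradient
  -- difference, and of two gradient differences are separated; each is quadratic in the
  -- differences.
  have e : relTensor κ ρ r q y i j = (κ ρ - κ r - deriv κ r * (ρ - r)) * (y i * y j) +
      (κ ρ - κ r) * ((q j - y j) * y i + (q i - y i) * y j) +
      κ ρ * ((q i - y i) * (q j - y j)) := by
    simp only [relTensor, stressTensor]
    ring
  rw [e]
  have c := fun k => abs_mul_abs_le (f := ρ - r) (g := fun k => q k - y k) k
  have G0 : 0 ≤ ∑ k, (q k - y k) ^ 2 := Finset.sum_nonneg fun k _ => sq_nonneg _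
  have s1 : |(κ ρ - κ r - deriv κ r * (ρ - r)) * (y i * y j)| ≤ K * (ρ - r) ^ 2 * L ^ 2 := by
    rw [abs_mul, abs_mul, sq L]
    exact mul_le_mul t2 (mul_le_mul (hy i) (hy j) (abs_nonneg _) hL) (by positivity)
      (by positivity)
  have s2 : ∀ i j, |(κ ρ - κ r) * ((q j - y j) * y i)| ≤
      K * L * ((ρ - r) ^ 2 + ∑ k, (q k - y k) ^ 2) := fun i j => by
    rw [abs_mul, abs_mul]
    calc |κ ρ - κ r| * (|q j - y j| * |y i|) ≤ K * |ρ - r| * (|q j - y j| * L) :=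
          mul_le_mul t1 (mul_le_mul_of_nonneg_left (hy i) (abs_nonneg _)) (by positivity)
            (by positivity)
      _ = K * L * (|ρ - r| * |q j - y j|) := by ring
      _ ≤ _ := mul_le_mul_of_nonneg_left (c j) (by positivity)
  have s3 : |κ ρ * ((q i - y i) * (q j - y j))| ≤ K * ∑ k, (q k - y k) ^ 2 := by
    rw [abs_mul, abs_mul]
    exact mul_le_mul t0 (abs_mul_abs_le_sum (g := fun k => q k - y k) i j) (by positivity) hK
  rw [mul_add (κ ρ - κ r)]
  refine (abs_add_le _ _).trans ((add_le_add ((abs_add_le _ _).trans (add_le_add s1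
    ((abs_add_le _ _).trans (add_le_add (s2 i j) (s2 j i))))) s3).trans ?_)
  have : 0 ≤ K * L ^ 2 * ∑ k, (q k - y k) ^ 2 := by positivity
  have : 0 ≤ K * (ρ - r) ^ 2 := by positivity
  linarith

lemma abs_double_sum_le {w : Fin d → ℝ} {U : Fin d → Fin d → ℝ} {L : ℝ}
    (hU : ∀ i j, |U i j| ≤ L) :
    |∑ i, ∑ j, w i * w j * U i j| ≤ d * (d * (L * ∑ i, w i ^ 2)) := by
  refine (Finset.abs_sum_le_sum_abs _ _).trans ((Finset.sum_le_card_nsmul _ _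
    (d * (L * ∑ i, w i ^ 2)) fun i _ => (Finset.abs_sum_le_sum_abs _ _).trans
    ((Finset.sum_le_card_nsmul _ _ (L * ∑ i, w i ^ 2) fun j _ => ?_).trans
      (le_of_eq (by simp)))).trans (le_of_eq (by simp)))
  rw [abs_mul, abs_mul, mul_comm L]
  exact mul_le_mul (abs_mul_abs_le_sum i j) (hU i j) (abs_nonneg _)
    (Finset.sum_nonneg fun k _ => sq_nonneg _)

/-- The pointwise bounds behind the stability estimate. -/
theorem exists_pointwise_bounds {h κ : ℝ → ℝ} (hF : UniformConvexity h κ) {a b : ℝ} (ha : 0 < a)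
    (d : ℕ) {L : ℝ} (hL : 0 ≤ L) :
    ∃ c C : ℝ, 0 < c ∧ 0 < C ∧ ∀ ρ ∈ Icc a b, ∀ r ∈ Icc a b, ∀ q y m u : Vec d,
      (∀ i, |y i| ≤ L) →
      c * relDensity ρ r q y m u ≤ relEnergy h κ ρ r q y m u ∧
      relEnergy h κ ρ r q y m u ≤ C * relDensity ρ r q y m u ∧
      ∀ (U : Fin d → Fin d → ℝ) (W : Fin d → ℝ), (∀ i j, |U i j| ≤ L) → (∀ k, |W k| ≤ d * L) →
        |relRate h κ ρ r q y m u U W| ≤ C * relDensity ρ r q y m u := by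
  obtain ⟨α, hα0, hα⟩ := hF.h_uniform
  obtain ⟨β, hβ0, hβ⟩ := hF.κ_uniform
  obtain ⟨K1, hK1, b1⟩ := exists_relF_upper hF.smooth_h hF.smooth_κ (b := b) ha d hL
  obtain ⟨K2, hK2, b2⟩ := exists_relScalar_bound hF.smooth_h hF.smooth_κ (b := b) ha d hL
  obtain ⟨K3, hK3, b3⟩ := exists_relVector_bound hF.smooth_κ (b := b) ha d hL
  obtain ⟨K4, hK4, b4⟩ := exists_relTensor_bound hF.smooth_κ (b := b) ha d hL
  set c := min 1 (min (α / 2) (β / 2)) with hc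
  have c1 : c ≤ 1 := min_le_left _ _
  have c2 : c ≤ α / 2 := (min_le_right _ _).trans (min_le_left _ _)
  have c3 : c ≤ β / 2 := (min_le_right _ _).trans (min_le_right _ _)
  -- The sum covers both upper bounds: `1` and `K1` serve the relative energy, and the other terms
  -- are the factors from the convective, scalar, vector and tensor contributions to the rate.
  set C := 1 + K1 + 2 * (d * (d * L)) + K2 * (d * L) + d * (K3 * (d * L)) + d * (d * (K4 * L))
    with hC
  refine ⟨c, C, lt_min one_pos (lt_min (by positivity) (by positivity)), by positivity,
    fun ρ hρ r hr q y m u hy => ?_⟩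
  have hρ0 : 0 < ρ := ha.trans_le hρ.1
  have hr0 : 0 < r := ha.trans_le hr.1
  set A := 1 / 2 * ρ * ‖ρ⁻¹ • m - u‖ ^ 2 with hA
  set B := (ρ - r) ^ 2 + ∑ k, (q k - y k) ^ 2 with hB
  have A0 : 0 ≤ A := by positivity
  have G0 : 0 ≤ ∑ k, (q k - y k) ^ 2 := Finset.sum_nonneg fun k _ => sq_nonneg _
  have B0 : 0 ≤ B := by positivity
  have eD : relDensity ρ r q y m u = A + B := by
    rw [relDensity, sum_sq_sub q y, sq_abs, hA, hB]
    ring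
  rw [eD]
  have up : ∀ {x K : ℝ}, 0 ≤ K → |x| ≤ K * B → ∀ {z Z : ℝ}, |z| ≤ Z → 0 ≤ Z →
      |x * z| ≤ K * Z * B := fun {x K} hK hx {z Z} hz hZ => by
    rw [abs_mul]
    exact (mul_le_mul hx hz (abs_nonneg _) (by positivity)).trans (le_of_eq (by ring))
  refine ⟨?_, ?_, fun U W hU hW => ?_⟩
  · have low := relF_lower hF.smooth_h hF.smooth_κ hF.κ_convex hα hβ hρ0 hr0 q y
    rw [relEnergy, ← hA]
    have e1 := mul_le_mul_of_nonneg_right c1 A0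
    have e2 := mul_le_mul_of_nonneg_right c2 (sq_nonneg (ρ - r))
    have e3 := mul_le_mul_of_nonneg_right c3 G0
    rw [hB]
    linarith
  · rw [relEnergy, ← hA]
    have e1 := (abs_le.1 (b1 ρ hρ r hr q y hy)).2
    rw [← hB] at e1
    have e2 : K1 * B ≤ C * B := mul_le_mul_of_nonneg_right (by
      rw [hC]
      have : 0 ≤ 2 * (d * (d * L)) + K2 * (d * L) + d * (K3 * (d * L)) + d * (d * (K4 * L)) := by
        positivity
      linarith) B0
    have e3 : 1 * A ≤ C * A := mul_le_mul_of_nonneg_right (by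
      rw [hC]
      have : 0 ≤ K1 + 2 * (d * (d * L)) + K2 * (d * L) + d * (K3 * (d * L)) +
        d * (d * (K4 * L)) := by positivity
      linarith) A0
    linarith
  · have f1 : |ρ * ∑ i, ∑ j, (m i / ρ - u i) * (m j / ρ - u j) * U i j| ≤
        2 * (d * (d * L)) * A := by
      rw [abs_mul, abs_of_pos hρ0, hA, sum_sq_velocity]
      refine (mul_le_mul_of_nonneg_left (abs_double_sum_le (w := fun i => m i / ρ - u i) hU)
        hρ0.le).trans (le_of_eq (by ring))
    have f2 : |relScalar h κ ρ r q y * ∑ i, U i i| ≤ K2 * (d * L) * B := by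
      refine up hK2 (b2 ρ hρ r hr q y hy) ?_ (by positivity)
      refine (Finset.abs_sum_le_sum_abs _ _).trans
        ((Finset.sum_le_card_nsmul _ _ L fun i _ => hU i i).trans (le_of_eq (by simp)))
    have f3 : |∑ k, relVector κ ρ r q y k * W k| ≤ d * (K3 * (d * L)) * B := by
      refine (Finset.abs_sum_le_sum_abs _ _).trans ((Finset.sum_le_card_nsmul _ _
        (K3 * (d * L) * B) fun k _ => ?_).trans (le_of_eq (by simp; ring)))
      exact up hK3 (b3 ρ hρ r hr q y hy k) (hW k) (by positivity)
    have f4 : |∑ i, ∑ j, relTensor κ ρ r q y i j * U i j| ≤ d * (d * (K4 * L)) * B := by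
      refine (Finset.abs_sum_le_sum_abs _ _).trans ((Finset.sum_le_card_nsmul _ _
        (d * (K4 * L) * B) fun i _ => (Finset.abs_sum_le_sum_abs _ _).trans
          ((Finset.sum_le_card_nsmul _ _ (K4 * L * B) fun j _ => ?_).trans
            (le_of_eq (by simp; ring)))).trans (le_of_eq (by simp; ring)))
      exact up hK4 (b4 ρ hρ r hr q y hy i j) (hU i j) hL
    rw [relRate]
    refine (abs_add_le _ _).trans ((add_le_add ((abs_add_le _ _).trans (add_le_add
      ((abs_add_le _ _).trans (add_le_add f1 f2)) f3)) f4).trans ?_)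
    have e1 : 2 * (d * (d * L)) * A ≤ C * A := mul_le_mul_of_nonneg_right (by
      rw [hC]
      have : 0 ≤ 1 + K1 + K2 * (d * L) + d * (K3 * (d * L)) + d * (d * (K4 * L)) := by
        positivity
      linarith) A0
    have e2 : (K2 * (d * L) + d * (K3 * (d * L)) + d * (d * (K4 * L))) * B ≤ C * B :=
      mul_le_mul_of_nonneg_right (by
        rw [hC]
        have : 0 ≤ 1 + K1 + 2 * (d * (d * L)) := by positivity
        linarith) B0
    linarith

end

section

/-! ### The energy inequality at each time and the Gronwall argument -/

/-- A Lipschitz cutoff that is `1` up to time `t` and vanishes from `t + ε` on. -/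
lemma exists_isTimeTest {T t ε : ℝ} (hε : 0 < ε) (hT : t + ε < T) :
    ∃ θ : ℝ → ℝ, IsTimeTest T θ ∧ (∀ s ≤ t, θ s = 1) ∧
      ∀ᵐ s : ℝ, deriv θ s = (Ioo t (t + ε)).indicator (fun _ => -ε⁻¹) s := by
  set θ : ℝ → ℝ := fun s => max 0 (min 1 ((t + ε - s) * ε⁻¹)) with hθ
  have hε' := inv_pos.2 hε
  have big : ∀ s ≤ t, θ s = 1 := fun s hs => by
    have : 1 ≤ (t + ε - s) * ε⁻¹ := by
      rw [← div_eq_mul_inv, le_div_iff₀ hε]; linarith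
    rw [hθ]
    simp [min_eq_left this]
  have small : ∀ s, t + ε ≤ s → θ s = 0 := fun s hs => by
    have : (t + ε - s) * ε⁻¹ ≤ 0 := mul_nonpos_of_nonpos_of_nonneg (by linarith) hε'.le
    rw [hθ]
    exact max_eq_left ((min_le_right _ _).trans this)
  have mid : ∀ s ∈ Ioo t (t + ε), θ s = (t + ε - s) * ε⁻¹ := fun s hs => by
    have h1 : (t + ε - s) * ε⁻¹ ≤ 1 := by
      rw [← div_eq_mul_inv, div_le_one hε]; linarith [hs.1]
    have h2 : 0 ≤ (t + ε - s) * ε⁻¹ := mul_nonneg (by linarith [hs.2]) hε'.le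
    rw [hθ]
    simp [min_eq_right h1, max_eq_right h2]
  refine ⟨θ, ⟨⟨Real.toNNReal ε⁻¹, ?_⟩, fun s => le_max_left _ _, t + ε, hT, small⟩, big, ?_⟩
  · have h1 : LipschitzWith (Real.toNNReal ε⁻¹) fun s : ℝ => (t + ε - s) * ε⁻¹ :=
      LipschitzWith.of_dist_le_mul fun x y => by
        rw [Real.dist_eq, Real.dist_eq, ← sub_mul, abs_mul, abs_of_pos hε', mul_comm,
          Real.coe_toNNReal _ hε'.le]
        refine mul_le_mul_of_nonneg_left (le_of_eq ?_) hε'.le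
        rw [abs_sub_comm x y]
        congr 1; ring
    exact (h1.const_min 1).const_max 0
  · have hne : ∀ᵐ s : ℝ, s ≠ t ∧ s ≠ t + ε := (Measure.ae_ne volume t).and (Measure.ae_ne volume _)
    filter_upwards [hne] with s hs
    rcases lt_or_gt_of_ne hs.1 with h1 | h1
    · rw [indicator_of_notMem fun h => h1.not_gt h.1]
      have : θ =ᶠ[𝓝 s] fun _ => 1 := 
        eventually_of_mem (Iio_mem_nhds h1) fun x hx => big x (le_of_lt hx)
      rw [this.deriv_eq, deriv_const]
    · rcases lt_or_gt_of_ne hs.2 with h2 | h2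
      · rw [indicator_of_mem (show s ∈ Ioo t (t + ε) from ⟨h1, h2⟩)]
        have : θ =ᶠ[𝓝 s] fun x => (t + ε - x) * ε⁻¹ :=
          eventually_of_mem (Ioo_mem_nhds h1 h2) fun x hx => mid x hx
        rw [this.deriv_eq]
        simp
      · rw [indicator_of_notMem fun h => h2.not_gt h.2]
        have : θ =ᶠ[𝓝 s] fun _ => 0 := 
        eventually_of_mem (Ioi_mem_nhds h2) fun x hx => small x (le_of_lt hx)
        rw [this.deriv_eq, deriv_const]

/-- The integrated energy inequality gives the inequality at every time. -/
lemma le_initial_of_timeTest {T : ℝ} (hT : 0 < T) {e : ℝ → ℝ} (he : ContinuousOn e (Icc 0 T))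
    (h : ∀ θ : ℝ → ℝ, IsTimeTest T θ → -∫ t in Ioo 0 T, e t * deriv θ t ≤ e 0 * θ 0) :
    ∀ t ∈ Icc 0 T, e t ≤ e 0 := by
  refine forall_le_of_ae_le hT he ((ae_restrict_mem measurableSet_Ioo).mono fun t ht => ?_)
  -- If the energy at an interior time exceeded its initial value, it would stay above some `η > e
  -- 0` shortly afterwards. A cutoff falling with slope `-1/ε` on that interval would make its
  -- average there at most `e 0`, a contradiction. The endpoints follow by continuity.
  by_contra! hlt
  have hcont : ContinuousAt e t := he.continuousAt (Icc_mem_nhds ht.1 ht.2)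
  obtain ⟨η, hη1, hη2⟩ := exists_between hlt
  obtain ⟨ε', hε', hball⟩ := Metric.eventually_nhds_iff.1 (hcont.eventually_const_lt hη2)
  set ε := min (ε' / 2) ((T - t) / 2) with hεd
  have hε : 0 < ε := lt_min (by linarith) (by linarith [ht.2])
  have hε1 : ε ≤ ε' / 2 := min_le_left _ _
  have hε2 : ε ≤ (T - t) / 2 := min_le_right _ _
  obtain ⟨θ, hθ, hθ0, hθd⟩ := exists_isTimeTest (T := T) (t := t) hε (by linarith [ht.2])
  have key := h θ hθ
  rw [hθ0 0 ht.1.le, mul_one] at key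
  have hsub : Ioo t (t + ε) ⊆ Ioo 0 T := Ioo_subset_Ioo ht.1.le (by linarith [ht.2])
  have e1 : ∫ s in Ioo 0 T, e s * deriv θ s = ∫ s in Ioo t (t + ε), e s * -ε⁻¹ := by
    have : ∫ s in Ioo 0 T, e s * deriv θ s =
        ∫ s in Ioo 0 T, (Ioo t (t + ε)).indicator (fun s => e s * -ε⁻¹) s := by
      refine integral_congr_ae (ae_restrict_of_ae ?_)
      filter_upwards [hθd] with s hs
      rw [hs]
      by_cases hm : s ∈ Ioo t (t + ε)
      · simp [indicator_of_mem hm]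
      · simp [indicator_of_notMem hm]
    rw [this, integral_indicator measurableSet_Ioo, Measure.restrict_restrict measurableSet_Ioo,
      inter_eq_left.2 hsub]
  rw [e1, integral_mul_const, mul_neg, neg_neg] at key
  have i1 : IntegrableOn e (Ioo t (t + ε)) :=
    (he.integrableOn_Icc).mono_set (hsub.trans Ioo_subset_Icc_self)
  have e2 : η * ε ≤ ∫ s in Ioo t (t + ε), e s := by
    have : ∫ _ in Ioo t (t + ε), η = η * ε := by
      simp [hε.le, mul_comm]
    rw [← this]
    refine setIntegral_mono_on (integrableOn_const (by simp)) i1 measurableSet_Ioo fun s hs => ?_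
    refine (hball ?_).le
    rw [Real.dist_eq, abs_of_pos (by linarith [hs.1])]
    linarith [hs.2]
  have e3 : η ≤ (∫ s in Ioo t (t + ε), e s) * ε⁻¹ := by
    rw [← div_eq_mul_inv, le_div_iff₀ hε]
    exact e2
  linarith

/-- The right-hand side `M` of the hypothesis satisfies `M' = KH ≤ KM`, so `M exp(-Kt)` is
nonincreasing. No sign of `A` or `H` is needed. -/
lemma gronwall_integral {T : ℝ} {H : ℝ → ℝ} {A K : ℝ} (hK : 0 ≤ K)
    (hH : ContinuousOn H (Icc 0 T)) (h : ∀ t ∈ Icc 0 T, H t ≤ A + K * ∫ s in (0 : ℝ)..t, H s) :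
    ∀ t ∈ Icc 0 T, H t ≤ A * Real.exp (K * t) := by
  intro t ht
  set M : ℝ → ℝ := fun t => A + K * ∫ s in (0 : ℝ)..t, H s with hM
  have hI : ∀ t ∈ Icc 0 T, IntervalIntegrable H volume 0 t := fun t ht =>
    (hH.mono (by rw [uIcc_of_le ht.1]; exact Icc_subset_Icc_right ht.2)).intervalIntegrable
  have hT : 0 ≤ T := ht.1.trans ht.2
  have cM : ContinuousOn M (Icc 0 T) := by
    have := intervalIntegral.continuousOn_primitive_interval' (hI T ⟨hT, le_rfl⟩)
      (left_mem_uIcc)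
    rw [uIcc_of_le hT] at this
    exact continuousOn_const.add (continuousOn_const.mul this)
  have dM : ∀ s ∈ Ioo 0 T, HasDerivAt (fun s => M s * Real.exp (-(K * s)))
      (K * H s * Real.exp (-(K * s)) + M s * (Real.exp (-(K * s)) * -(K * 1))) s := fun s hs => by
    have h1 : HasDerivAt (fun t => ∫ s in (0 : ℝ)..t, H s) (H s) s :=
      intervalIntegral.integral_hasDerivAt_right (hI s (Ioo_subset_Icc_self hs))
        ((hH.mono Ioo_subset_Icc_self).stronglyMeasurableAtFilter isOpen_Ioo s hs)
        (hH.continuousAt (Icc_mem_nhds hs.1 hs.2))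
    exact ((h1.const_mul K).const_add A).mul (((hasDerivAt_id s).const_mul K).neg.exp)
  have anti : AntitoneOn (fun s => M s * Real.exp (-(K * s))) (Icc 0 T) := by
    refine antitoneOn_of_deriv_nonpos (convex_Icc 0 T)
      (cM.mul (by fun_prop)) (fun s hs => ?_) fun s hs => ?_
    · rw [interior_Icc] at hs
      exact (dM s hs).differentiableAt.differentiableWithinAt
    · rw [interior_Icc] at hs
      rw [(dM s hs).deriv]
      have := mul_le_mul_of_nonneg_left (h s (Ioo_subset_Icc_self hs)) hK
      have e := mul_le_mul_of_nonneg_right this (Real.exp_pos (-(K * s))).le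
      simp only [hM]
      linarith
  have := anti ⟨le_rfl, hT⟩ ht ht.1
  simp only [mul_zero, neg_zero, Real.exp_zero, mul_one] at this
  have h0 : M 0 = A := by simp [hM]
  rw [h0, Real.exp_neg, ← div_eq_mul_inv, div_le_iff₀ (Real.exp_pos _)] at this
  exact (h t ht).trans this

/-- The Gronwall argument for an inequality with a rate that is only integrable in time. -/
lemma gronwall_of_rate {T : ℝ} {E J : ℝ → ℝ} {K : ℝ} (hK : 0 ≤ K)
    (hJ : IntegrableOn J (Ioo 0 T)) (hE : ∀ t ∈ Icc 0 T, E t ≤ E 0 - ∫ s in (0 : ℝ)..t, J s)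
    (hJE : ∀ᵐ s ∂(volume.restrict (Ioo 0 T)), |J s| ≤ K * E s) :
    ∀ t ∈ Icc 0 T, E t ≤ E 0 * Real.exp (K * t) := by
  intro t ht
  -- `E` is not assumed continuous and `J` is merely integrable. The Gronwall argument is run on
  -- this continuous majorant of `E`, which satisfies `-J ≤ K E ≤ K H` almost everywhere.
  set H : ℝ → ℝ := fun t => E 0 - ∫ s in (0 : ℝ)..t, J s with hH
  have hT : 0 ≤ T := ht.1.trans ht.2
  have cH : ContinuousOn H (Icc 0 T) := by
    have := intervalIntegral.continuousOn_primitive_interval'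
      (intervalIntegrable_of_Ioo hJ ⟨hT, le_rfl⟩) (left_mem_uIcc)
    rw [uIcc_of_le hT] at this
    exact continuousOn_const.sub this
  refine (hE t ht).trans (gronwall_integral hK cH (fun t ht => ?_) t ht)
  have iH : IntegrableOn H (Ioo 0 T) := cH.integrableOn_Icc.mono_set Ioo_subset_Icc_self
  have : ∫ s in (0 : ℝ)..t, -J s ≤ ∫ s in (0 : ℝ)..t, K * H s := by
    refine intervalIntegral.integral_mono_ae_restrict ht.1 (intervalIntegrable_of_Ioo hJ ht).neg
      (intervalIntegrable_of_Ioo (iH.const_mul K) ht) ?_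
    rw [← restrict_Ioo_eq_restrict_Icc]
    have hsub : Ioo 0 t ⊆ Ioo 0 T := Ioo_subset_Ioo_right ht.2
    filter_upwards [ae_restrict_of_ae_restrict_of_subset hsub hJE, ae_restrict_mem measurableSet_Ioo]
      with s hs hs'
    have h1 := hE s (Ioo_subset_Icc_self (hsub hs'))
    have h2 := mul_le_mul_of_nonneg_left h1 hK
    exact (neg_le_abs _).trans (hs.trans h2)
  rw [intervalIntegral.integral_neg, intervalIntegral.integral_const_mul] at this
  simp only [hH] at this ⊢
  linarith

end

section

/-! ### The stability estimate -/

section Stability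

variable {h κ : ℝ → ℝ} {T δ R L : ℝ} {ρ r : ℝ → Torus d → ℝ} {q y m u : ℝ → Torus d → Vec d}
  {D D' : ℝ → Torus d → ℝ} {rt : ℝ → Torus d → ℝ} {yt ut : Fin d → ℝ → Torus d → ℝ}
  {Q U : Fin d → Fin d → ℝ → Torus d → ℝ} {P V : Fin d → Fin d → Fin d → ℝ → Torus d → ℝ}

/-- Bounds on the density that hold almost everywhere on the slab hold at every time. -/
lemma IsWeakSolution.density_mem (hT : 0 < T) (hw : IsWeakSolution h κ T ρ q D m) {a b : ℝ}
    (hmem : ∀ᵐ z ∂(slab d T), ρ z.1 z.2 ∈ Icc a b) :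
    ∀ t ∈ Icc 0 T, ∀ᵐ x, ρ t x ∈ Icc a b := by
  intro t ht
  -- Centring at the midpoint turns the two-sided bound into a bound on an absolute value.
  have key := ae_abs_le_of_weakly_continuous hT (f := fun t x => ρ t x - (a + b) / 2)
    (M := (b - a) / 2) (fun t ht => (hw.continuous_ρ.1 t ht).sub (integrable_const _))
    (fun p hp => by
      refine ((hw.continuous_ρ.continuousOn_integral hp.continuous).sub
        (continuousOn_const (c := ∫ x, (a + b) / 2 * p x))).congr fun t ht => ?_
      rw [Pi.sub_apply, ← integral_sub ((hw.continuous_ρ.1 t ht).mul_continuous hp.continuous)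
        ((integrable_const _).mul_continuous hp.continuous)]
      simp_rw [sub_mul])
    (slab_ae (P := fun t x => |ρ t x - (a + b) / 2| ≤ (b - a) / 2) (hmem.mono fun z hz =>
      abs_le.2 ⟨by linarith [hz.1], by linarith [hz.2]⟩)) t ht
  filter_upwards [key] with x hx
  have := abs_le.1 hx
  exact ⟨by linarith [this.1], by linarith [this.2]⟩

/-- The definition makes only `ρκ(ρ)∇ρ` integrable on the slab. For densities in a compact part of
`(0,∞)` the factor `ρκ(ρ)` is bounded away from zero and can be divided out. -/
lemma IsWeakSolution.integrable_grad_apply (hT : 0 < T) (hw : IsWeakSolution h κ T ρ q D m)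
    (hκ : ContDiffOn ℝ ∞ κ (Ioi 0)) (hpos : ∀ s > 0, 0 < κ s) {a b : ℝ} (ha : 0 < a)
    (hmem : ∀ᵐ z ∂(slab d T), ρ z.1 z.2 ∈ Icc a b) (i : Fin d) :
    Integrable (Function.uncurry fun t x => q t x i) (slab d T) := by
  have hab : a ≤ b := by
    obtain ⟨x, hx⟩ := (hw.density_mem hT hmem 0 ⟨le_rfl, hT.le⟩).exists
    exact hx.1.trans hx.2
  have hs : ∀ s ∈ Icc a b, 0 < s * κ s := fun s hs =>
    mul_pos (ha.trans_le hs.1) (hpos s (ha.trans_le hs.1))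
  have hb : SlabBdd T (fun t x => (ρ t x * κ (ρ t x))⁻¹) :=
    SlabBdd.comp (G := fun s => (s * κ s)⁻¹) hw.measurable_ρ hmem hab
      ((continuousOn_id.mul (hκ.continuousOn.mono fun s hs => ha.trans_le hs.1)).inv₀
        fun s h => (hs s h).ne')
  refine (hb.mul_integrable (hw.integrable_vector_apply i)).congr ?_
  filter_upwards [hmem] with ⟨t, x⟩ hz
  have := (hs _ hz).ne'
  simp only [Function.uncurry, stressVector, PiLp.smul_apply, smul_eq_mul]
  dsimp only at this
  rw [mul_comm, inv_mul_cancel_left₀ this]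

lemma StrongFields.integral_relEnergy (S : StrongFields T δ R L r (fun i t x => y t x i)
    (fun i t x => u t x i) rt yt ut Q U P V) (hT : 0 < T) (hδ : 0 < δ)
    (hh : ContDiffOn ℝ ∞ h (Ioi 0)) (hκ : ContDiffOn ℝ ∞ κ (Ioi 0))
    (hw : IsWeakSolution h κ T r y D' (momentum r u)) (hw' : IsWeakSolution h κ T ρ q D m)
    {t : ℝ} (ht : t ∈ Icc 0 T) (hρ : ∀ᵐ x, 0 < ρ t x)
    (ie : Integrable fun x => totalEnergy h κ (r t x) (y t x) (momentum r u t x))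
    (ie' : Integrable fun x => totalEnergy h κ (ρ t x) (q t x) (m t x)) :
    Integrable (fun x => relEnergy h κ (ρ t x) (r t x) (q t x) (y t x) (m t x) (u t x)) ∧
    ∫ x, relEnergy h κ (ρ t x) (r t x) (q t x) (y t x) (m t x) (u t x) =
      (∫ x, totalEnergy h κ (ρ t x) (q t x) (m t x)) -
        (∫ x, totalEnergy h κ (r t x) (y t x) (momentum r u t x)) -
      ((∫ x, coupling ρ q m (fun i t x => u t x i) (densityMult h κ r y u) (gradMult κ r y) t x) -
        ∫ x, coupling r y (momentum r u) (fun i t x => u t x i) (densityMult h κ r y u)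
          (gradMult κ r y) t x) := by
  have M := S.multiplier hT hδ hh hκ
  have c1 := (M.integral_coupling hw' ht).1
  have c2 := (M.integral_coupling hw ht).1
  have e : (fun x => relEnergy h κ (ρ t x) (r t x) (q t x) (y t x) (m t x) (u t x)) =ᵐ[volume]
      fun x => totalEnergy h κ (ρ t x) (q t x) (m t x) -
        totalEnergy h κ (r t x) (y t x) (momentum r u t x) -
      (coupling ρ q m (fun i t x => u t x i) (densityMult h κ r y u) (gradMult κ r y) t x -
        coupling r y (momentum r u) (fun i t x => u t x i) (densityMult h κ r y u)
          (gradMult κ r y) t x) := by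
    filter_upwards [hρ] with x hx
    exact relEnergy_eq h κ hx.ne' (hδ.trans_le (S.mem t ht x).1).ne' _ _ _ _
  refine ⟨((ie'.sub ie).sub (c1.sub c2)).congr e.symm, ?_⟩
  rw [integral_congr_ae e, ← integral_sub ie' ie, ← integral_sub c1 c2]
  exact integral_sub (ie'.sub ie) (c1.sub c2)

lemma relDensity_nonneg {ρ : ℝ} (hρ : 0 ≤ ρ) (r : ℝ) (q y m u : Vec d) :
    0 ≤ relDensity ρ r q y m u := by
  unfold relDensity
  positivity

lemma distDensity_momentum {t : ℝ} {x : Torus d} (hr : r t x ≠ 0) :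
    distDensity ρ q m r y (momentum r u) t x =
      relDensity (ρ t x) (r t x) (q t x) (y t x) (m t x) (u t x) := by
  rw [distDensity, relDensity, momentum, inv_smul_smul₀ hr]

lemma aestronglyMeasurable_relDensity {ρ r : Torus d → ℝ} {q y m u : Torus d → Vec d}
    (hρ : AEStronglyMeasurable ρ) (hr : AEStronglyMeasurable r) (hq : AEStronglyMeasurable q)
    (hy : AEStronglyMeasurable y) (hm : AEStronglyMeasurable m) (hu : AEStronglyMeasurable u) :
    AEStronglyMeasurable fun x => relDensity (ρ x) (r x) (q x) (y x) (m x) (u x) := by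
  unfold relDensity
  have h1 : AEStronglyMeasurable fun x => (ρ x)⁻¹ := hρ.aemeasurable.inv.aestronglyMeasurable
  exact (((hρ.const_mul _).mul (((h1.smul hm).sub hu).norm.pow 2)).add
    ((hρ.sub hr).norm.pow 2)).add ((hq.sub hy).norm.pow 2)

lemma IsConservative.isDissipative (hc : IsConservative h κ T ρ q D m) :
    IsDissipative h κ T ρ q D m :=
  ⟨hc.weak, hc.continuous_energy, fun θ hθ => (hc.energy_eq θ hθ).le⟩

lemma ContinuousInL1.continuousOn_integral_one {f : ℝ → Torus d → ℝ} (hf : ContinuousInL1 T f) :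
    ContinuousOn (fun t => ∫ x, f t x) (Icc 0 T) := by
  simpa using hf.continuousOn_integral (p := fun _ => (1 : ℝ)) continuous_const

lemma IsDissipative.energy_le_initial (hT : 0 < T) (hd : IsDissipative h κ T ρ q D m) :
    ∀ t ∈ Icc 0 T, ∫ x, totalEnergy h κ (ρ t x) (q t x) (m t x) ≤
      ∫ x, totalEnergy h κ (ρ 0 x) (q 0 x) (m 0 x) :=
  le_initial_of_timeTest hT hd.continuous_energy.continuousOn_integral_one hd.energy_le

/-- The energy identity is also an inequality for minus the energy, so the strong energy cannot
drop. This direction is needed because it enters the relative energy with a negative sign. -/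
lemma IsConservative.initial_le_energy (hT : 0 < T) (hc : IsConservative h κ T ρ q D m) :
    ∀ t ∈ Icc 0 T, ∫ x, totalEnergy h κ (ρ 0 x) (q 0 x) (m 0 x) ≤
      ∫ x, totalEnergy h κ (ρ t x) (q t x) (m t x) := by
  intro t ht
  have := le_initial_of_timeTest hT (e := fun t => -∫ x, totalEnergy h κ (ρ t x) (q t x) (m t x))
    hc.continuous_energy.continuousOn_integral_one.neg (fun θ hθ => by
      have := hc.energy_eq θ hθ
      simp only [neg_mul, integral_neg]
      linarith) t ht
  exact neg_le_neg_iff.1 this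

/-- Finiteness of the distance and the stability estimate, from the pointwise comparison of the
relative energy, its rate, and the integrand of the distance. -/
theorem stability_of_pointwise_bounds {a b c C ρmin ρmax : ℝ} (hT : 0 < T) (hδ : 0 < δ)
    (hF : UniformConvexity h κ) (hc : 0 < c) (hC : 0 < C) (hmin : 0 < ρmin)
    (hI : Icc ρmin ρmax ⊆ Icc a b) (hI' : Icc δ R ⊆ Icc a b)
    (hb : ∀ ρ ∈ Icc a b, ∀ r ∈ Icc a b, ∀ q y m u : Vec d, (∀ i, |y i| ≤ |L|) →
      c * relDensity ρ r q y m u ≤ relEnergy h κ ρ r q y m u ∧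
      relEnergy h κ ρ r q y m u ≤ C * relDensity ρ r q y m u ∧
      ∀ (U : Fin d → Fin d → ℝ) (W : Fin d → ℝ), (∀ i j, |U i j| ≤ |L|) →
        (∀ k, |W k| ≤ d * |L|) → |relRate h κ ρ r q y m u U W| ≤ C * relDensity ρ r q y m u)
    (hs : IsStrongSolution h κ T r y D' u) (hr : ∀ t ∈ Icc 0 T, ∀ x, r t x ∈ Icc δ R)
    (hy : ∀ᵐ z ∂(slab d T), ‖y z.1 z.2‖ ≤ L)
    (hU : ∀ i j, WeakDerivBound T L [some j] (fun t x => u t x i))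
    (hV : ∀ i j k, WeakDerivBound T L [some j, some k] (fun t x => u t x i))
    (hd : IsDissipative h κ T ρ q D m) (hρ : ∀ᵐ z ∂(slab d T), ρ z.1 z.2 ∈ Icc ρmin ρmax) :
    (∀ t ∈ Icc 0 T, Integrable (distDensity ρ q m r y (momentum r u) t)) ∧
    ∀ t ∈ Icc 0 T, distPhi ρ q m r y (momentum r u) t ≤
      C / c * Real.exp (C / c * T) * distPhi ρ q m r y (momentum r u) 0 := by
  obtain ⟨rt, yt, ut, Q, U, P, V, S⟩ := hs.exists_fields hT hr hy hU hV
  have hw := hs.conservative.weak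
  have hw' := hd.weak
  have h0T : (0 : ℝ) ∈ Icc 0 T := ⟨le_rfl, hT.le⟩
  have hρt := hw'.density_mem hT hρ
  have iq := hw'.integrable_grad_apply hT hF.smooth_κ hF.κ_pos hmin hρ
  obtain ⟨iJ, evo⟩ := S.relative_evolution hT hδ hF.smooth_h hF.smooth_κ hw hw'
    (hρ.mono fun z hz => hmin.trans_le hz.1) iq
  have hE := fun t (ht : t ∈ Icc 0 T) => S.integral_relEnergy hT hδ hF.smooth_h hF.smooth_κ hw hw' ht
    ((hρt t ht).mono fun x hx => hmin.trans_le hx.1) (hs.conservative.continuous_energy.1 t ht)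
    (hd.continuous_energy.1 t ht)
  set E : ℝ → ℝ := fun t => ∫ x, relEnergy h κ (ρ t x) (r t x) (q t x) (y t x) (m t x) (u t x)
    with hEd
  set G : ℝ → Torus d → ℝ := fun t x => relDensity (ρ t x) (r t x) (q t x) (y t x) (m t x) (u t x)
    with hG
  have pt : ∀ t ∈ Icc 0 T, ∀ᵐ x, 0 ≤ G t x ∧
      c * G t x ≤ relEnergy h κ (ρ t x) (r t x) (q t x) (y t x) (m t x) (u t x) ∧
      relEnergy h κ (ρ t x) (r t x) (q t x) (y t x) (m t x) (u t x) ≤ C * G t x ∧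
      ∀ (U : Fin d → Fin d → ℝ) (W : Fin d → ℝ), (∀ i j, |U i j| ≤ |L|) →
        (∀ k, |W k| ≤ d * |L|) → |relRate h κ (ρ t x) (r t x) (q t x) (y t x) (m t x) (u t x) U W| ≤
          C * G t x := fun t ht => by
    filter_upwards [hρt t ht, ae_all_iff.2 fun i => S.q_le t ht i] with x h1 h2
    exact ⟨relDensity_nonneg (hmin.le.trans h1.1) _ _ _ _ _,
      hb _ (hI h1) _ (hI' (hr t ht x)) _ _ _ _ fun i => (h2 i).trans (le_abs_self L)⟩
  have hmu : ∀ t ∈ Icc 0 T, AEStronglyMeasurable (u t) := fun t ht =>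
    (hs.continuousOn_u.comp_continuous (by fun_prop : Continuous fun x : Torus d => (t, x))
      fun x => ⟨ht, mem_univ x⟩).aestronglyMeasurable
  have mG : ∀ t ∈ Icc 0 T, AEStronglyMeasurable (G t) := fun t ht =>
    aestronglyMeasurable_relDensity (hw'.continuous_ρ.1 t ht).aestronglyMeasurable
      (hw.continuous_ρ.1 t ht).aestronglyMeasurable
      (hw'.grad t ht).integrable_grad.aestronglyMeasurable
      (hw.grad t ht).integrable_grad.aestronglyMeasurable
      (hw'.continuous_m.1 t ht).aestronglyMeasurable
      (hmu t ht)
  have iG : ∀ t ∈ Icc 0 T, Integrable (G t) := fun t ht => by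
    -- Finiteness of the distance comes from convexity: its integrand is dominated by `1/c` times
    -- the relative energy density, a combination of integrable energies and couplings.
    refine ((hE t ht).1.const_mul c⁻¹).mono' (mG t ht) ((pt t ht).mono fun x hx => ?_)
    rw [Real.norm_eq_abs, abs_of_nonneg hx.1, ← div_eq_inv_mul, le_div_iff₀ hc, mul_comm]
    exact hx.2.1
  have eG : ∀ t ∈ Icc 0 T, distDensity ρ q m r y (momentum r u) t = G t := fun t ht =>
    funext fun x => distDensity_momentum (hδ.trans_le (hr t ht x).1).ne'
  have eΦ : ∀ t ∈ Icc 0 T, distPhi ρ q m r y (momentum r u) t = ∫ x, G t x := fun t ht => by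
    rw [distPhi, eG t ht]
  have lower : ∀ t ∈ Icc 0 T, c * ∫ x, G t x ≤ E t := fun t ht => by
    rw [← integral_const_mul]
    exact integral_mono_ae ((iG t ht).const_mul c) (hE t ht).1 ((pt t ht).mono fun x hx => hx.2.1)
  have upper : E 0 ≤ C * ∫ x, G 0 x := by
    rw [← integral_const_mul]
    exact integral_mono_ae (hE 0 h0T).1 ((iG 0 h0T).const_mul C)
      ((pt 0 h0T).mono fun x hx => hx.2.2.1)
  have hK : 0 ≤ C / c := (div_pos hC hc).le
  -- The weak energy does not exceed its initial value, the strong one is not below its own, and the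
  -- change of the couplings is the time integral of the rate. The rate is at most `C G ≤ (C/c)`
  -- times the relative energy after integration.
  have gron := gronwall_of_rate (E := E) hK (slab_integrableOn iJ) (fun t ht => by
    have e1 := (hE t ht).2
    have e0 := (hE 0 h0T).2
    have e2 := evo t ht
    have e3 := hd.energy_le_initial hT t ht
    have e4 := hs.conservative.initial_le_energy hT t ht
    simp only [hEd]
    rw [e1, e0, ← e2]
    linarith) (by
    filter_upwards [ae_restrict_mem measurableSet_Ioo,
      ae_all_iff.2 fun i => ae_all_iff.2 fun j => slab_ae (P := fun t x => |U i j t x| ≤ L)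
        (S.U_le i j),
      ae_all_iff.2 fun i => ae_all_iff.2 fun j => ae_all_iff.2 fun k =>
        slab_ae (P := fun t x => |V i j k t x| ≤ L) (S.V_le i j k)] with s hs' hUs hVs
    have hs := Ioo_subset_Icc_self hs'
    have b1 := norm_integral_le_of_norm_le ((iG s hs).const_mul C)
      (f := fun x => relRate h κ (ρ s x) (r s x) (q s x) (y s x) (m s x) (u s x)
        (fun i j => U i j s x) (fun k => gradDiv V k s x)) (by
      filter_upwards [pt s hs, ae_all_iff.2 fun i => ae_all_iff.2 fun j => hUs i j,
        ae_all_iff.2 fun i => ae_all_iff.2 fun j => ae_all_iff.2 fun k => hVs i j k]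
        with x h1 h2 h3
      refine h1.2.2.2 _ _ (fun i j => (h2 i j).trans (le_abs_self L)) fun k => ?_
      refine (Finset.abs_sum_le_sum_abs _ _).trans
        ((Finset.sum_le_sum fun j _ => (h3 j j k).trans (le_abs_self L)).trans ?_)
      simp)
    rw [Real.norm_eq_abs, integral_const_mul] at b1
    refine b1.trans ?_
    rw [div_mul_eq_mul_div, le_div_iff₀ hc]
    have := mul_le_mul_of_nonneg_left (lower s hs) hC.le
    linarith)
  refine ⟨fun t ht => by rw [eG t ht]; exact iG t ht, fun t ht => ?_⟩
  rw [eΦ t ht, eΦ 0 h0T]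
  have h1 := (lower t ht).trans (gron t ht)
  have g0 : 0 ≤ ∫ x, G 0 x := integral_nonneg_of_ae ((pt 0 h0T).mono fun x hx => hx.1)
  have h2 : E 0 * Real.exp (C / c * t) ≤ C * (∫ x, G 0 x) * Real.exp (C / c * T) :=
    mul_le_mul upper (Real.exp_le_exp.2 (mul_le_mul_of_nonneg_left ht.2 hK)) (Real.exp_pos _).le
      (mul_nonneg hC.le g0)
  have h3 : C / c * Real.exp (C / c * T) * ∫ x, G 0 x =
      C * (∫ x, G 0 x) * Real.exp (C / c * T) / c := by ring
  rw [h3, le_div_iff₀ hc, mul_comm]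
  exact h1.trans h2

lemma distPhi_nonneg {ρ' : ℝ → Torus d → ℝ} {q' m' : ℝ → Torus d → Vec d} {t : ℝ}
    (hρ : ∀ᵐ x, 0 ≤ ρ t x) : 0 ≤ distPhi ρ q m ρ' q' m' t :=
  integral_nonneg_of_ae (hρ.mono fun x hx => by
    simp only [Pi.zero_apply, distDensity]
    positivity)

/-- Only densities and momenta are assumed to agree; the gradients then agree because the weak
gradient of an almost everywhere equal function is unique. -/
lemma distPhi_eq_zero_of_eq (hg : IsWeakGrad (ρ 0) (q 0)) (hg' : IsWeakGrad (r 0) (y 0))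
    {m' : ℝ → Torus d → Vec d} (e1 : ρ 0 =ᵐ[volume] r 0) (e2 : m 0 =ᵐ[volume] m' 0) :
    distPhi ρ q m r y m' 0 = 0 := by
  have e3 : ∀ i, (fun x => q 0 x i) =ᵐ[volume] fun x => y 0 x i := fun i => by
    refine (hg.wkD i).unique ⟨hg.integrable, (hg'.wkD i).int_g, fun φ hφ => ?_⟩
    rw [← (hg'.wkD i).parts φ hφ]
    exact integral_congr_ae (e1.mono fun x hx => by simp only [hx])
  refine (integral_congr_ae ?_).trans (integral_zero _ _)
  filter_upwards [e1, e2, ae_all_iff.2 e3] with x h1 h2 h3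
  have h4 : q 0 x = y 0 x := by ext i; exact h3 i
  simp [distDensity, h1, h2, h4]

/-- The three nonnegative parts of the integrand vanish separately. Equality of momenta is recovered
from that of velocities because the density is positive. -/
lemma eq_of_distPhi_eq_zero {m' : ℝ → Torus d → Vec d} {t : ℝ}
    (hρ : ∀ᵐ x, 0 < ρ t x) (hi : Integrable (distDensity ρ q m r y m' t))
    (h0 : distPhi ρ q m r y m' t = 0) : ρ t =ᵐ[volume] r t ∧ m t =ᵐ[volume] m' t := by
  have hn : 0 ≤ᵐ[volume] distDensity ρ q m r y m' t := hρ.mono fun x hx => by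
    simp only [Pi.zero_apply, distDensity]
    positivity
  have hz := (integral_eq_zero_iff_of_nonneg_ae hn hi).1 h0
  have key : ∀ᵐ x, ρ t x = r t x ∧ m t x = m' t x := by
    filter_upwards [hz, hρ] with x h1 h2
    simp only [Pi.zero_apply, distDensity] at h1
    have p1 : 0 ≤ 1 / 2 * ρ t x * ‖(ρ t x)⁻¹ • m t x - (r t x)⁻¹ • m' t x‖ ^ 2 := by positivity
    have p2 : 0 ≤ |ρ t x - r t x| ^ 2 := by positivity
    have p3 : 0 ≤ ‖q t x - y t x‖ ^ 2 := by positivity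
    have z2 : |ρ t x - r t x| ^ 2 = 0 := by linarith
    have z1 : 1 / 2 * ρ t x * ‖(ρ t x)⁻¹ • m t x - (r t x)⁻¹ • m' t x‖ ^ 2 = 0 := by linarith
    have e1 : ρ t x = r t x := sub_eq_zero.1 (abs_eq_zero.1 (pow_eq_zero_iff two_ne_zero |>.1 z2))
    have e2 := norm_eq_zero.1 (pow_eq_zero_iff two_ne_zero |>.1
      ((mul_eq_zero.1 z1).resolve_left (by positivity)))
    rw [← e1, ← smul_sub] at e2
    exact ⟨e1, sub_eq_zero.1 ((smul_eq_zero.1 e2).resolve_left (inv_ne_zero h2.ne'))⟩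
  exact ⟨key.mono fun x hx => hx.1, key.mono fun x hx => hx.2⟩

end Stability

end

end EulerKorteweg

end

/-! ### The stability theorem and weak–strong uniqueness -/

theorem mainTheorem3 (d : ℕ) (h κ : ℝ → ℝ) (hF : EulerKorteweg.UniformConvexity h κ)
    (T : ℝ) (hT : 0 < T)
    (ρmin ρmax : ℝ) (hρmin : 0 < ρmin)
    (δ R : ℝ) (hδ : 0 < δ) (L : ℝ) :
    ∃ C : ℝ, 0 < C ∧
      -- the strong solution `(ρ', u')`, with gradient `q'` and momentum `ρ' u'`
      ∀ (ρ' : ℝ → EulerKorteweg.Torus d → ℝ) (q' : ℝ → EulerKorteweg.Torus d → EulerKorteweg.Vec d)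
        (D' : ℝ → EulerKorteweg.Torus d → ℝ)
        (u' : ℝ → EulerKorteweg.Torus d → EulerKorteweg.Vec d),
        EulerKorteweg.IsStrongSolution h κ T ρ' q' D' u' →
        (∀ t ∈ Set.Icc 0 T, ∀ x, ρ' t x ∈ Set.Icc δ R) →
        (∀ᵐ z ∂(EulerKorteweg.slab d T), ‖q' z.1 z.2‖ ≤ L) →
        (∀ i j, EulerKorteweg.WeakDerivBound T L [some j] (fun t x => u' t x i)) →
        (∀ i j k, EulerKorteweg.WeakDerivBound T L [some j, some k] (fun t x => u' t x i)) →
      -- the weak solution `(ρ, m)`, with gradient `q`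
      ∀ (ρ : ℝ → EulerKorteweg.Torus d → ℝ) (q : ℝ → EulerKorteweg.Torus d → EulerKorteweg.Vec d)
        (D : ℝ → EulerKorteweg.Torus d → ℝ)
        (m : ℝ → EulerKorteweg.Torus d → EulerKorteweg.Vec d),
        (EulerKorteweg.IsDissipative h κ T ρ q D m ∨ EulerKorteweg.IsConservative h κ T ρ q D m) →
        (∃ K₁ : ℝ, ∀ t ∈ Set.Ioo 0 T, ∫ x, ρ t x ≤ K₁) →
        (∃ K₂ : ℝ, ∀ t ∈ Set.Ioo 0 T,
          ∫ x, EulerKorteweg.totalEnergy h κ (ρ t x) (q t x) (m t x) ≤ K₂) →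
        (∀ᵐ z ∂(EulerKorteweg.slab d T), ρ z.1 z.2 ∈ Set.Icc ρmin ρmax) →
        -- `Φ` is finite
        (∀ t ∈ Set.Icc 0 T, MeasureTheory.Integrable
          (EulerKorteweg.distDensity ρ q m ρ' q' (EulerKorteweg.momentum ρ' u') t)) ∧
        -- the stability estimate
        (∀ t ∈ Set.Icc 0 T,
          EulerKorteweg.distPhi ρ q m ρ' q' (EulerKorteweg.momentum ρ' u') t ≤
            C * EulerKorteweg.distPhi ρ q m ρ' q' (EulerKorteweg.momentum ρ' u') 0) ∧
        -- `sup Φ = 0` if `Φ(0) = 0`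
        (EulerKorteweg.distPhi ρ q m ρ' q' (EulerKorteweg.momentum ρ' u') 0 = 0 →
          IsLUB (EulerKorteweg.distPhi ρ q m ρ' q' (EulerKorteweg.momentum ρ' u') '' Set.Icc 0 T)
            0) ∧
        -- weak-strong uniqueness
        (ρ 0 =ᵐ[MeasureTheory.volume] ρ' 0 →
          m 0 =ᵐ[MeasureTheory.volume] EulerKorteweg.momentum ρ' u' 0 →
          ∀ t ∈ Set.Icc 0 T, ρ t =ᵐ[MeasureTheory.volume] ρ' t ∧
            m t =ᵐ[MeasureTheory.volume] EulerKorteweg.momentum ρ' u' t) := by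
  -- One interval containing the ranges of both densities is fixed in advance, so the constants do
  -- not depend on the solutions. The absolute value of `L` appears because `L` carries no sign.
  obtain ⟨c, C, hc, hC, hb⟩ := EulerKorteweg.exists_pointwise_bounds hF (a := min ρmin δ)
    (b := max ρmax R) (lt_min hρmin hδ) d (abs_nonneg L)
  -- The factor `C / c` comes from passing between `Φ` and the relative energy at the two times, the
  -- exponential from Gronwall with rate `C / c`.
  have hpos : 0 < C / c * Real.exp (C / c * T) := by positivity
  refine ⟨C / c * Real.exp (C / c * T), hpos, ?_⟩
  intro r y D' u hs hr hy hU hV ρ q D m hw _ _ hρ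
  have hd : EulerKorteweg.IsDissipative h κ T ρ q D m := hw.elim id fun hc => hc.isDissipative
  have h0T : (0 : ℝ) ∈ Set.Icc 0 T := ⟨le_rfl, hT.le⟩
  have hρt := hd.weak.density_mem hT hρ
  obtain ⟨fin, stab⟩ := EulerKorteweg.stability_of_pointwise_bounds hT hδ hF hc hC hρmin
    (Set.Icc_subset_Icc (min_le_left _ _) (le_max_left _ _))
    (Set.Icc_subset_Icc (min_le_right _ _) (le_max_right _ _)) hb hs hr hy hU hV hd hρ
  have zero : EulerKorteweg.distPhi ρ q m r y (EulerKorteweg.momentum r u) 0 = 0 →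
      ∀ t ∈ Set.Icc 0 T, EulerKorteweg.distPhi ρ q m r y (EulerKorteweg.momentum r u) t = 0 := by
    intro h0 t ht
    have := stab t ht
    rw [h0, mul_zero] at this
    exact le_antisymm this (EulerKorteweg.distPhi_nonneg (hd.weak.nonneg t ht))
  refine ⟨fin, stab, fun h0 => ?_, fun e1 e2 t ht => ?_⟩
  · have : EulerKorteweg.distPhi ρ q m r y (EulerKorteweg.momentum r u) '' Set.Icc 0 T = {0} := by
      refine Set.eq_singleton_iff_unique_mem.2 ⟨⟨0, h0T, h0⟩, ?_⟩
      rintro _ ⟨t, ht, rfl⟩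
      exact zero h0 t ht
    rw [this]
    exact isLUB_singleton
  · exact EulerKorteweg.eq_of_distPhi_eq_zero ((hρt t ht).mono fun x hx => hρmin.trans_le hx.1)
      (fin t ht) (zero (EulerKorteweg.distPhi_eq_zero_of_eq (hd.weak.grad 0 h0T)
        (hs.conservative.weak.grad 0 h0T) e1 e2) t ht)
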